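/- All polygons are in the Euclidean plane. The vertices of a simple polygon may include points at which the interior angle is $180^\circ$, so one may add vertices to a polygon by marking finitely many further points on its (open) edges; this does not change it as a curve. A quadrilateral is \emph{nice} if it is convex and all four of its interior angles lie in $[60^\circ,120^\circ]$. A \emph{nice mesh extending} a simple polygon $P$ is a finite family of nice quadrilaterals whose union is $P$ together with its interior, any two of which are disjoint or meet exactly in one common vertex or exactly in one common full side, such that the mesh vertices lying on $P$ are exactly the vertices of $P$. Its size is the number of quadrilaterals. A simple polygon $P$ is a \emph{sink} if, for every polygon $P'$ obtained by adding an even number of vertices to the edges of $P$, there is a nice mesh extending $P'$. For a quadrilateral $R$, $\mathcal E(R)\ge 1$ denotes the length of the longest side of $R$ divided by the length of the shortest side. There are absolute constants $C, C'$ such that the following hold. (1) (Square sinks.) For every square $S$ we can add exactly $24$ vertices to the sides of $S$ so that the resulting polygon $S'$ is a sink and moreover: (a) if $M\ge 1$ and $S''$ is obtained from $S'$ by adding $2M$ further vertices to its edges, then there is a nice mesh extending $S''$ with at most $C M^2$ quadrilaterals; (b) if $M_1,M_2\ge 1$ and $S''$ is obtained from $S'$ by adding an even number of further vertices, at most $M_1$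 of them on one pair of opposite sides of $S$ and at most $M_2$ of them on the other pair, then there is a nice mesh extending $S''$ with at most $C M_1M_2$ quadrilaterals. (2) (Rectangular sinks.) For every rectangle $R$ we can add at most $28\lceil\mathcal E(R)\rceil$ vertices to the sides of $R$ so that the resulting polygon $R'$ is a sink and moreover: if $M_1,M_2\ge 1$ and $R''$ is obtained from $R'$ by adding an even number of further vertices, at most $M_1$ of them on one pair of opposite sides of $R$ and at most $M_2$ of them on the other pair, then there is a nice mesh extending $R''$ with at most $C'\,(\mathcal E(R)+M_1M_2)$ quadrilaterals. -/

import Mathlib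

namespace QuadMesh

/-- The Euclidean plane. -/
abbrev Plane := EuclideanSpace ℝ (Fin 2)

/-! ### Simple polygons -/

/-- The closed polygonal curve through `z 0, z 1, …`, closed up cyclically (`i + 1` is taken
modulo the number of points). -/
def polyCurve {n : ℕ} (z : Fin (n + 3) → Plane) : Set Plane :=
  ⋃ i, segment ℝ (z i) (z (i + 1))

/-- A closed polygonal curve is simple: its corners are distinct, and two different closed edges
meet at most in a common end point. -/
def IsSimpleCurve {n : ℕ} (z : Fin (n + 3) → Plane) : Prop :=
  Function.Injective z ∧
    ∀ i j, i ≠ j →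
      segment ℝ (z i) (z (i + 1)) ∩ segment ℝ (z j) (z (j + 1)) ⊆
        {z i, z (i + 1)} ∩ {z j, z (j + 1)}

/-- A simple polygon: a simple closed polygonal curve `carrier` together with its finite set of
vertices. The vertices may include, besides the points `z i` that generate the curve, finitely many
further points on the edges (where the interior angle is `180°`). -/
structure SimplePolygon where
  carrier : Set Plane
  vertices : Set Plane
  finite_vertices : vertices.Finite
  vertices_subset : vertices ⊆ carrier
  exists_curve : ∃ (n : ℕ) (z : Fin (n + 3) → Plane),
    IsSimpleCurve z ∧ carrier = polyCurve z ∧ Set.range z ⊆ vertices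

/-- `P` together with its interior, that is, with the bounded connected components of its
complement. -/
def SimplePolygon.region (P : SimplePolygon) : Set Plane :=
  P.carrier ∪ {x | x ∉ P.carrier ∧ Bornology.IsBounded (connectedComponentIn P.carrierᶜ x)}

/-- The points of `P` that are not vertices of `P`, i.e. the union of its open edges. -/
def SimplePolygon.openEdges (P : SimplePolygon) : Set Plane := P.carrier \ P.vertices

/-- The polygon obtained by adding the points of `A`, which lie on open edges of `P`, as new
vertices. -/
def SimplePolygon.addVertices (P : SimplePolygon) (A : Finset Plane)
    (hA : (A : Set Plane) ⊆ P.openEdges) : SimplePolygon where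
  carrier := P.carrier
  vertices := P.vertices ∪ A
  finite_vertices := P.finite_vertices.union A.finite_toSet
  vertices_subset := Set.union_subset P.vertices_subset (hA.trans Set.sdiff_subset)
  exists_curve := by
    obtain ⟨n, z, h1, h2, h3⟩ := P.exists_curve
    exact ⟨n, z, h1, h2, h3.trans Set.subset_union_left⟩

/-! ### Quadrilaterals -/

/-- The determinant of two plane vectors. -/
def cross (u v : Plane) : ℝ := u 0 * v 1 - u 1 * v 0

/-- The points `q 0, q 1, q 2, q 3` are, in counterclockwise order, the vertices of a
(nondegenerate) convex quadrilateral: there is a strict left turn at each of them. -/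
def IsConvexQuad (q : Fin 4 → Plane) : Prop :=
  ∀ i, 0 < cross (q (i + 1) - q i) (q (i + 2) - q (i + 1))

/-- The closed region bounded by a convex quadrilateral. -/
def cell (q : Fin 4 → Plane) : Set Plane := convexHull ℝ (Set.range q)

/-- All four interior angles are between `90° - 30°` and `90° + 30°`. -/
def IsNice (q : Fin 4 → Plane) : Prop :=
  ∀ i, EuclideanGeometry.angle (q i) (q (i + 1)) (q (i + 2)) ∈
    Set.Icc (Real.pi / 3) (2 * Real.pi / 3)

/-- Longest side length divided by shortest side length. -/
noncomputable def eccentricity (q : Fin 4 → Plane) : ℝ :=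
  (⨆ i, dist (q i) (q (i + 1))) / (⨅ i, dist (q i) (q (i + 1)))

/-! ### Nice quadrilateral meshes and sinks -/

/-- Two quadrilaterals are disjoint, or meet exactly in a common vertex, or meet exactly in a
common (full) side. -/
def MeetProperly (q q' : Fin 4 → Plane) : Prop :=
  cell q ∩ cell q' = ∅ ∨
  (∃ i j, q i = q' j ∧ cell q ∩ cell q' = {q i}) ∨
  (∃ i j, s(q i, q (i + 1)) = s(q' j, q' (j + 1)) ∧
    cell q ∩ cell q' = segment ℝ (q i) (q (i + 1)))

/-- The finite set `T` of quadrilaterals is a nice quadrilateral mesh of the interior of `P` that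
extends `P`: the elements are nice convex quadrilaterals, they fill the interior of `P`, they fit
together face to face, and the mesh vertices lying on `P` are precisely the vertices of `P`. -/
structure IsNiceMeshExtending (T : Finset (Fin 4 → Plane)) (P : SimplePolygon) : Prop where
  convex : ∀ q ∈ T, IsConvexQuad q
  nice : ∀ q ∈ T, IsNice q
  cover : ⋃ q ∈ T, cell q = P.region
  conforming : ∀ q ∈ T, ∀ q' ∈ T, q ≠ q' → MeetProperly q q'
  boundary_vertices : (⋃ q ∈ T, Set.range q) ∩ P.carrier = P.vertices

/-- `P` is a sink: whenever an even number of vertices is added to the edges of `P`, the new polygon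
is extended by a nice quadrilateral mesh of its interior. -/
def IsSink (P : SimplePolygon) : Prop :=
  ∀ (A : Finset Plane) (hA : (A : Set Plane) ⊆ P.openEdges), Even A.card →
    ∃ T, IsNiceMeshExtending T (P.addVertices A hA)

/-- Some nice mesh that extends `P` has at most `N` elements. -/
def HasNiceMeshOfSize (P : SimplePolygon) (N : ℝ) : Prop :=
  ∃ T, IsNiceMeshExtending T P ∧ (T.card : ℝ) ≤ N

/-! ### Rectangles -/

/-- A rectangle, given by its corners in cyclic order (in either orientation): a nondegenerate
parallelogram with a right angle. -/
structure Rectangle where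
  corner : Fin 4 → Plane
  ne_one : corner 1 ≠ corner 0
  ne_three : corner 3 ≠ corner 0
  parallelogram : corner 2 - corner 3 = corner 1 - corner 0
  right_angle : inner ℝ (corner 1 - corner 0) (corner 3 - corner 0) = 0

namespace Rectangle

variable (R : Rectangle)

/-- The rectangle is a square. -/
def IsSquare : Prop := dist (R.corner 0) (R.corner 1) = dist (R.corner 0) (R.corner 3)

/-- One pair of opposite sides. -/
def sides₁ : Set Plane :=
  segment ℝ (R.corner 0) (R.corner 1) ∪ segment ℝ (R.corner 2) (R.corner 3)

/-- The other pair of opposite sides. -/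
def sides₂ : Set Plane :=
  segment ℝ (R.corner 1) (R.corner 2) ∪ segment ℝ (R.corner 3) (R.corner 0)

lemma corner_two : R.corner 2 =
    R.corner 0 + ((R.corner 1 - R.corner 0) + (R.corner 3 - R.corner 0)) := by
  rw [← R.parallelogram]; abel

lemma coord_unique {t s t' s' : ℝ}
    (h : t • (R.corner 1 - R.corner 0) + s • (R.corner 3 - R.corner 0) =
      t' • (R.corner 1 - R.corner 0) + s' • (R.corner 3 - R.corner 0)) : t = t' ∧ s = s' := by
  have hu : inner ℝ (R.corner 1 - R.corner 0) (R.corner 1 - R.corner 0) ≠ 0 := by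
    simpa [sub_eq_zero] using R.ne_one
  have hv : inner ℝ (R.corner 3 - R.corner 0) (R.corner 3 - R.corner 0) ≠ 0 := by
    simpa [sub_eq_zero] using R.ne_three
  have huv := R.right_angle
  have hvu : inner ℝ (R.corner 3 - R.corner 0) (R.corner 1 - R.corner 0) = 0 := by
    rw [real_inner_comm]; exact huv
  generalize R.corner 1 - R.corner 0 = u at *
  generalize R.corner 3 - R.corner 0 = v at *
  have h1 := congrArg (fun w => inner ℝ u w) h
  have h2 := congrArg (fun w => inner ℝ v w) h
  simp only [inner_add_right, real_inner_smul_right, huv, hvu, mul_zero, add_zero, zero_add]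
    at h1 h2
  exact ⟨mul_right_cancel₀ hu h1, mul_right_cancel₀ hv h2⟩

/-- The first coordinates of the corners in the frame of the rectangle. -/
def cornerX : Fin 4 → ℝ := ![0, 1, 1, 0]

/-- The second coordinates of the corners in the frame of the rectangle. -/
def cornerY : Fin 4 → ℝ := ![0, 0, 1, 1]

lemma corner_eq (i : Fin 4) : R.corner i =
    R.corner 0 + (cornerX i • (R.corner 1 - R.corner 0) +
      cornerY i • (R.corner 3 - R.corner 0)) := by
  fin_cases i
  · simp [cornerX, cornerY]
  · simp [cornerX, cornerY]
  · simpa [cornerX, cornerY] using R.corner_two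
  · simp [cornerX, cornerY]

lemma mem_segment {i j : Fin 4} {x : Plane} (hx : x ∈ segment ℝ (R.corner i) (R.corner j)) :
    ∃ a b : ℝ, 0 ≤ a ∧ 0 ≤ b ∧ a + b = 1 ∧ x = R.corner 0 +
      ((a * cornerX i + b * cornerX j) • (R.corner 1 - R.corner 0) +
        (a * cornerY i + b * cornerY j) • (R.corner 3 - R.corner 0)) := by
  obtain ⟨a, b, ha, hb, hab, rfl⟩ := hx
  refine ⟨a, b, ha, hb, hab, ?_⟩
  rw [R.corner_eq i, R.corner_eq j]
  have : R.corner 0 = (a + b) • R.corner 0 := by rw [hab, one_smul]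
  generalize R.corner 1 - R.corner 0 = u at *
  generalize R.corner 3 - R.corner 0 = v at *
  conv_rhs => rw [this]
  module

lemma isSimpleCurve : IsSimpleCurve (n := 1) R.corner := by
  constructor
  · intro i j h
    rw [R.corner_eq i, R.corner_eq j, add_right_inj] at h
    obtain ⟨h1, h2⟩ := R.coord_unique h
    fin_cases i <;> fin_cases j <;> simp_all [cornerX, cornerY]
  · rintro i j hij x ⟨hx, hx'⟩
    obtain ⟨a, b, ha, hb, hab, h⟩ := R.mem_segment hx
    obtain ⟨a', b', ha', hb', hab', h'⟩ := R.mem_segment hx'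
    have hh := h
    rw [h', add_right_inj] at hh
    obtain ⟨h1, h2⟩ := R.coord_unique hh
    have key : ∀ k : Fin 4, cornerX k = a * cornerX i + b * cornerX (i + 1) →
        cornerY k = a * cornerY i + b * cornerY (i + 1) → x = R.corner k := by
      intro k e1 e2
      rw [R.corner_eq k, e1, e2, h]
    have hb1 : b = 1 - a := by linarith
    have hb1' : b' = 1 - a' := by linarith
    subst hb1 hb1'
    have hk : (a = 0 ∧ (i + 1 = j ∨ i + 1 = j + 1)) ∨ (a = 1 ∧ (i = j ∨ i = j + 1)) := by
      clear h h' hh hx hx' key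
      fin_cases i <;> fin_cases j <;>
        simp [cornerX, cornerY] at h1 h2 hij <;>
        first
        | (exfalso; linarith)
        | exact Or.inl ⟨by linarith, by decide⟩
        | exact Or.inr ⟨by linarith, by decide⟩
    rcases hk with ⟨rfl, hk⟩ | ⟨rfl, hk⟩
    · rw [key (i + 1) (by ring) (by ring)]
      exact ⟨by simp, by rcases hk with hk | hk <;> rw [hk] <;> simp⟩
    · rw [key i (by ring) (by ring)]
      exact ⟨by simp, by rcases hk with hk | hk <;> rw [hk] <;> simp⟩

/-- The rectangle as a simple polygon whose only vertices are the four corners. -/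
def toPolygon : SimplePolygon where
  carrier := polyCurve (n := 1) R.corner
  vertices := Set.range R.corner
  finite_vertices := Set.finite_range _
  vertices_subset := by
    rintro _ ⟨i, rfl⟩
    exact Set.mem_iUnion.2 ⟨i, left_mem_segment ℝ _ _⟩
  exists_curve := ⟨1, R.corner, R.isSimpleCurve, rfl, subset_rfl⟩

end Rectangle

end QuadMesh

/-! All constructions take place in a coordinate rectangle `[0, W] × [0, H]` similar to the given
one. A mesh is handled as a formal sum: `Fills Good N c` provides a list of nice quadrilaterals
whose oriented boundaries add up to `c` when tested against every antisymmetric function of directed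
edges. Such identities can simply be added, inner edges cancel, and pieces are glued without any
discussion of overlaps.

A filling of the marked boundary is already a mesh. Tested with the signed number of crossings with
a ray, the identity says that a generic point lies in exactly one open cell if it is in the
rectangle and in none otherwise. Tested with the indicator of a directed edge, it says that every
side is either a side, reversed, of another cell or one of the boundary edges. Hence the cells tile
the rectangle and meet face to face (`MeshData`, `exists_niceMesh_of_fills`).

To build a filling, each side gets a strip of depth `th`. Every mark of the side is continued
through the strip to its inner wall, by a line at most 30° off the perpendicular. At certain
prescribed marks, the sites, a ring is inserted (`strip_ring`): nested arches over the edge that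
starts at the site, made of directions 60° apart, which add `K` wall points near either end of that
edge. Rings change the number of wall points by any even amount. If they are larger than the number
of marks, they also force wall points with certain fixed indices to lie near the sites, wherever the
other marks are (`exists_partial_end`, `exists_strip_of_marked`). So points of opposite walls with
equal indices differ by little more than the distance of neighboring sites (`Wall.dist_le`).

The region inside the walls is divided into four grids that turn like a windmill around a tiny
central tile (`fills_windmill`). Each grid joins corresponding points of opposite walls by lines
whose slope is bounded by `Wall.dist_le`. The only obstruction left is parity: if bottom and top
differ by an odd number of wall points, so do left and right, and both defects are absorbed by a
tile with additional points on three of its sides (`fills_tile`). Near the corners a small Lipschitz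
perturbation (`cornerWarp`) fits this model to the boxes cut off by the outermost marks. The result
is `fills_rectangle`, with a number of cells bounded by the product of the numbers of marks on the
two pairs of sides.

A unit square needs three sites on each side and three further special marks, in all `4 * 6 = 24`. A
longer rectangle is cut into `⌈E⌉` boxes of nearly square shape; each joint receives boundedly many
marks, with the parity that makes both neighbors even (`fills_chain`). -/

namespace QuadMesh

/-! ### Formal sums of quadrilaterals in coordinates -/

/-- The determinant of two vectors in coordinates. -/
def det2 (u v : ℝ × ℝ) : ℝ := u.1 * v.2 - u.2 * v.1

/-- The scalar product of two vectors in coordinates. -/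
def dot2 (u v : ℝ × ℝ) : ℝ := u.1 * v.1 + u.2 * v.2

/-- Two consecutive side vectors of a counterclockwise quadrilateral that make a left turn and
enclose an angle between `60°` and `120°`. -/
def NiceTurn (u v : ℝ × ℝ) : Prop := 0 < det2 u v ∧ 3 * dot2 u v ^ 2 ≤ det2 u v ^ 2

/-- A counterclockwise convex quadrilateral with nice angles. -/
def Good (q : Fin 4 → ℝ × ℝ) : Prop := ∀ i, NiceTurn (q (i + 1) - q i) (q (i + 2) - q (i + 1))

lemma NiceTurn.neg_neg {u v : ℝ × ℝ} (h : NiceTurn u v) : NiceTurn (-u) (-v) := by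
  simpa [NiceTurn, det2, dot2] using h

lemma NiceTurn.rotate {u v : ℝ × ℝ} (h : NiceTurn u v) : NiceTurn v (-u) := by
  obtain ⟨h1, h2⟩ := h
  have e1 : det2 v (-u) = det2 u v := by simp [det2]; ring
  have e2 : dot2 v (-u) = -dot2 u v := by simp [dot2]; ring
  rw [NiceTurn, e1, e2, neg_sq]
  exact ⟨h1, h2⟩

/-- The four turns are stated for the sides `b - a`, `c - d` and the sides `d - a`, `c - b`, so that
in a grid each one compares a nearly horizontal side with a nearly vertical one. `NiceTurn.rotate`
and `NiceTurn.neg_neg` convert them into the turns along the boundary. -/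
lemma good_mk {a b c d : ℝ × ℝ} (h1 : NiceTurn (b - a) (d - a)) (h2 : NiceTurn (b - a) (c - b))
    (h3 : NiceTurn (c - d) (c - b)) (h4 : NiceTurn (c - d) (d - a)) : Good ![a, b, c, d] := by
  intro i
  fin_cases i
  · exact h2
  · simpa using h3.rotate
  · simpa using h4.neg_neg
  · have := h1.rotate.neg_neg.neg_neg.rotate.rotate
    simpa using this

/-- The boundary of a quadrilateral, as a functional on functions of directed edges. -/
def bd (f : ℝ × ℝ → ℝ × ℝ → ℝ) (q : Fin 4 → ℝ × ℝ) : ℝ := ∑ i, f (q i) (q (i + 1))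

lemma bd_mk (f : ℝ × ℝ → ℝ × ℝ → ℝ) (a b c d : ℝ × ℝ) :
    bd f ![a, b, c, d] = f a b + f b c + f c d + f d a := by
  simp [bd, Fin.sum_univ_four]

/-- A function of directed edges that changes sign when the edge is reversed. -/
def Antisymm (f : ℝ × ℝ → ℝ × ℝ → ℝ) : Prop := ∀ p q, f q p = -f p q

/-- At most `N` quadrilaterals with the property `G` have boundaries that add up to `c`. -/
def Fills (G : (Fin 4 → ℝ × ℝ) → Prop) (N : ℕ) (c : (ℝ × ℝ → ℝ × ℝ → ℝ) → ℝ) : Prop :=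
  ∃ L : List (Fin 4 → ℝ × ℝ), L.length ≤ N ∧ (∀ q ∈ L, G q) ∧
    ∀ f, Antisymm f → (L.map (bd f)).sum = c f

/-! ### Addition, transport and reflection of fillings. -/

namespace Fills

variable {G G' : (Fin 4 → ℝ × ℝ) → Prop} {N N' : ℕ} {c c' : (ℝ × ℝ → ℝ × ℝ → ℝ) → ℝ}

lemma zero : Fills G 0 (fun _ => 0) := ⟨[], by simp, by simp, by simp⟩

lemma add (h : Fills G N c) (h' : Fills G N' c') : Fills G (N + N') (fun f => c f + c' f) := by
  obtain ⟨L, h1, h2, h3⟩ := h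
  obtain ⟨L', h1', h2', h3'⟩ := h'
  refine ⟨L ++ L', by simp; omega, ?_, fun f hf => by simp [h3 f hf, h3' f hf]⟩
  intro q hq
  rcases List.mem_append.1 hq with hq | hq
  exacts [h2 q hq, h2' q hq]

lemma single {a b d e : ℝ × ℝ} (h : G ![a, b, d, e]) :
    Fills G 1 (fun f => f a b + f b d + f d e + f e a) :=
  ⟨[![a, b, d, e]], by simp, by simpa using h, fun f _ => by simp [bd_mk]⟩

lemma mono (h : Fills G N c) (hN : N ≤ N') (hc : ∀ f, Antisymm f → c f = c' f) :
    Fills G N' c' := by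
  obtain ⟨L, h1, h2, h3⟩ := h
  exact ⟨L, h1.trans hN, h2, fun f hf => (h3 f hf).trans (hc f hf)⟩

lemma map (φ : ℝ × ℝ → ℝ × ℝ) (h : Fills (fun q => G (fun i => φ (q i))) N c) :
    Fills G N (fun f => c (fun x y => f (φ x) (φ y))) := by
  obtain ⟨L, h1, h2, h3⟩ := h
  refine ⟨L.map (fun q i => φ (q i)), by simpa using h1, by simpa using h2, fun f hf => ?_⟩
  beta_reduce
  rw [← h3 (fun x y => f (φ x) (φ y)) (fun x y => hf _ _), List.map_map]
  rfl

/-- A reflection reverses the orientation of the quadrilaterals. -/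
lemma map_reverse (φ : ℝ × ℝ → ℝ × ℝ)
    (h : Fills (fun q => G ![φ (q 1), φ (q 0), φ (q 3), φ (q 2)]) N c) :
    Fills G N (fun f => -c (fun x y => f (φ x) (φ y))) := by
  obtain ⟨L, h1, h2, h3⟩ := h
  refine ⟨L.map (fun q => ![φ (q 1), φ (q 0), φ (q 3), φ (q 2)]), by simpa using h1,
    by simpa using h2, fun f hf => ?_⟩
  beta_reduce
  rw [← h3 (fun x y => f (φ x) (φ y)) (fun x y => hf _ _), List.map_map]
  clear h1 h2 h3
  induction L with
  | nil => simp
  | cons q L ih =>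
    have := hf (φ (q 0)) (φ (q 1))
    have := hf (φ (q 1)) (φ (q 2))
    have := hf (φ (q 2)) (φ (q 3))
    have := hf (φ (q 3)) (φ (q 0))
    have e : bd (fun x y => f (φ x) (φ y)) q = f (φ (q 0)) (φ (q 1)) + f (φ (q 1)) (φ (q 2)) +
        f (φ (q 2)) (φ (q 3)) + f (φ (q 3)) (φ (q 0)) := by
      simp [bd, Fin.sum_univ_four]
    rw [List.map_cons, List.sum_cons, ih, List.map_cons, List.sum_cons, e, Function.comp_apply,
      bd_mk]
    linarith

lemma imp (h : Fills G N c) (hG : ∀ q, G q → G' q) : Fills G' N c := by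
  obtain ⟨L, h1, h2, h3⟩ := h
  exact ⟨L, h1, fun q hq => hG q (h2 q hq), h3⟩

end Fills

/-- The sum of a function over the consecutive pairs of a list. -/
def pathSum {α : Type*} (f : α → α → ℝ) : List α → ℝ
  | [] => 0
  | [_] => 0
  | a :: b :: l => f a b + pathSum f (b :: l)

@[simp] lemma pathSum_nil {α : Type*} (f : α → α → ℝ) : pathSum f [] = 0 := rfl

@[simp] lemma pathSum_singleton {α : Type*} (f : α → α → ℝ) (a : α) : pathSum f [a] = 0 := rfl

@[simp] lemma pathSum_cons_cons {α : Type*} (f : α → α → ℝ) (a b : α) (l : List α) :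
    pathSum f (a :: b :: l) = f a b + pathSum f (b :: l) := rfl

lemma pathSum_append {α : Type*} (f : α → α → ℝ) (l l' : List α) (a : α) :
    pathSum f (l ++ a :: l') = pathSum f (l ++ [a]) + pathSum f (a :: l') := by
  induction l with
  | nil => simp
  | cons b l ih =>
    cases l with
    | nil => simp
    | cons b' l => simpa [add_assoc] using ih

lemma pathSum_map {α β : Type*} (f : β → β → ℝ) (g : α → β) (l : List α) :
    pathSum f (l.map g) = pathSum (fun x y => f (g x) (g y)) l := by
  induction l with
  | nil => rfl
  | cons a l ih =>
    cases l with
    | nil => rfl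
    | cons b l => simpa using ih

lemma pathSum_reverse (f : ℝ × ℝ → ℝ × ℝ → ℝ) (hf : Antisymm f) (l : List (ℝ × ℝ)) :
    pathSum f l.reverse = -pathSum f l := by
  induction l with
  | nil => simp
  | cons a l ih =>
    cases l with
    | nil => simp
    | cons b l =>
      have e : (a :: b :: l).reverse = l.reverse ++ b :: [a] := by simp
      have e' : l.reverse ++ [b] = (b :: l).reverse := by simp
      rw [e, pathSum_append, e', ih]
      simp [hf a b]

/-- The basic filling: a grid swept out by a list of lines. -/
lemma fills_column {τ : Type*} {G : (Fin 4 → ℝ × ℝ) → Prop} {S : τ → τ → Prop}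
    (e e' : τ → ℝ × ℝ)
    (hG : ∀ y y', S y y' → G ![e y, e' y, e' y', e y']) (y : τ) (q : List τ)
    (hq : (y :: q).IsChain S) :
    Fills G q.length (fun f => f (e y) (e' y) + pathSum f ((y :: q).map e') -
      f (e (q.getLastD y)) (e' (q.getLastD y)) - pathSum f ((y :: q).map e)) := by
  induction q generalizing y with
  | nil => exact Fills.zero.mono le_rfl (fun f _ => by simp)
  | cons y' q ih =>
    rw [List.isChain_cons_cons] at hq
    have h1 := Fills.single (hG y y' hq.1)
    refine (h1.add (ih y' hq.2)).mono (by simp [add_comm]) (fun f hf => ?_)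
    have e1 := hf (e y') (e' y')
    have e2 := hf (e y') (e y)
    simp only [List.map_cons, pathSum_cons_cons, List.getLastD_cons]
    linarith

/-- Neighboring columns share a path that enters the two sums with opposite signs. -/
lemma fills_grid {α τ : Type*} {G : (Fin 4 → ℝ × ℝ) → Prop} {R : α → α → Prop}
    {S : τ → τ → Prop} (e : α → τ → ℝ × ℝ)
    (hG : ∀ l l' y y', R l l' → S y y' → G ![e l y, e l' y, e l' y', e l y'])
    (l : α) (ls : List α) (hl : (l :: ls).IsChain R) (y : τ) (q : List τ)
    (hq : (y :: q).IsChain S) :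
    Fills G (ls.length * q.length) (fun f => pathSum f ((l :: ls).map (e · y)) +
      pathSum f ((y :: q).map (e (ls.getLastD l))) -
      pathSum f ((l :: ls).map (e · (q.getLastD y))) - pathSum f ((y :: q).map (e l))) := by
  induction ls generalizing l with
  | nil => exact Fills.zero.mono (by simp) (fun f _ => by simp)
  | cons l' ls ih =>
    rw [List.isChain_cons_cons] at hl
    have h1 := fills_column (G := G) (e l) (e l') (fun y y' h => hG _ _ y y' hl.1 h) y q hq
    refine (h1.add (ih l' hl.2)).mono (by simp; ring_nf; rfl) (fun f hf => ?_)
    simp only [List.map_cons, pathSum_cons_cons, List.getLastD_cons]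
    ring

/-! ### Convex quadrilaterals in coordinates -/

/-- A counterclockwise convex quadrilateral in coordinates. -/
def Convex4 (q : Fin 4 → ℝ × ℝ) : Prop := ∀ i, 0 < det2 (q (i + 1) - q i) (q (i + 2) - q (i + 1))

/-- The affine function that vanishes on the `i`-th side and is positive to its left. -/
def side (q : Fin 4 → ℝ × ℝ) (i : Fin 4) (x : ℝ × ℝ) : ℝ := det2 (q (i + 1) - q i) (x - q i)

/-- The closed region of a convex quadrilateral, as an intersection of half planes. -/
def closedQuad (q : Fin 4 → ℝ × ℝ) : Set (ℝ × ℝ) := {x | ∀ i, 0 ≤ side q i x}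

/-- The open region of a convex quadrilateral. -/
def openQuad (q : Fin 4 → ℝ × ℝ) : Set (ℝ × ℝ) := {x | ∀ i, 0 < side q i x}

lemma continuous_det2 (p q : ℝ × ℝ) : Continuous fun x : ℝ × ℝ => det2 p (x - q) := by
  unfold det2; fun_prop

lemma continuous_side (q : Fin 4 → ℝ × ℝ) (i : Fin 4) : Continuous (side q i) :=
  continuous_det2 _ _

lemma side_combo (q : Fin 4 → ℝ × ℝ) (i : Fin 4) {a b : ℝ} (hab : a + b = 1) (x y : ℝ × ℝ) :
    side q i (a • x + b • y) = a * side q i x + b * side q i y := by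
  obtain rfl : b = 1 - a := by linarith
  simp [side, det2]; ring

lemma convex_closedQuad (q : Fin 4 → ℝ × ℝ) : Convex ℝ (closedQuad q) := by
  intro x hx y hy a b ha hb hab i
  rw [side_combo q i hab]
  have := hx i
  have := hy i
  positivity

lemma isClosed_closedQuad (q : Fin 4 → ℝ × ℝ) : IsClosed (closedQuad q) := by
  have : closedQuad q = ⋂ i, {x | 0 ≤ side q i x} := by ext; simp [closedQuad]
  rw [this]
  exact isClosed_iInter fun i => isClosed_le continuous_const (continuous_side q i)

lemma isOpen_openQuad (q : Fin 4 → ℝ × ℝ) : IsOpen (openQuad q) := by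
  have : openQuad q = ⋂ i, {x | 0 < side q i x} := by ext; simp [openQuad]
  rw [this]
  exact isOpen_iInter_of_finite fun i => isOpen_lt continuous_const (continuous_side q i)

lemma openQuad_subset (q : Fin 4 → ℝ × ℝ) : openQuad q ⊆ closedQuad q := fun _ hx i => (hx i).le

@[simp] lemma side_self (q : Fin 4 → ℝ × ℝ) (i : Fin 4) : side q i (q i) = 0 := by
  simp [side, det2]

@[simp] lemma side_succ (q : Fin 4 → ℝ × ℝ) (i : Fin 4) : side q i (q (i + 1)) = 0 := by
  simp [side, det2]; ring

/-! ### Incidences of points, vertices and sides in one convex quadrilateral. -/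

namespace Convex4

variable {q : Fin 4 → ℝ × ℝ} (hq : Convex4 q)
include hq

lemma side_two_pos (i : Fin 4) : 0 < side q i (q (i + 2)) := by
  have := hq i
  simp only [side, det2, Prod.fst_sub, Prod.snd_sub] at *
  linarith

lemma side_three_pos (i : Fin 4) : 0 < side q i (q (i + 3)) := by
  have := hq (i + 3)
  have e1 : i + 3 + 1 = i := by rw [add_assoc]; simp
  have e2 : i + 3 + 2 = i + 1 := by rw [add_assoc]; congr 1
  rw [e1, e2] at this
  simp only [side, det2, Prod.fst_sub, Prod.snd_sub] at *
  linarith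

lemma vertex_mem (j : Fin 4) : q j ∈ closedQuad q := by
  intro i
  obtain ⟨k, rfl⟩ : ∃ k, j = i + k := ⟨j - i, by simp⟩
  fin_cases k
  · simp
  · simp
  · exact (hq.side_two_pos i).le
  · exact (hq.side_three_pos i).le

lemma openQuad_nonempty : ∃ x, x ∈ openQuad q := by
  refine ⟨(1 / 2 : ℝ) • q 0 + (1 / 2 : ℝ) • q 2, fun i => ?_⟩
  rw [side_combo q i (by norm_num)]
  have h0 := hq.vertex_mem 0 i
  have h2 := hq.vertex_mem 2 i
  have : 0 < side q i (q 0) ∨ 0 < side q i (q 2) := by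
    fin_cases i
    · exact Or.inr (hq.side_two_pos 0)
    · exact Or.inl (hq.side_three_pos 1)
    · exact Or.inl (hq.side_two_pos 2)
    · exact Or.inr (hq.side_three_pos 3)
  rcases this with h | h <;> linarith

lemma subset_closure : closedQuad q ⊆ closure (openQuad q) := by
  intro x hx
  obtain ⟨c, hc⟩ := hq.openQuad_nonempty
  have hcont : Continuous fun t : ℝ => (1 - t) • x + t • c := by fun_prop
  have h0 : Filter.Tendsto (fun t : ℝ => (1 - t) • x + t • c) (nhdsWithin 0 (Set.Ioi 0))
      (nhds x) := by
    have := hcont.tendsto 0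
    simp only [sub_zero, one_smul, zero_smul, add_zero] at this
    exact this.mono_left nhdsWithin_le_nhds
  refine mem_closure_of_tendsto h0 ?_
  have : Set.Ioo (0 : ℝ) 1 ∈ nhdsWithin (0 : ℝ) (Set.Ioi 0) := Ioo_mem_nhdsGT one_pos
  filter_upwards [this] with t ht i
  rw [side_combo q i (by ring)]
  have h1 := hx i
  have h2 := hc i
  have h3 : 0 < 1 - t := by linarith [ht.2]
  have h4 := ht.1
  positivity

/-- A point of a convex quadrilateral on the line of a side lies on this side. -/
lemma exists_of_side_eq_zero {x : ℝ × ℝ} (hx : x ∈ closedQuad q) {i : Fin 4}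
    (h : side q i x = 0) : ∃ t : ℝ, 0 ≤ t ∧ t ≤ 1 ∧ x = (1 - t) • q i + t • q (i + 1) := by
  obtain ⟨t, rfl⟩ : ∃ t : ℝ, x = (1 - t) • q i + t • q (i + 1) := by
    have hne := hq i
    generalize q (i + 2) = r at *
    simp only [side, det2, Prod.fst_sub, Prod.snd_sub] at h hne
    by_cases h1 : (q (i + 1)).1 - (q i).1 = 0
    · have h2 : (q (i + 1)).2 - (q i).2 ≠ 0 := by
        intro h2; rw [h1, h2] at hne; simp at hne
      refine ⟨(x.2 - (q i).2) / ((q (i + 1)).2 - (q i).2), ?_⟩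
      rw [h1] at h
      have h3 : x.1 - (q i).1 = 0 := by
        have : ((q (i + 1)).2 - (q i).2) * (x.1 - (q i).1) = 0 := by linarith
        exact (mul_eq_zero.1 this).resolve_left h2
      ext
      · simp only [Prod.fst_add, Prod.smul_fst, smul_eq_mul]
        rw [show (q (i + 1)).1 = (q i).1 by linarith]; linarith
      · simp only [Prod.snd_add, Prod.smul_snd, smul_eq_mul]
        field_simp; ring
    · refine ⟨(x.1 - (q i).1) / ((q (i + 1)).1 - (q i).1), ?_⟩
      ext
      · simp only [Prod.fst_add, Prod.smul_fst, smul_eq_mul]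
        field_simp; ring
      · simp only [Prod.snd_add, Prod.smul_snd, smul_eq_mul]
        field_simp; linarith
  refine ⟨t, ?_, ?_, rfl⟩
  · have h1 := hx (i + 3)
    have h2 := hq.side_two_pos (i + 3)
    have e1 : i + 3 + 1 = i := by rw [add_assoc]; simp
    have e2 : i + 3 + 2 = i + 1 := by rw [add_assoc]; congr 1
    have h3 := side_succ q (i + 3)
    rw [e1] at h3
    rw [e2] at h2
    rw [side_combo _ _ (by ring), h3] at h1
    by_contra! ht
    nlinarith
  · have h1 := hx (i + 1)
    have h2 := hq.side_three_pos (i + 1)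
    have e1 : i + 1 + 3 = i := by rw [add_assoc]; simp
    have h3 := side_self q (i + 1)
    rw [e1] at h2
    rw [side_combo _ _ (by ring), h3] at h1
    by_contra! ht
    nlinarith

lemma side_pos_of_ne {x : ℝ × ℝ} (hx : x ∈ closedQuad q) {i : Fin 4}
    (h : side q i x = 0) (h0 : x ≠ q i) (h1 : x ≠ q (i + 1)) {j : Fin 4} (hj : j ≠ i) :
    0 < side q j x := by
  obtain ⟨t, ht0, ht1, rfl⟩ := hq.exists_of_side_eq_zero hx h
  have ht0' : 0 < t := by
    refine lt_of_le_of_ne ht0 fun e => h0 ?_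
    rw [← e]; simp
  have ht1' : 0 < 1 - t := by
    refine lt_of_le_of_ne (by linarith) fun e => h1 ?_
    rw [← e, show t = 1 by linarith]; simp
  rw [side_combo q j (by ring)]
  have g0 := hq.vertex_mem i j
  have g1 := hq.vertex_mem (i + 1) j
  have : 0 < side q j (q i) ∨ 0 < side q j (q (i + 1)) := by
    clear hx h h0 h1 g0 g1
    fin_cases i <;> fin_cases j <;>
      first
      | exact absurd rfl hj
      | exact Or.inl (hq.side_two_pos _)
      | exact Or.inl (hq.side_three_pos _)
      | exact Or.inr (hq.side_two_pos _)
  rcases this with h | h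
  · have := mul_pos ht1' h
    have := mul_nonneg ht0 g1
    linarith
  · have := mul_pos ht0' h
    have := mul_nonneg ht1'.le g0
    linarith

lemma ne_succ (i : Fin 4) : q i ≠ q (i + 1) := by
  intro h
  have := hq i
  rw [← h] at this
  simp [det2] at this

omit hq in
/-- A nonempty convex subset of the boundary lies on one side. -/
lemma exists_side_of_convex {s : Set (ℝ × ℝ)} (hs : Convex ℝ s) (hsq : s ⊆ closedQuad q)
    (hd : Disjoint s (openQuad q)) : ∃ i, ∀ x ∈ s, side q i x = 0 := by
  by_contra! h
  choose x hx hne using h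
  have hpos : ∀ i, 0 < side q i (x i) := fun i => lt_of_le_of_ne (hsq (hx i) i) (hne i).symm
  -- If no side contained `s`, averaging four points of `s`, the `i`-th strictly to the left of side
  -- `i`, would give a point of `s` in the open quadrilateral.
  have e : ∀ a b : ℝ × ℝ, a ∈ s → b ∈ s → ∃ c ∈ s, ∀ i, (0 < side q i a ∨ 0 < side q i b) →
      0 < side q i c := by
    intro a b ha hb
    refine ⟨(1 / 2 : ℝ) • a + (1 / 2 : ℝ) • b, hs ha hb (by norm_num) (by norm_num) (by norm_num),
      fun i hi => ?_⟩
    rw [side_combo q i (by norm_num)]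
    have := hsq ha i
    have := hsq hb i
    rcases hi with hi | hi <;> linarith
  obtain ⟨c, hc, hc'⟩ := e _ _ (hx 0) (hx 1)
  obtain ⟨d, hd1, hd'⟩ := e _ _ (hx 2) (hx 3)
  obtain ⟨z, hz, hz'⟩ := e c d hc hd1
  refine Set.disjoint_left.1 hd hz fun i => hz' i ?_
  fin_cases i
  · exact Or.inl (hc' _ (Or.inl (hpos 0)))
  · exact Or.inl (hc' _ (Or.inr (hpos 1)))
  · exact Or.inr (hd' _ (Or.inl (hpos 2)))
  · exact Or.inr (hd' _ (Or.inr (hpos 3)))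

lemma side_zero_inter (i : Fin 4) :
    closedQuad q ∩ {x | side q i x = 0} = segment ℝ (q i) (q (i + 1)) := by
  ext x
  constructor
  · rintro ⟨hx, h⟩
    obtain ⟨t, h0, h1, rfl⟩ := hq.exists_of_side_eq_zero hx h
    exact ⟨1 - t, t, by linarith, h0, by ring, rfl⟩
  · intro hx
    refine ⟨(convex_closedQuad q).segment_subset (hq.vertex_mem i) (hq.vertex_mem _) hx, ?_⟩
    obtain ⟨a, b, -, -, hab, rfl⟩ := hx
    simp [side_combo q i hab]

end Convex4

/-- The three determinants, divided by their sum, are the barycentric coordinates of `x`. -/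
lemma mem_hull_triangle {a b c x : ℝ × ℝ} {s : Set (ℝ × ℝ)} (hs : Convex ℝ s) (ha : a ∈ s)
    (hb : b ∈ s) (hc : c ∈ s) (h : 0 < det2 (b - a) (c - a)) (h1 : 0 ≤ det2 (b - a) (x - a))
    (h2 : 0 ≤ det2 (c - b) (x - b)) (h3 : 0 ≤ det2 (a - c) (x - c)) : x ∈ s := by
  have e : det2 (b - a) (x - a) + det2 (c - b) (x - b) + det2 (a - c) (x - c) =
      det2 (b - a) (c - a) := by simp [det2]; ring
  have key : x = (det2 (c - b) (x - b) / det2 (b - a) (c - a)) • a +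
      (det2 (a - c) (x - c) / det2 (b - a) (c - a)) • b +
      (det2 (b - a) (x - a) / det2 (b - a) (c - a)) • c := by
    have hd := h.ne'
    ext
    · simp only [Prod.fst_add, Prod.smul_fst, smul_eq_mul]
      field_simp
      simp only [det2, Prod.fst_sub, Prod.snd_sub]; ring
    · simp only [Prod.snd_add, Prod.smul_snd, smul_eq_mul]
      field_simp
      simp only [det2, Prod.fst_sub, Prod.snd_sub]; ring
  rw [key]
  have := hs.sum_mem (t := Finset.univ) (w := ![det2 (c - b) (x - b) / det2 (b - a) (c - a),
    det2 (a - c) (x - c) / det2 (b - a) (c - a), det2 (b - a) (x - a) / det2 (b - a) (c - a)])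
    (z := ![a, b, c]) ?_ ?_ ?_
  · simpa [Fin.sum_univ_three] using this
  · intro i _; fin_cases i
    · exact div_nonneg h2 h.le
    · exact div_nonneg h3 h.le
    · exact div_nonneg h1 h.le
  · simp only [Fin.sum_univ_three, Matrix.cons_val]
    rw [← add_div, ← add_div, div_eq_one_iff_eq h.ne']; linarith
  · intro i _; fin_cases i
    exacts [ha, hb, hc]

lemma Convex4.closedQuad_eq {q : Fin 4 → ℝ × ℝ} (hq : Convex4 q) :
    closedQuad q = convexHull ℝ (Set.range q) := by
  apply Set.Subset.antisymm
  · intro x hx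
    have hm : ∀ i, q i ∈ convexHull ℝ (Set.range q) := fun i =>
      subset_convexHull ℝ _ (Set.mem_range_self i)
    have hs := convex_convexHull ℝ (Set.range q)
    by_cases h : 0 ≤ det2 (q 2 - q 0) (x - q 0)
    · refine mem_hull_triangle hs (hm 0) (hm 2) (hm 3) ?_ h (hx 2) (hx 3)
      have := hq.side_two_pos 2
      simp only [side, det2, Prod.fst_sub, Prod.snd_sub, Fin.reduceAdd] at *
      linarith
    · refine mem_hull_triangle hs (hm 0) (hm 1) (hm 2) (hq.side_two_pos 0) (hx 0) (hx 1) ?_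
      simp only [det2, Prod.fst_sub, Prod.snd_sub] at *
      linarith
  · exact convexHull_min (by rintro _ ⟨i, rfl⟩; exact hq.vertex_mem i) (convex_closedQuad q)

/-! ### Counting signed crossings of a ray -/

open Classical in
/-- Does the upward edge from `p` to `q` cross the horizontal ray to the right of `x`? -/
noncomputable def upCross (x p q : ℝ × ℝ) : ℝ :=
  if p.2 < x.2 ∧ x.2 < q.2 ∧ 0 < det2 (q - p) (x - p) then 1 else 0

/-- The signed crossing of the edge from `p` to `q` with the horizontal ray to the right of `x`. -/
noncomputable def crossing (x p q : ℝ × ℝ) : ℝ := upCross x p q - upCross x q p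

lemma antisymm_crossing (x : ℝ × ℝ) : Antisymm (crossing x) := fun p q => by
  simp [crossing]

/-- A point in general position with respect to a set of points. -/
def Generic (S : Set (ℝ × ℝ)) (x : ℝ × ℝ) : Prop :=
  (∀ p ∈ S, x.2 ≠ p.2) ∧ ∀ p ∈ S, ∀ q ∈ S, p ≠ q → det2 (q - p) (x - p) ≠ 0

-- Here `a b c` are the heights of the corners of a triangle above a point and `A B C` its
-- unnormalized barycentric coordinates, which explains the linear relation. With all six numbers
-- nonzero, only finitely many sign patterns remain, and the relation excludes those that would
-- violate the formula.
open Classical in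
lemma crossing_signs {a b c A B C : ℝ} (ha : a ≠ 0) (hb : b ≠ 0) (hc : c ≠ 0) (hA : A ≠ 0)
    (hB : B ≠ 0) (hC : C ≠ 0) (hs : 0 < A + B + C) (h : B * a + C * b + A * c = 0) :
    ((if a < 0 ∧ 0 < b ∧ 0 < A then 1 else 0) - (if b < 0 ∧ 0 < a ∧ A < 0 then 1 else 0)) +
    ((if b < 0 ∧ 0 < c ∧ 0 < B then 1 else 0) - (if c < 0 ∧ 0 < b ∧ B < 0 then 1 else 0)) +
    ((if c < 0 ∧ 0 < a ∧ 0 < C then 1 else 0) - (if a < 0 ∧ 0 < c ∧ C < 0 then 1 else 0)) =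
    (if 0 < A ∧ 0 < B ∧ 0 < C then 1 else (0 : ℝ)) := by
  rcases ha.lt_or_gt with ha | ha <;> rcases hb.lt_or_gt with hb | hb <;>
  rcases hc.lt_or_gt with hc | hc <;> rcases hA.lt_or_gt with hA | hA <;>
  rcases hB.lt_or_gt with hB | hB <;> rcases hC.lt_or_gt with hC | hC <;>
  first
  | (simp [ha, hb, hc, hA, hB, hC, ha.not_gt, hb.not_gt, hc.not_gt, hA.not_gt, hB.not_gt,
      hC.not_gt]; done)
  | (exfalso; linarith)
  | (exfalso; nlinarith)

open Classical in
lemma crossing_triangle {a b c x : ℝ × ℝ} (h : 0 < det2 (b - a) (c - a))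
    (hx : Generic {a, b, c} x) :
    crossing x a b + crossing x b c + crossing x c a =
      if 0 < det2 (b - a) (x - a) ∧ 0 < det2 (c - b) (x - b) ∧ 0 < det2 (a - c) (x - c)
      then 1 else 0 := by
  have hab : a ≠ b := by rintro rfl; simp [det2] at h
  have hac : a ≠ c := by rintro rfl; simp [det2] at h
  have hbc : b ≠ c := by rintro rfl; simp [det2, mul_comm] at h
  obtain ⟨h1, h2⟩ := hx
  have key := crossing_signs (a := a.2 - x.2) (b := b.2 - x.2) (c := c.2 - x.2)
    (A := det2 (b - a) (x - a)) (B := det2 (c - b) (x - b)) (C := det2 (a - c) (x - c))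
    (sub_ne_zero.2 (h1 a (by simp)).symm) (sub_ne_zero.2 (h1 b (by simp)).symm)
    (sub_ne_zero.2 (h1 c (by simp)).symm) (h2 a (by simp) b (by simp) hab)
    (h2 b (by simp) c (by simp) hbc) (h2 c (by simp) a (by simp) hac.symm)
    (by
      have : det2 (b - a) (x - a) + det2 (c - b) (x - b) + det2 (a - c) (x - c) =
        det2 (b - a) (c - a) := by simp [det2]; ring
      rw [this]; exact h)
    (by simp [det2]; ring)
  rw [← key]
  have neg : ∀ p q : ℝ × ℝ, det2 (p - q) (x - q) = -det2 (q - p) (x - p) := by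
    intro p q; simp [det2]; ring
  simp only [crossing, upCross]
  rw [neg a b, neg b c, neg c a]
  simp only [sub_neg, sub_pos, neg_pos]

-- A diagonal cuts the quadrilateral into two triangles; by antisymmetry its two traversals cancel.
-- A generic point is not on the diagonal, so it is in the open quadrilateral exactly if it is in
-- the open triangle on its side of the diagonal.
open Classical in
lemma crossing_quad {q : Fin 4 → ℝ × ℝ} (hq : Convex4 q) {x : ℝ × ℝ}
    (hx : Generic (Set.range q) x) :
    bd (crossing x) q = if x ∈ openQuad q then 1 else 0 := by
  have gen : ∀ i j k, Generic {q i, q j, q k} x := by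
    intro i j k
    have : ({q i, q j, q k} : Set (ℝ × ℝ)) ⊆ Set.range q := by
      rintro _ (rfl | rfl | rfl) <;> simp
    exact ⟨fun p hp => hx.1 p (this hp), fun p hp r hr => hx.2 p (this hp) r (this hr)⟩
  have p012 : 0 < det2 (q 1 - q 0) (q 2 - q 0) := hq.side_two_pos 0
  have p023 : 0 < det2 (q 2 - q 0) (q 3 - q 0) := by
    have := hq.side_two_pos 2
    simp only [side, det2, Prod.fst_sub, Prod.snd_sub, Fin.reduceAdd] at *
    linarith
  have p1 : 0 < det2 (q 2 - q 1) (q 3 - q 1) := hq.side_two_pos 1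
  have p3 : 0 < det2 (q 0 - q 3) (q 1 - q 3) := hq.side_two_pos 3
  have t1 := crossing_triangle p012 (gen 0 1 2)
  have t2 := crossing_triangle p023 (gen 0 2 3)
  have e : bd (crossing x) q = (crossing x (q 0) (q 1) + crossing x (q 1) (q 2) +
      crossing x (q 2) (q 0)) + (crossing x (q 0) (q 2) + crossing x (q 2) (q 3) +
      crossing x (q 3) (q 0)) := by
    rw [antisymm_crossing x (q 0) (q 2)]
    simp only [bd, Fin.sum_univ_four, Fin.reduceAdd]
    ring
  have hD : det2 (q 2 - q 0) (x - q 0) ≠ 0 :=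
    (gen 0 1 2).2 _ (by simp) _ (by simp) (by
      intro h; rw [h] at p012; simp [det2, mul_comm] at p012)
  have eD : det2 (q 0 - q 2) (x - q 2) = -det2 (q 2 - q 0) (x - q 0) := by simp [det2]; ring
  rw [e, t1, t2, eD]
  have hopen : x ∈ openQuad q ↔ (0 < det2 (q 1 - q 0) (x - q 0) ∧ 0 < det2 (q 2 - q 1) (x - q 1) ∧
      0 < det2 (q 3 - q 2) (x - q 2) ∧ 0 < det2 (q 0 - q 3) (x - q 3)) := by
    simp [openQuad, Fin.forall_fin_succ, side]
  rw [if_congr hopen rfl rfl]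
  set A := det2 (q 1 - q 0) (x - q 0) with hA
  set B := det2 (q 2 - q 1) (x - q 1) with hB
  set C := det2 (q 3 - q 2) (x - q 2) with hC
  set E := det2 (q 0 - q 3) (x - q 3) with hE
  set D := det2 (q 2 - q 0) (x - q 0) with hD'
  -- Four linear relations among the side functions and the function `D` of the diagonal: on one
  -- side of the diagonal, positivity for the triangle there implies positivity for the two
  -- remaining sides.
  have i1 : det2 (q 1 - q 0) (q 2 - q 0) * C =
      B * det2 (q 2 - q 0) (q 3 - q 0) + -D * det2 (q 2 - q 1) (q 3 - q 1) := by
    simp only [hB, hC, hD', det2, Prod.fst_sub, Prod.snd_sub]; ring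
  have i2 : det2 (q 1 - q 0) (q 2 - q 0) * E =
      A * det2 (q 2 - q 0) (q 3 - q 0) + -D * det2 (q 0 - q 3) (q 1 - q 3) := by
    simp only [hA, hE, hD', det2, Prod.fst_sub, Prod.snd_sub]; ring
  have i3 : det2 (q 2 - q 0) (q 3 - q 0) * A =
      E * det2 (q 1 - q 0) (q 2 - q 0) + D * det2 (q 0 - q 3) (q 1 - q 3) := by
    simp only [hA, hE, hD', det2, Prod.fst_sub, Prod.snd_sub]; ring
  have i4 : det2 (q 2 - q 0) (q 3 - q 0) * B =
      C * det2 (q 1 - q 0) (q 2 - q 0) + D * det2 (q 2 - q 1) (q 3 - q 1) := by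
    simp only [hB, hC, hD', det2, Prod.fst_sub, Prod.snd_sub]; ring
  rcases hD.lt_or_gt with hD | hD
  · have : (0 < A ∧ 0 < B ∧ 0 < C ∧ 0 < E) ↔ (0 < A ∧ 0 < B ∧ 0 < -D) := by
      constructor
      · rintro ⟨h1, h2, -, -⟩; exact ⟨h1, h2, by linarith⟩
      · rintro ⟨h1, h2, h3⟩
        refine ⟨h1, h2, ?_, ?_⟩
        · refine pos_of_mul_pos_right (a := det2 (q 1 - q 0) (q 2 - q 0)) ?_ p012.le
          rw [i1]; positivity
        · refine pos_of_mul_pos_right (a := det2 (q 1 - q 0) (q 2 - q 0)) ?_ p012.le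
          rw [i2]; positivity
    rw [if_congr this rfl rfl, if_neg (c := 0 < D ∧ 0 < C ∧ 0 < E) (fun h => by linarith [h.1]), add_zero]
  · have : (0 < A ∧ 0 < B ∧ 0 < C ∧ 0 < E) ↔ (0 < D ∧ 0 < C ∧ 0 < E) := by
      constructor
      · rintro ⟨-, -, h1, h2⟩; exact ⟨hD, h1, h2⟩
      · rintro ⟨h1, h2, h3⟩
        refine ⟨?_, ?_, h2, h3⟩
        · refine pos_of_mul_pos_right (a := det2 (q 2 - q 0) (q 3 - q 0)) ?_ p023.le
          rw [i3]; positivity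
        · refine pos_of_mul_pos_right (a := det2 (q 2 - q 0) (q 3 - q 0)) ?_ p023.le
          rw [i4]; positivity
    rw [if_congr this rfl rfl, if_neg (c := 0 < A ∧ 0 < B ∧ 0 < -D) (fun h => by linarith [h.2.2]), zero_add]

/-! ### From formal sums to meshes of a rectangle -/

lemma dense_affine_ne {a b c : ℝ} (h : a ≠ 0 ∨ b ≠ 0) :
    Dense {x : ℝ × ℝ | a * x.1 + b * x.2 + c ≠ 0} := by
  intro x
  by_cases hx : a * x.1 + b * x.2 + c = 0
  · have hcont : Continuous fun t : ℝ => ((x.1 + t * a, x.2 + t * b) : ℝ × ℝ) := by fun_prop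
    have h0 : Filter.Tendsto (fun t : ℝ => ((x.1 + t * a, x.2 + t * b) : ℝ × ℝ))
        (nhdsWithin 0 (Set.Ioi 0)) (nhds x) := by
      have := hcont.tendsto 0
      simp only [zero_mul, add_zero] at this
      exact this.mono_left nhdsWithin_le_nhds
    refine mem_closure_of_tendsto h0 ?_
    filter_upwards [self_mem_nhdsWithin] with t ht
    have ht : 0 < t := ht
    have hab : 0 < a * a + b * b := by
      rcases h with h | h
      · have := mul_self_pos.2 h; nlinarith [mul_self_nonneg b]
      · have := mul_self_pos.2 h; nlinarith [mul_self_nonneg a]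
    have := mul_pos ht hab
    intro h'
    nlinarith
  · exact subset_closure hx

/-- Genericity removes finitely many lines, and the complement of each is open and dense. -/
lemma exists_generic {S : Set (ℝ × ℝ)} (hS : S.Finite) {U : Set (ℝ × ℝ)} (hU : IsOpen U)
    (hne : U.Nonempty) : ∃ x ∈ U, Generic S x := by
  have key : ∀ a b c : ℝ, (a ≠ 0 ∨ b ≠ 0) → IsOpen {x : ℝ × ℝ | a * x.1 + b * x.2 + c ≠ 0} :=
    fun a b c _ => isOpen_ne_fun (by fun_prop) (by fun_prop)
  have h1 : Dense (⋂ p ∈ S, {x : ℝ × ℝ | 0 * x.1 + 1 * x.2 + -p.2 ≠ 0}) :=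
    dense_biInter_of_isOpen (fun p _ => key _ _ _ (Or.inr one_ne_zero)) hS.countable
      (fun p _ => dense_affine_ne (Or.inr one_ne_zero))
  let F : (ℝ × ℝ) × (ℝ × ℝ) → Set (ℝ × ℝ) := fun e =>
    {x : ℝ × ℝ | -(e.2.2 - e.1.2) * x.1 + (e.2.1 - e.1.1) * x.2 +
      ((e.2.2 - e.1.2) * e.1.1 - (e.2.1 - e.1.1) * e.1.2) ≠ 0}
  have hT : ((S ×ˢ S) ∩ {e | e.1 ≠ e.2}).Finite := (hS.prod hS).subset Set.inter_subset_left
  have hab : ∀ e ∈ (S ×ˢ S) ∩ {e | e.1 ≠ e.2}, -(e.2.2 - e.1.2) ≠ 0 ∨ e.2.1 - e.1.1 ≠ 0 := by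
    rintro ⟨p, q⟩ ⟨-, h⟩
    by_contra! h'
    exact h (Prod.ext (by linarith [h'.2]) (by linarith [h'.1]))
  have h2 : Dense (⋂ e ∈ (S ×ˢ S) ∩ {e | e.1 ≠ e.2}, F e) :=
    dense_biInter_of_isOpen (fun e he => key _ _ _ (hab e he)) hT.countable
      (fun e he => dense_affine_ne (hab e he))
  have o1 : IsOpen (⋂ p ∈ S, {x : ℝ × ℝ | 0 * x.1 + 1 * x.2 + -p.2 ≠ 0}) :=
    hS.isOpen_biInter fun p _ => key _ _ _ (Or.inr one_ne_zero)
  obtain ⟨x, hxU, hx1, hx2⟩ := (h1.inter_of_isOpen_left h2 o1).inter_open_nonempty U hU hne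
  refine ⟨x, hxU, fun p hp h => ?_, fun p hp q hq hpq h => ?_⟩
  · exact Set.mem_iInter₂.1 hx1 p hp (by rw [h]; ring)
  · have := Set.mem_iInter₂.1 hx2 (p, q) ⟨⟨hp, hq⟩, hpq⟩
    simp only [F, Set.mem_ofPred_eq] at this
    apply this
    rw [← h]; simp only [det2, Prod.fst_sub, Prod.snd_sub]; ring

/-- The closed rectangle `[0, W] × [0, H]`. -/
def closedRect (W H : ℝ) : Set (ℝ × ℝ) := {x | 0 ≤ x.1 ∧ x.1 ≤ W ∧ 0 ≤ x.2 ∧ x.2 ≤ H}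

/-- The open rectangle `(0, W) × (0, H)`. -/
def openRect (W H : ℝ) : Set (ℝ × ℝ) := {x | 0 < x.1 ∧ x.1 < W ∧ 0 < x.2 ∧ x.2 < H}

lemma isOpen_openRect (W H : ℝ) : IsOpen (openRect W H) := by
  have : openRect W H = Set.Ioo 0 W ×ˢ Set.Ioo 0 H := by
    ext; simp [openRect, and_assoc]
  rw [this]; exact isOpen_Ioo.prod isOpen_Ioo

lemma isClosed_closedRect (W H : ℝ) : IsClosed (closedRect W H) := by
  have : closedRect W H = Set.Icc 0 W ×ˢ Set.Icc 0 H := by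
    ext; simp only [closedRect, Set.mem_ofPred_eq, Set.mem_prod, Set.mem_Icc, and_assoc]
  rw [this]; exact isClosed_Icc.prod isClosed_Icc

lemma closedRect_eq_closure {W H : ℝ} (hW : 0 < W) (hH : 0 < H) :
    closedRect W H = closure (openRect W H) := by
  have h1 : closedRect W H = Set.Icc 0 W ×ˢ Set.Icc 0 H := by
    ext; simp only [closedRect, Set.mem_ofPred_eq, Set.mem_prod, Set.mem_Icc, and_assoc]
  have h2 : openRect W H = Set.Ioo 0 W ×ˢ Set.Ioo 0 H := by
    ext; simp [openRect, and_assoc]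
  rw [h1, h2, closure_prod_eq, closure_Ioo hW.ne, closure_Ioo hH.ne]

/-- A list of directed edges running counterclockwise once around the rectangle. -/
structure IsBoundary (W H : ℝ) (E : List ((ℝ × ℝ) × (ℝ × ℝ))) : Prop where
  ne : ∀ e ∈ E, e.1 ≠ e.2
  left_notMem : ∀ e ∈ E, e.1 ∈ closedRect W H ∧ e.1 ∉ openRect W H
  right_notMem : ∀ e ∈ E, e.2 ∈ closedRect W H ∧ e.2 ∉ openRect W H
  support : ∀ e ∈ E, ∀ x ∈ closedRect W H, 0 ≤ det2 (e.2 - e.1) (x - e.1)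
  covers : ∀ x ∈ closedRect W H, x ∉ openRect W H → ∃ e ∈ E, x ∈ segment ℝ e.1 e.2
  generic_set : ∃ S : Set (ℝ × ℝ), S.Finite ∧ ∀ x, Generic S x →
    (E.map fun e => crossing x e.1 e.2).sum =
      (openRect W H).indicator (fun _ => (1 : ℝ)) x

/-- The quadrilaterals of a list fit together to a mesh of a rectangle. -/
structure MeshData (W H : ℝ) (E : List ((ℝ × ℝ) × (ℝ × ℝ))) (L : List (Fin 4 → ℝ × ℝ)) :
    Prop where
  hW : 0 < W
  hH : 0 < H
  convex : ∀ q ∈ L, Convex4 q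
  boundary : IsBoundary W H E
  sum_eq : ∀ f, Antisymm f → (L.map (bd f)).sum = (E.map fun e => f e.1 e.2).sum

lemma list_sum_two {α : Type*} (g : α → ℝ) (hg : ∀ a, 0 ≤ g a) :
    ∀ (L : List α) {a b : α}, a ∈ L → b ∈ L → a ≠ b → g a + g b ≤ (L.map g).sum := by
  have one : ∀ (L : List α) {a : α}, a ∈ L → g a ≤ (L.map g).sum := by
    intro L
    induction L with
    | nil => simp
    | cons c L ih =>
      intro a ha
      have h0 : 0 ≤ (L.map g).sum := List.sum_nonneg (by simpa using fun x _ => hg x)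
      rcases List.mem_cons.1 ha with rfl | ha
      · simp [h0]
      · have := ih ha; have := hg c; simp; linarith
  intro L
  induction L with
  | nil => simp
  | cons c L ih =>
    intro a b ha hb hab
    rcases List.mem_cons.1 ha with ha' | ha' <;> rcases List.mem_cons.1 hb with hb' | hb'
    · exact absurd (ha'.trans hb'.symm) hab
    · have := one L hb'; simp [← ha']; linarith
    · have := one L ha'; simp [← hb']; linarith
    · have := ih ha' hb' hab; have := hg c; simp; linarith

lemma list_sum_nonpos : ∀ (l : List ℝ), (∀ r ∈ l, r ≤ 0) → l.sum ≤ 0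
  | [], _ => by simp
  | a :: l, h => by
    have := list_sum_nonpos l (fun r hr => h r (by simp [hr]))
    have := h a (by simp)
    simp; linarith

/-! ### Disjointness, covering, adjacency and boundary vertices of the cells of a formal sum. -/

namespace MeshData

variable {W H : ℝ} {E : List ((ℝ × ℝ) × (ℝ × ℝ))} {L : List (Fin 4 → ℝ × ℝ)}
  (h : MeshData W H E L)
include h

/-- This is the boundary identity tested with `crossing x`. The finite set also contains all corners
of cells, so that `x` avoids all lines through sides. -/
lemma exists_set : ∃ S : Set (ℝ × ℝ), S.Finite ∧ ∀ x, Generic S x →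
    (L.map fun q => (openQuad q).indicator (fun _ => (1 : ℝ)) x).sum =
      (openRect W H).indicator (fun _ => (1 : ℝ)) x ∧
      ∀ q ∈ L, ∀ i, side q i x ≠ 0 := by
  obtain ⟨S, hS, hSx⟩ := h.boundary.generic_set
  refine ⟨S ∪ ⋃ q ∈ L.toFinset, Set.range q, hS.union (L.toFinset.finite_toSet.biUnion
    fun q _ => Set.finite_range q), fun x hx => ?_⟩
  have h1 : ∀ q ∈ L, Generic (Set.range q) x := by
    intro q hq
    have : Set.range q ⊆ S ∪ ⋃ q ∈ L.toFinset, Set.range q := by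
      refine Set.subset_union_of_subset_right ?_ _
      exact Set.subset_biUnion_of_mem (u := fun q => Set.range q) (by simpa using hq)
    exact ⟨fun p hp => hx.1 p (this hp), fun p hp r hr => hx.2 p (this hp) r (this hr)⟩
  have h2 : Generic S x := ⟨fun p hp => hx.1 p (Or.inl hp),
    fun p hp r hr => hx.2 p (Or.inl hp) r (Or.inl hr)⟩
  refine ⟨?_, fun q hq i => ?_⟩
  · rw [← hSx x h2, ← h.sum_eq _ (antisymm_crossing x)]
    congr 1
    refine List.map_congr_left fun q hq => ?_
    rw [crossing_quad (h.convex q hq) (h1 q hq)]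
    by_cases hxq : x ∈ openQuad q
    · rw [if_pos hxq, Set.indicator_of_mem hxq]
    · rw [if_neg hxq, Set.indicator_of_notMem hxq]
  · exact (h1 q hq).2 _ ⟨i, rfl⟩ _ ⟨i + 1, rfl⟩ ((h.convex q hq).ne_succ i)

lemma exists_good_point {U : Set (ℝ × ℝ)} (hU : IsOpen U) (hne : U.Nonempty) :
    ∃ x ∈ U, (L.map fun q => (openQuad q).indicator (fun _ => (1 : ℝ)) x).sum =
      (openRect W H).indicator (fun _ => (1 : ℝ)) x ∧ ∀ q ∈ L, ∀ i, side q i x ≠ 0 := by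
  obtain ⟨S, hS, hSx⟩ := h.exists_set
  obtain ⟨x, hxU, hx⟩ := exists_generic hS hU hne
  exact ⟨x, hxU, hSx x hx⟩

/-- An overlap is open, hence contains a generic point, and there two cells would contribute at
least `2` to a sum that is at most `1`. -/
lemma eq_of_mem_openQuad {q q' : Fin 4 → ℝ × ℝ} (hq : q ∈ L) (hq' : q' ∈ L)
    {y : ℝ × ℝ} (hy : y ∈ openQuad q) (hy' : y ∈ openQuad q') : q = q' := by
  by_contra hne
  obtain ⟨x, ⟨hx1, hx2⟩, hx, -⟩ := h.exists_good_point
    ((isOpen_openQuad q).inter (isOpen_openQuad q')) ⟨y, hy, hy'⟩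
  have := list_sum_two (fun q => (openQuad q).indicator (fun _ => (1 : ℝ)) x)
    (fun a => Set.indicator_nonneg (by simp) _) L hq hq' hne
  rw [hx] at this
  simp only [Set.indicator_of_mem hx1, Set.indicator_of_mem hx2] at this
  have h1 : (openRect W H).indicator (fun _ => (1 : ℝ)) x ≤ 1 :=
    Set.indicator_le_self' (by simp) x
  linarith

lemma closedQuad_subset {q : Fin 4 → ℝ × ℝ} (hq : q ∈ L) : closedQuad q ⊆ closedRect W H := by
  refine (h.convex q hq).subset_closure.trans (closure_minimal ?_ (isClosed_closedRect W H))
  by_contra hn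
  obtain ⟨y, hy, hyn⟩ := Set.not_subset.1 hn
  obtain ⟨x, ⟨hx1, hx2⟩, hx, -⟩ := h.exists_good_point
    ((isOpen_openQuad q).inter (isClosed_closedRect W H).isOpen_compl) ⟨y, hy, hyn⟩
  have hxo : x ∉ openRect W H := fun h' =>
    hx2 (by rw [closedRect_eq_closure h.hW h.hH]; exact subset_closure h')
  rw [Set.indicator_of_notMem hxo] at hx
  have h0 : ∀ r ∈ L.map (fun q => (openQuad q).indicator (fun _ => (1 : ℝ)) x), 0 ≤ r := by
    simpa using fun q _ => Set.indicator_nonneg (by simp) _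
  have := List.single_le_sum h0 _ (List.mem_map.2 ⟨q, hq, rfl⟩)
  rw [hx, Set.indicator_of_mem hx1] at this
  linarith

lemma iUnion_closedQuad : ⋃ q ∈ L, closedQuad q = closedRect W H := by
  apply Set.Subset.antisymm
  · exact Set.iUnion₂_subset fun q hq => h.closedQuad_subset hq
  · have hcl : IsClosed (⋃ q ∈ L, closedQuad q) := by
      have : ⋃ q ∈ L, closedQuad q = ⋃ q ∈ L.toFinset, closedQuad q := by simp
      rw [this]
      exact L.toFinset.finite_toSet.isClosed_biUnion fun q _ => isClosed_closedQuad q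
    rw [closedRect_eq_closure h.hW h.hH]
    refine closure_minimal ?_ hcl
    by_contra hn
    obtain ⟨y, hy, hyn⟩ := Set.not_subset.1 hn
    obtain ⟨x, ⟨hx1, hx2⟩, hx, -⟩ := h.exists_good_point
      ((isOpen_openRect W H).inter hcl.isOpen_compl) ⟨y, hy, hyn⟩
    rw [Set.indicator_of_mem hx1] at hx
    have : (L.map fun q => (openQuad q).indicator (fun _ => (1 : ℝ)) x).sum = 0 := by
      apply List.sum_eq_zero
      simp only [List.mem_map]
      rintro _ ⟨q, hq, rfl⟩
      exact Set.indicator_of_notMem (fun hxq => hx2 (Set.mem_iUnion₂.2 ⟨q, hq,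
        openQuad_subset q hxq⟩)) _
    linarith

omit h in
open Classical in
/-- The signed indicator function of a directed edge. -/
lemma antisymm_edge (p r : ℝ × ℝ) : Antisymm fun a b =>
    (if a = p ∧ b = r then (1 : ℝ) else 0) - (if a = r ∧ b = p then 1 else 0) := by
  intro a b
  simp only [and_comm]
  ring

/-- Every side is a side of the next quadrilateral, or a side of the boundary. -/
lemma exists_neighbor {q : Fin 4 → ℝ × ℝ} (hq : q ∈ L) (i : Fin 4) :
    (∃ q' ∈ L, ∃ j, q' j = q (i + 1) ∧ q' (j + 1) = q i) ∨ (q i, q (i + 1)) ∈ E := by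
  classical
  by_contra! hn
  obtain ⟨h1, h2⟩ := hn
  -- The identity is tested with the signed indicator of this edge. Without a reversed copy among
  -- the sides, the cells contribute at least `1`; without the edge in `E`, the boundary contributes
  -- at most `0`.
  have hs := h.sum_eq _ (antisymm_edge (q i) (q (i + 1)))
  have hle : (E.map fun e => ((if e.1 = q i ∧ e.2 = q (i + 1) then (1 : ℝ) else 0) -
      (if e.1 = q (i + 1) ∧ e.2 = q i then 1 else 0))).sum ≤ 0 := by
    apply list_sum_nonpos
    simp only [List.mem_map]
    rintro _ ⟨e, he, rfl⟩
    rw [if_neg (fun h' => h2 (by rw [← h'.1, ← h'.2]; exact he))]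
    split_ifs <;> simp
  rw [← hs] at hle
  have h0 : ∀ r ∈ L.map (bd fun a b => (if a = q i ∧ b = q (i + 1) then (1 : ℝ) else 0) -
      (if a = q (i + 1) ∧ b = q i then 1 else 0)), 0 ≤ r := by
    simp only [List.mem_map]
    rintro _ ⟨q', hq', rfl⟩
    refine Finset.sum_nonneg fun j _ => ?_
    beta_reduce
    rw [if_neg (c := q' j = q (i + 1) ∧ _) (fun h' => h1 q' hq' j h'.1 h'.2)]
    split_ifs <;> simp
  have h3 := List.single_le_sum h0 _ (List.mem_map.2 ⟨q, hq, rfl⟩)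
  have h4 : (1 : ℝ) ≤ bd (fun a b => (if a = q i ∧ b = q (i + 1) then (1 : ℝ) else 0) -
      (if a = q (i + 1) ∧ b = q i then 1 else 0)) q := by
    have hnn : ∀ j ∈ Finset.univ, 0 ≤ (if q j = q i ∧ q (j + 1) = q (i + 1) then (1 : ℝ) else 0) -
      (if q j = q (i + 1) ∧ q (j + 1) = q i then 1 else 0) := by
      intro j _
      rw [if_neg (c := q j = q (i + 1) ∧ _) (fun h' => h1 q hq j h'.1 h'.2)]
      split_ifs <;> simp
    have := Finset.single_le_sum hnn (Finset.mem_univ i)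
    rw [if_pos ⟨rfl, rfl⟩, if_neg (fun h' => h1 q hq i h'.1 h'.2)] at this
    simpa [bd] using this
  linarith

/-- Conversely, every boundary edge is a side of some quadrilateral. -/
lemma exists_of_mem_boundary {e : (ℝ × ℝ) × (ℝ × ℝ)} (he : e ∈ E) :
    ∃ q ∈ L, ∃ i, q i = e.1 ∧ q (i + 1) = e.2 := by
  classical
  by_contra! hn
  have hs := h.sum_eq _ (antisymm_edge e.1 e.2)
  -- Two opposite boundary edges would confine the whole rectangle to one line.
  have hrev : ∀ e' ∈ E, ¬(e'.1 = e.2 ∧ e'.2 = e.1) := by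
    rintro e' he' ⟨h1, h2⟩
    have s1 := h.boundary.support e he
    have s2 := h.boundary.support e' he'
    have hopen : ∃ x, x ∈ openRect W H :=
      ⟨(W / 2, H / 2), by have := h.hW; have := h.hH; exact ⟨by simp; linarith, by simp; linarith,
        by simp; linarith, by simp; linarith⟩⟩
    obtain ⟨x, hx1, hx2⟩ := exists_generic (S := {e.1, e.2}) (by simp) (isOpen_openRect W H) hopen
    have hxc : x ∈ closedRect W H := by
      rw [closedRect_eq_closure h.hW h.hH]; exact subset_closure hx1
    have g := hx2.2 e.1 (by simp) e.2 (by simp) (h.boundary.ne e he)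
    have g1 := s1 x hxc
    have g2 := s2 x hxc
    rw [h1, h2] at g2
    apply g
    simp only [det2, Prod.fst_sub, Prod.snd_sub] at *
    linarith
  have h0 : ∀ r ∈ E.map (fun e' => ((if e'.1 = e.1 ∧ e'.2 = e.2 then (1 : ℝ) else 0) -
      (if e'.1 = e.2 ∧ e'.2 = e.1 then 1 else 0))), 0 ≤ r := by
    simp only [List.mem_map]
    rintro _ ⟨e', he', rfl⟩
    rw [if_neg (c := e'.1 = e.2 ∧ _) (hrev e' he')]
    split_ifs <;> simp
  have h3 := List.single_le_sum h0 _ (List.mem_map.2 ⟨e, he, rfl⟩)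
  rw [← hs, if_pos ⟨rfl, rfl⟩, if_neg (hrev e he)] at h3
  have hle : (L.map (bd fun a b => (if a = e.1 ∧ b = e.2 then (1 : ℝ) else 0) -
      (if a = e.2 ∧ b = e.1 then 1 else 0))).sum ≤ 0 := by
    apply list_sum_nonpos
    simp only [List.mem_map]
    rintro _ ⟨q', hq', rfl⟩
    refine Finset.sum_nonpos fun j _ => ?_
    beta_reduce
    rw [if_neg (fun h' => hn q' hq' j h'.1 h'.2)]
    split_ifs <;> simp
  linarith

/-- A quadrilateral that contains an inner point of a side of another one is its neighbor. -/
lemma neighbor_of_mem {q q' : Fin 4 → ℝ × ℝ} (hq : q ∈ L) (hq' : q' ∈ L) (hne : q ≠ q')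
    {x : ℝ × ℝ} (hx' : x ∈ closedQuad q') {i : Fin 4} (h0 : side q i x = 0)
    (hpos : ∀ j, j ≠ i → 0 < side q j x) : ∃ j, q' j = q (i + 1) ∧ q' (j + 1) = q i := by
  have near : ∀ (r : Fin 4 → ℝ × ℝ) (i : Fin 4), (∀ j, j ≠ i → 0 < side r j x) →
      ∃ U : Set (ℝ × ℝ), IsOpen U ∧ x ∈ U ∧ ∀ y ∈ U, ∀ j, j ≠ i → 0 < side r j y := by
    intro r i hr
    refine ⟨⋂ j ∈ ({j | j ≠ i} : Set (Fin 4)), {y | 0 < side r j y},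
      Set.Finite.isOpen_biInter (Set.toFinite _) fun j _ =>
      isOpen_lt continuous_const (continuous_side r j), ?_, ?_⟩
    · simpa using hr
    · intro y hy; simpa using hy
  obtain ⟨U, hUo, hxU, hU⟩ := near q i hpos
  have hxc := (h.convex q' hq').subset_closure hx'
  -- Near an inner point `x` of the side, every generic point is in `q` or in the cell `r` across
  -- the side, if there is one. Since `q'` has inner points arbitrarily near `x`, it overlaps `q` or
  -- `r`, hence equals `r`. On the boundary of the rectangle there is nothing across the side.
  rcases h.exists_neighbor hq i with ⟨r, hr, j, hj1, hj2⟩ | hE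
  · have hside : ∀ y, side r j y = -side q i y := by
      intro y; simp only [side, hj1, hj2, det2, Prod.fst_sub, Prod.snd_sub]; ring
    have hxq : x ∈ closedQuad q := fun k => by
      by_cases hk : k = i
      · rw [hk, h0]
      · exact (hpos k hk).le
    obtain ⟨t, ht0, ht1, hxt⟩ := (h.convex q hq).exists_of_side_eq_zero hxq h0
    have hxr : x ∈ closedQuad r := by
      rw [hxt, ← hj1, ← hj2]
      exact convex_closedQuad r ((h.convex r hr).vertex_mem _) ((h.convex r hr).vertex_mem _)
        (by linarith) ht0 (by ring)
    have n0 : x ≠ q i := by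
      rintro rfl
      have e1 : i + 3 + 1 = i := by rw [add_assoc]; simp
      have := hpos (i + 3) (by simp)
      have h3 := side_succ q (i + 3)
      rw [e1] at h3
      linarith
    have n1 : x ≠ q (i + 1) := by
      rintro rfl
      have := hpos (i + 1) (by simp)
      simp at this
    obtain ⟨V, hVo, hxV, hV⟩ := near r j (fun k hk => (h.convex r hr).side_pos_of_ne hxr
      (by rw [hside, h0, neg_zero]) (by rw [hj1]; exact n1) (by rw [hj2]; exact n0) hk)
    obtain ⟨y, ⟨hyU, hyV⟩, hyq⟩ := mem_closure_iff.1 hxc _ (hUo.inter hVo) ⟨hxU, hxV⟩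
    obtain ⟨z, ⟨⟨hzU, hzV⟩, hzq⟩, -, hz⟩ := h.exists_good_point
      ((hUo.inter hVo).inter (isOpen_openQuad q')) ⟨y, ⟨hyU, hyV⟩, hyq⟩
    rcases (hz q hq i).lt_or_gt with hlt | hgt
    · have : r = q' := h.eq_of_mem_openQuad hr hq' (y := z) (fun k => by
        by_cases hk : k = j
        · rw [hk, hside]; linarith
        · exact hV z hzV k hk) hzq
      subst this
      exact ⟨j, hj1, hj2⟩
    · exact absurd (h.eq_of_mem_openQuad hq hq' (y := z) (fun k => by
        by_cases hk : k = i
        · rw [hk]; exact hgt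
        · exact hU z hzU k hk) hzq) hne
  · obtain ⟨y, hyU, hyq⟩ := mem_closure_iff.1 hxc _ hUo hxU
    obtain ⟨z, ⟨hzU, hzq⟩, -, hz⟩ := h.exists_good_point
      (hUo.inter (isOpen_openQuad q')) ⟨y, hyU, hyq⟩
    have hz0 : 0 ≤ side q i z := h.boundary.support _ hE z
      (h.closedQuad_subset hq' (openQuad_subset _ hzq))
    exact absurd (h.eq_of_mem_openQuad hq hq' (y := z) (fun k => by
        by_cases hk : k = i
        · rw [hk]; exact lt_of_le_of_ne hz0 (hz q hq i).symm
        · exact hU z hzU k hk) hzq) hne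

/-- Two different quadrilaterals of the list are disjoint, or meet in a common vertex, or meet in
a common side. -/
lemma meet {q q' : Fin 4 → ℝ × ℝ} (hq : q ∈ L) (hq' : q' ∈ L) (hne : q ≠ q') :
    closedQuad q ∩ closedQuad q' = ∅ ∨
    (∃ i j, q i = q' j ∧ closedQuad q ∩ closedQuad q' = {q i}) ∨
    (∃ i j, s(q i, q (i + 1)) = s(q' j, q' (j + 1)) ∧
      closedQuad q ∩ closedQuad q' = segment ℝ (q i) (q (i + 1))) := by
  have main : ∀ {q q' : Fin 4 → ℝ × ℝ}, q ∈ L → q' ∈ L → q ≠ q' →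
      (∃ i j, q' j = q (i + 1) ∧ q' (j + 1) = q i ∧
        closedQuad q ∩ closedQuad q' = segment ℝ (q i) (q (i + 1))) ∨
      (closedQuad q ∩ closedQuad q' ⊆ Set.range q) := by
    intro q q' hq hq' hne
    refine or_iff_not_imp_right.2 fun hn => ?_
    obtain ⟨x, ⟨hx, hx'⟩, hxn⟩ := Set.not_subset.1 hn
    -- The intersection is convex and avoids the open cell, so it lies on one side of `q`. A point
    -- of it that is not a vertex of `q` makes `q'` the neighbor across this side.
    have hd : Disjoint (closedQuad q ∩ closedQuad q') (openQuad q) := by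
      rw [Set.disjoint_left]
      rintro y ⟨-, hy'⟩ hyo
      obtain ⟨z, hz, hz'⟩ := mem_closure_iff.1 ((h.convex q' hq').subset_closure hy') _
        (isOpen_openQuad q) hyo
      exact hne (h.eq_of_mem_openQuad hq hq' hz hz')
    obtain ⟨i, hi⟩ := Convex4.exists_side_of_convex
      ((convex_closedQuad q).inter (convex_closedQuad q')) Set.inter_subset_left hd
    have hpos : ∀ j, j ≠ i → 0 < side q j x := fun j hj =>
      (h.convex q hq).side_pos_of_ne hx (hi x ⟨hx, hx'⟩) (fun e => hxn ⟨i, e.symm⟩)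
        (fun e => hxn ⟨i + 1, e.symm⟩) hj
    obtain ⟨j, hj1, hj2⟩ := h.neighbor_of_mem hq hq' hne hx' (hi x ⟨hx, hx'⟩) hpos
    refine ⟨i, j, hj1, hj2, Set.Subset.antisymm ?_ ?_⟩
    · rw [← (h.convex q hq).side_zero_inter i]
      exact fun y hy => ⟨hy.1, hi y hy⟩
    · refine Set.subset_inter ?_ ?_
      · exact (convex_closedQuad q).segment_subset ((h.convex q hq).vertex_mem i)
          ((h.convex q hq).vertex_mem _)
      · rw [← hj1, ← hj2]
        exact (convex_closedQuad q').segment_subset ((h.convex q' hq').vertex_mem _)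
          ((h.convex q' hq').vertex_mem _)
  rcases main hq hq' hne with ⟨i, j, h1, h2, h3⟩ | h1
  · refine Or.inr (Or.inr ⟨i, j, ?_, h3⟩)
    rw [h1, h2, Sym2.eq_swap]
  rcases main hq' hq hne.symm with ⟨i, j, h1, h2, h3⟩ | h2
  · refine Or.inr (Or.inr ⟨j, i, ?_, ?_⟩)
    · rw [h1, h2, Sym2.eq_swap]
    · rw [Set.inter_comm, h3, h1, h2, segment_symm]
  rw [Set.inter_comm] at h2
  -- Otherwise the intersection consists of vertices of `q`: it is finite and convex, hence has at
  -- most one point.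
  have hsub : (closedQuad q ∩ closedQuad q').Subsingleton := by
    have hc := (convex_closedQuad q).inter (convex_closedQuad q')
    have hf : (closedQuad q ∩ closedQuad q').Finite := (Set.finite_range q).subset h1
    exact Set.not_nontrivial_iff.1 fun hnt => hc.isPreconnected.infinite_of_nontrivial hnt hf
  rcases hsub.eq_empty_or_singleton with h0 | ⟨x, hx⟩
  · exact Or.inl h0
  · have hxm : x ∈ closedQuad q ∩ closedQuad q' := by rw [hx]; rfl
    obtain ⟨i, hi⟩ := h1 hxm
    obtain ⟨j, hj⟩ := h2 hxm
    exact Or.inr (Or.inl ⟨i, j, by rw [hi, hj], by rw [hx, hi]⟩)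

/-- The vertices on the boundary of the rectangle are the end points of the boundary edges. -/
lemma boundary_vertices (x : ℝ × ℝ) :
    ((∃ q ∈ L, ∃ i, q i = x) ∧ x ∉ openRect W H) ↔ ∃ e ∈ E, e.1 = x ∨ e.2 = x := by
  constructor
  · rintro ⟨⟨q, hq, k, rfl⟩, hx⟩
    obtain ⟨e, he, hxe⟩ := h.boundary.covers _
      (h.closedQuad_subset hq ((h.convex q hq).vertex_mem k)) hx
    obtain ⟨q', hq', i, h1, h2⟩ := h.exists_of_mem_boundary he
    refine ⟨e, he, ?_⟩
    by_contra! hn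
    rw [← h1, ← h2] at hn hxe
    rw [← (h.convex q' hq').side_zero_inter i] at hxe
    have hpos : ∀ j, j ≠ i → 0 < side q' j (q k) := fun j hj =>
      (h.convex q' hq').side_pos_of_ne hxe.1 hxe.2 hn.1.symm hn.2.symm hj
    by_cases hqq : q' = q
    · subst hqq
      by_cases hk : k = i
      · have := hpos (i + 1) (by simp)
        exact hn.1 (by rw [hk])
      · have := hpos k hk
        simp at this
    -- A vertex inside a boundary edge would belong to a cell across that edge, on the wrong side of
    -- a supporting line of the rectangle.
    · obtain ⟨j, hj1, hj2⟩ := h.neighbor_of_mem hq' hq hqq ((h.convex q hq).vertex_mem k) hxe.2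
        hpos
      obtain ⟨c, hc⟩ := (h.convex q hq).openQuad_nonempty
      have hs := h.boundary.support e he c (h.closedQuad_subset hq (openQuad_subset q hc))
      have hcj := hc j
      rw [← h1, ← h2] at hs
      simp only [side, hj1, hj2, det2, Prod.fst_sub, Prod.snd_sub] at hs hcj
      linarith
  · rintro ⟨e, he, hx⟩
    obtain ⟨q, hq, i, h1, h2⟩ := h.exists_of_mem_boundary he
    rcases hx with rfl | rfl
    · exact ⟨⟨q, hq, i, h1⟩, (h.boundary.left_notMem e he).2⟩
    · exact ⟨⟨q, hq, i + 1, h2⟩, (h.boundary.right_notMem e he).2⟩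

end MeshData

/-! ### The boundary of a rectangle with marked points -/

/-- The consecutive pairs of a list. -/
def edges {α : Type*} : List α → List (α × α)
  | [] => []
  | [_] => []
  | a :: b :: l => (a, b) :: edges (b :: l)

lemma sum_edges {α : Type*} (f : α → α → ℝ) (l : List α) :
    ((edges l).map fun e => f e.1 e.2).sum = pathSum f l := by
  induction l with
  | nil => rfl
  | cons a l ih =>
    cases l with
    | nil => rfl
    | cons b l => simpa [edges] using ih

lemma edges_prop {α : Type*} {R : α → α → Prop} {l : List α} (hl : l.IsChain R) {e : α × α}
    (he : e ∈ edges l) : e.1 ∈ l ∧ e.2 ∈ l ∧ R e.1 e.2 := by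
  induction l with
  | nil => simp [edges] at he
  | cons a l ih =>
    cases l with
    | nil => simp [edges] at he
    | cons b l =>
      rw [List.isChain_cons_cons] at hl
      rcases List.mem_cons.1 he with rfl | he
      · exact ⟨by simp, by simp, hl.1⟩
      · obtain ⟨h1, h2, h3⟩ := ih hl.2 he
        exact ⟨List.mem_cons_of_mem _ h1, List.mem_cons_of_mem _ h2, h3⟩

lemma exists_edge_of_mem {α : Type*} {l : List α} {a : α} (ha : a ∈ l) (hl : 2 ≤ l.length) :
    ∃ e ∈ edges l, e.1 = a ∨ e.2 = a := by
  induction l with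
  | nil => simp at ha
  | cons b l ih =>
    cases l with
    | nil => simp at hl
    | cons c l =>
      rcases List.mem_cons.1 ha with rfl | ha
      · exact ⟨(a, c), by simp [edges], Or.inl rfl⟩
      · cases l with
        | nil =>
          obtain rfl : a = c := by simpa using ha
          exact ⟨(b, a), by simp [edges], Or.inr rfl⟩
        | cons d l =>
          obtain ⟨e, he, h⟩ := ih ha (by simp)
          exact ⟨e, List.mem_cons_of_mem _ he, h⟩

lemma exists_edge_of_le {a b x : ℝ} (l : List ℝ) (h1 : a ≤ x) (h2 : x ≤ b) :
    ∃ e ∈ edges (a :: (l ++ [b])), e.1 ≤ x ∧ x ≤ e.2 := by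
  induction l generalizing a with
  | nil => exact ⟨(a, b), by simp [edges], h1, h2⟩
  | cons c l ih =>
    by_cases hc : c ≤ x
    · obtain ⟨e, he, h⟩ := ih hc
      exact ⟨e, List.mem_cons_of_mem _ he, h⟩
    · exact ⟨(a, c), by simp [edges], h1, by linarith⟩

lemma pathSum_telescope {α : Type*} {R : α → α → Prop} (f : α → α → ℝ) (g : α → ℝ)
    {a b : α} {l : List α} (hl : (a :: (l ++ [b])).IsChain R)
    (h : ∀ x ∈ a :: (l ++ [b]), ∀ y ∈ a :: (l ++ [b]), R x y → f x y = g y - g x) :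
    pathSum f (a :: (l ++ [b])) = g b - g a := by
  induction l generalizing a with
  | nil =>
    simp only [List.nil_append, List.isChain_pair] at hl
    simpa using h a (by simp) b (by simp) hl
  | cons c l ih =>
    rw [List.cons_append, List.isChain_cons_cons] at hl
    rw [List.cons_append, pathSum_cons_cons, h a (by simp) c (by simp) hl.1]
    rw [ih hl.2 (fun x hx y hy => h x (List.mem_cons_of_mem _ hx) y (List.mem_cons_of_mem _ hy))]
    ring

/-- A list of marks on an interval, together with the end points. -/
def full (W : ℝ) (l : List ℝ) : List ℝ := 0 :: (l ++ [W])

lemma mem_full_Icc {W : ℝ} {l : List ℝ} (h : (full W l).IsChain (· < ·)) {x : ℝ}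
    (hx : x ∈ full W l) : 0 ≤ x ∧ x ≤ W := by
  have hp := List.isChain_iff_pairwise.1 h
  rw [full, List.pairwise_cons, List.pairwise_append] at hp
  obtain ⟨h1, -, -, h2⟩ := hp
  rcases List.mem_cons.1 hx with rfl | hx
  · exact ⟨le_rfl, (h1 W (by simp)).le⟩
  · refine ⟨(h1 x hx).le, ?_⟩
    rcases List.mem_append.1 hx with hx | hx
    · exact (h2 x hx W (by simp)).le
    · simp at hx; exact hx.le

/-- The counterclockwise boundary edges of a rectangle with marks. -/
def boundaryEdges (W H : ℝ) (B R T L : List ℝ) : List ((ℝ × ℝ) × (ℝ × ℝ)) :=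
  (edges (full W B)).map (fun e => ((e.1, 0), (e.2, 0))) ++
  (edges (full H R)).map (fun e => ((W, e.1), (W, e.2))) ++
  (edges (full W T)).map (fun e => ((e.2, H), (e.1, H))) ++
  (edges (full H L)).map (fun e => ((0, e.2), (0, e.1)))

/-- The sum of a function over the boundary edges of a rectangle with marks. -/
def boundarySum (W H : ℝ) (B R T L : List ℝ) (f : ℝ × ℝ → ℝ × ℝ → ℝ) : ℝ :=
  pathSum f ((full W B).map fun x => (x, 0)) + pathSum f ((full H R).map fun y => (W, y)) -
  pathSum f ((full W T).map fun x => (x, H)) - pathSum f ((full H L).map fun y => (0, y))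

lemma sum_boundaryEdges (W H : ℝ) (B R T L : List ℝ) {f : ℝ × ℝ → ℝ × ℝ → ℝ} (hf : Antisymm f) :
    ((boundaryEdges W H B R T L).map fun e => f e.1 e.2).sum = boundarySum W H B R T L f := by
  have neg : ∀ {α : Type} (l : List α) (g : α → ℝ), (l.map fun a => -g a).sum = -(l.map g).sum := by
    intro α l g
    induction l with
    | nil => simp
    | cons a l ih => simp [ih]; ring
  simp only [boundaryEdges, List.map_append, List.sum_append, List.map_map, Function.comp_def,
    boundarySum, pathSum_map]
  rw [← sum_edges, ← sum_edges, ← sum_edges, ← sum_edges]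
  have e1 : ((edges (full W T)).map fun e => f (e.2, H) (e.1, H)) =
      (edges (full W T)).map fun e => -f (e.1, H) (e.2, H) :=
    List.map_congr_left fun e _ => hf _ _
  have e2 : ((edges (full H L)).map fun e => f (0, e.2) (0, e.1)) =
      (edges (full H L)).map fun e => -f (0, e.1) (0, e.2) :=
    List.map_congr_left fun e _ => hf _ _
  rw [e1, e2, neg, neg]
  ring

open Classical in
lemma crossing_vertical (c : ℝ) {x : ℝ × ℝ} {y y' : ℝ} (h : y < y') (hy : x.2 ≠ y)
    (hy' : x.2 ≠ y') : crossing x (c, y) (c, y') =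
    (if x.2 < y' ∧ x.1 < c then 1 else 0) - (if x.2 < y ∧ x.1 < c then 1 else 0) := by
  have hd : 0 < det2 ((c, y') - (c, y)) (x - (c, y)) ↔ x.1 < c := by
    simp only [det2, Prod.fst_sub, Prod.snd_sub, sub_self, zero_mul, zero_sub]
    constructor
    · intro h'; nlinarith
    · intro h'; nlinarith
  simp only [crossing, upCross, hd]
  rcases hy.lt_or_gt with h1 | h1 <;> rcases hy'.lt_or_gt with h2 | h2 <;>
    by_cases h3 : x.1 < c <;> simp [h1, h2, h3, h1.not_gt, h2.not_gt]
  all_goals linarith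

lemma crossing_horizontal (c : ℝ) {x : ℝ × ℝ} (y y' : ℝ) : crossing x (y, c) (y', c) = 0 := by
  have : ∀ a b, upCross x (a, c) (b, c) = 0 := by
    intro a b
    rw [upCross, if_neg]
    rintro ⟨h1, h2, -⟩
    exact lt_asymm h1 h2
  simp [crossing, this]

lemma boundaryEdges_cases {W H : ℝ} {B R T L : List ℝ}
    (hB : (full W B).IsChain (· < ·)) (hR : (full H R).IsChain (· < ·))
    (hT : (full W T).IsChain (· < ·)) (hL : (full H L).IsChain (· < ·))
    {e : (ℝ × ℝ) × (ℝ × ℝ)} (he : e ∈ boundaryEdges W H B R T L) :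
    (∃ a b, 0 ≤ a ∧ a < b ∧ b ≤ W ∧ e = ((a, 0), (b, 0))) ∨
    (∃ a b, 0 ≤ a ∧ a < b ∧ b ≤ H ∧ e = ((W, a), (W, b))) ∨
    (∃ a b, 0 ≤ a ∧ a < b ∧ b ≤ W ∧ e = ((b, H), (a, H))) ∨
    (∃ a b, 0 ≤ a ∧ a < b ∧ b ≤ H ∧ e = ((0, b), (0, a))) := by
  simp only [boundaryEdges, List.mem_append, List.mem_map] at he
  rcases he with ((⟨e, he, rfl⟩ | ⟨e, he, rfl⟩) | ⟨e, he, rfl⟩) | ⟨e, he, rfl⟩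
  · obtain ⟨h1, h2, h3⟩ := edges_prop hB he
    exact Or.inl ⟨_, _, (mem_full_Icc hB h1).1, h3, (mem_full_Icc hB h2).2, rfl⟩
  · obtain ⟨h1, h2, h3⟩ := edges_prop hR he
    exact Or.inr (Or.inl ⟨_, _, (mem_full_Icc hR h1).1, h3, (mem_full_Icc hR h2).2, rfl⟩)
  · obtain ⟨h1, h2, h3⟩ := edges_prop hT he
    exact Or.inr (Or.inr (Or.inl
      ⟨_, _, (mem_full_Icc hT h1).1, h3, (mem_full_Icc hT h2).2, rfl⟩))
  · obtain ⟨h1, h2, h3⟩ := edges_prop hL he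
    exact Or.inr (Or.inr (Or.inr
      ⟨_, _, (mem_full_Icc hL h1).1, h3, (mem_full_Icc hL h2).2, rfl⟩))
lemma boundaryEdges_covers {W H : ℝ} (B R T L : List ℝ) {z : ℝ × ℝ} (hz : z ∈ closedRect W H)
    (hn : z ∉ openRect W H) : ∃ e ∈ boundaryEdges W H B R T L, z ∈ segment ℝ e.1 e.2 := by
  obtain ⟨x, y⟩ := z
  obtain ⟨g1, g2, g3, g4⟩ := hz
  simp only at g1 g2 g3 g4
  have seg : ∀ {a b t : ℝ}, a ≤ t → t ≤ b → ∃ u v : ℝ, 0 ≤ u ∧ 0 ≤ v ∧ u + v = 1 ∧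
      u * a + v * b = t := by
    intro a b t h1 h2
    have : t ∈ segment ℝ a b := by
      rw [segment_eq_Icc (h1.trans h2)]; exact ⟨h1, h2⟩
    obtain ⟨u, v, hu, hv, huv, h⟩ := this
    exact ⟨u, v, hu, hv, huv, by simpa using h⟩
  have : y = 0 ∨ x = W ∨ y = H ∨ x = 0 := by
    by_contra! h
    exact hn ⟨lt_of_le_of_ne g1 h.2.2.2.symm, lt_of_le_of_ne g2 h.2.1,
      lt_of_le_of_ne g3 h.1.symm, lt_of_le_of_ne g4 h.2.2.1⟩
  simp only [boundaryEdges, List.mem_append, List.mem_map]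
  rcases this with rfl | rfl | rfl | rfl
  · obtain ⟨e, he, h1, h2⟩ := exists_edge_of_le B g1 g2
    obtain ⟨u, v, hu, hv, huv, h⟩ := seg h1 h2
    exact ⟨_, Or.inl (Or.inl (Or.inl ⟨e, he, rfl⟩)), u, v, hu, hv, huv, by
      ext <;> simp [h]⟩
  · obtain ⟨e, he, h1, h2⟩ := exists_edge_of_le R g3 g4
    obtain ⟨u, v, hu, hv, huv, h⟩ := seg h1 h2
    exact ⟨_, Or.inl (Or.inl (Or.inr ⟨e, he, rfl⟩)), u, v, hu, hv, huv, by
      ext <;> simp [h]; rw [← add_mul, huv, one_mul]⟩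
  · obtain ⟨e, he, h1, h2⟩ := exists_edge_of_le T g1 g2
    obtain ⟨u, v, hu, hv, huv, h⟩ := seg h1 h2
    exact ⟨_, Or.inl (Or.inr ⟨e, he, rfl⟩), v, u, hv, hu, by linarith, by
      ext
      · simp; linarith
      · simp [← add_mul]; rw [add_comm v u, huv, one_mul]⟩
  · obtain ⟨e, he, h1, h2⟩ := exists_edge_of_le L g3 g4
    obtain ⟨u, v, hu, hv, huv, h⟩ := seg h1 h2
    exact ⟨_, Or.inr ⟨e, he, rfl⟩, v, u, hv, hu, by linarith, by
      ext
      · simp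
      · simp; linarith⟩

/-- Horizontal edges never cross a horizontal ray, and along a vertical side the crossings
telescope. What remains depends only on the end points of the left and the right side. -/
lemma crossing_boundaryEdges {W H : ℝ} (hW : 0 < W) (hH : 0 < H) {B R T L : List ℝ}
    (hR : (full H R).IsChain (· < ·))
    (hL : (full H L).IsChain (· < ·)) :
    ∃ S : Set (ℝ × ℝ), S.Finite ∧ ∀ x, Generic S x →
    ((boundaryEdges W H B R T L).map fun e => crossing x e.1 e.2).sum =
      (openRect W H).indicator (fun _ => (1 : ℝ)) x := by
  refine ⟨{p | p ∈ (full H R).map fun y => (W, y)} ∪ {p | p ∈ (full H L).map fun y => (0, y)},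
    (List.finite_toSet _).union (List.finite_toSet _), fun x hx => ?_⟩
  classical
  have vert : ∀ (c : ℝ) (l : List ℝ), (full H l).IsChain (· < ·) →
      (∀ y ∈ full H l, x.2 ≠ y) → pathSum (crossing x) ((full H l).map fun y => (c, y)) =
      (if x.2 < H ∧ x.1 < c then 1 else 0) - (if x.2 < 0 ∧ x.1 < c then 1 else 0) := by
    intro c l hl hne
    rw [pathSum_map]
    exact pathSum_telescope _ (fun y => if x.2 < y ∧ x.1 < c then (1 : ℝ) else 0) hl
      (fun y hy y' hy' hlt => crossing_vertical c hlt (hne y hy) (hne y' hy'))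
  have horiz : ∀ (c : ℝ) (l : List ℝ), pathSum (crossing x) (l.map fun y => (y, c)) = 0 := by
    intro c l
    rw [pathSum_map]
    simp only [crossing_horizontal]
    induction l with
    | nil => rfl
    | cons a l ih => cases l with
      | nil => rfl
      | cons b l => simpa using ih
  have hneR : ∀ y ∈ full H R, x.2 ≠ y := fun y hy => hx.1 (W, y) (Or.inl (by simpa using hy))
  have hneL : ∀ y ∈ full H L, x.2 ≠ y := fun y hy => hx.1 (0, y) (Or.inr (by simpa using hy))
  rw [sum_boundaryEdges _ _ _ _ _ _ (antisymm_crossing x), boundarySum, horiz, horiz,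
    vert W R hR hneR, vert 0 L hL hneL]
  have hx0 : x.1 ≠ 0 := by
    intro h0
    refine hx.2 (0, 0) (Or.inr ?_) (0, H) (Or.inr ?_) ?_ ?_
    · simp [full]
    · simp [full]
    · simp [hH.ne]
    · simp [det2, h0]
  have hxW : x.1 ≠ W := by
    intro h0
    refine hx.2 (W, 0) (Or.inl ?_) (W, H) (Or.inl ?_) ?_ ?_
    · simp [full]
    · simp [full]
    · simp [hH.ne]
    · simp [det2, h0]
  have hy0 : x.2 ≠ 0 := hneR 0 (by simp [full])
  have hyH : x.2 ≠ H := hneR H (by simp [full])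
  simp only [Set.indicator, openRect, Set.mem_ofPred_eq]
  rcases hx0.lt_or_gt with h1 | h1 <;> rcases hxW.lt_or_gt with h2 | h2 <;>
  rcases hy0.lt_or_gt with h3 | h3 <;> rcases hyH.lt_or_gt with h4 | h4 <;>
    first
    | (exfalso; linarith)
    | simp [h1, h2, h3, h4, h1.not_gt, h2.not_gt, h3.not_gt, h4.not_gt]

lemma isBoundary_boundaryEdges {W H : ℝ} (hW : 0 < W) (hH : 0 < H) {B R T L : List ℝ}
    (hB : (full W B).IsChain (· < ·)) (hR : (full H R).IsChain (· < ·))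
    (hT : (full W T).IsChain (· < ·)) (hL : (full H L).IsChain (· < ·)) :
    IsBoundary W H (boundaryEdges W H B R T L) := by
  have hcases := fun e he => boundaryEdges_cases hB hR hT hL (e := e) he
  refine ⟨?_, ?_, ?_, ?_, fun x => boundaryEdges_covers B R T L, crossing_boundaryEdges hW hH hR hL⟩
  · intro e he
    rcases hcases e he with h | h | h | h <;> obtain ⟨a, b, h1, h2, h3, rfl⟩ := h <;>
      simp [h2.ne, h2.ne']
  · intro e he
    rcases hcases e he with h | h | h | h <;> obtain ⟨a, b, h1, h2, h3, rfl⟩ := h <;>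
      simp only [closedRect, openRect, Set.mem_ofPred_eq] <;>
      refine ⟨⟨?_, ?_, ?_, ?_⟩, fun ⟨g1, g2, g3, g4⟩ => ?_⟩ <;> linarith
  · intro e he
    rcases hcases e he with h | h | h | h <;> obtain ⟨a, b, h1, h2, h3, rfl⟩ := h <;>
      simp only [closedRect, openRect, Set.mem_ofPred_eq] <;>
      refine ⟨⟨?_, ?_, ?_, ?_⟩, fun ⟨g1, g2, g3, g4⟩ => ?_⟩ <;> linarith
  · rintro e he x ⟨g1, g2, g3, g4⟩
    rcases hcases e he with h | h | h | h <;> obtain ⟨a, b, h1, h2, h3, rfl⟩ := h <;>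
      simp only [det2, Prod.fst_sub, Prod.snd_sub] <;> nlinarith

/-- The end points of the boundary edges. -/
lemma exists_boundaryEdge_iff {W H : ℝ} {B R T L : List ℝ}
    (hB : (full W B).IsChain (· < ·)) (hR : (full H R).IsChain (· < ·))
    (hT : (full W T).IsChain (· < ·)) (hL : (full H L).IsChain (· < ·)) (x : ℝ × ℝ) :
    (∃ e ∈ boundaryEdges W H B R T L, e.1 = x ∨ e.2 = x) ↔
      (x.1 ∈ full W B ∧ x.2 = 0) ∨ (x.1 = W ∧ x.2 ∈ full H R) ∨
      (x.1 ∈ full W T ∧ x.2 = H) ∨ (x.1 = 0 ∧ x.2 ∈ full H L) := by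
  have len : ∀ W l, 2 ≤ (full W l).length := by intro W l; simp [full]
  constructor
  · rintro ⟨e, he, h⟩
    simp only [boundaryEdges, List.mem_append, List.mem_map] at he
    rcases he with ((⟨e, he, rfl⟩ | ⟨e, he, rfl⟩) | ⟨e, he, rfl⟩) | ⟨e, he, rfl⟩
    · have h1 := edges_prop hB he
      rcases h with rfl | rfl
      exacts [Or.inl ⟨h1.1, rfl⟩, Or.inl ⟨h1.2.1, rfl⟩]
    · have h1 := edges_prop hR he
      rcases h with rfl | rfl
      exacts [Or.inr (Or.inl ⟨rfl, h1.1⟩), Or.inr (Or.inl ⟨rfl, h1.2.1⟩)]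
    · have h1 := edges_prop hT he
      rcases h with rfl | rfl
      exacts [Or.inr (Or.inr (Or.inl ⟨h1.2.1, rfl⟩)), Or.inr (Or.inr (Or.inl ⟨h1.1, rfl⟩))]
    · have h1 := edges_prop hL he
      rcases h with rfl | rfl
      exacts [Or.inr (Or.inr (Or.inr ⟨rfl, h1.2.1⟩)), Or.inr (Or.inr (Or.inr ⟨rfl, h1.1⟩))]
  · obtain ⟨x, y⟩ := x
    simp only [boundaryEdges, List.mem_append, List.mem_map]
    rintro (⟨h, rfl⟩ | ⟨rfl, h⟩ | ⟨h, rfl⟩ | ⟨rfl, h⟩)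
    · obtain ⟨e, he, h'⟩ := exists_edge_of_mem h (len _ _)
      exact ⟨_, Or.inl (Or.inl (Or.inl ⟨e, he, rfl⟩)), by simpa using h'⟩
    · obtain ⟨e, he, h'⟩ := exists_edge_of_mem h (len _ _)
      exact ⟨_, Or.inl (Or.inl (Or.inr ⟨e, he, rfl⟩)), by simpa using h'⟩
    · obtain ⟨e, he, h'⟩ := exists_edge_of_mem h (len _ _)
      exact ⟨_, Or.inl (Or.inr ⟨e, he, rfl⟩), by simpa using h'.symm⟩
    · obtain ⟨e, he, h'⟩ := exists_edge_of_mem h (len _ _)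
      exact ⟨_, Or.inr ⟨e, he, rfl⟩, by simpa using h'.symm⟩

lemma Good.convex4 {q : Fin 4 → ℝ × ℝ} (h : Good q) : Convex4 q := fun i => (h i).1

lemma exists_meshData {W H : ℝ} (hW : 0 < W) (hH : 0 < H) {B R T L : List ℝ}
    (hB : (full W B).IsChain (· < ·)) (hR : (full H R).IsChain (· < ·))
    (hT : (full W T).IsChain (· < ·)) (hL : (full H L).IsChain (· < ·)) {N : ℕ}
    (h : Fills Good N (boundarySum W H B R T L)) :
    ∃ Q : List (Fin 4 → ℝ × ℝ), Q.length ≤ N ∧ (∀ q ∈ Q, Good q) ∧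
      MeshData W H (boundaryEdges W H B R T L) Q := by
  obtain ⟨Q, h1, h2, h3⟩ := h
  exact ⟨Q, h1, h2, hW, hH, fun q hq => (h2 q hq).convex4, isBoundary_boundaryEdges hW hH hB hR hT hL,
    fun f hf => by rw [h3 f hf, sum_boundaryEdges _ _ _ _ _ _ hf]⟩

/-! ### Transfer to rectangles in the Euclidean plane -/

lemma plane_inner (a b : Plane) : inner ℝ a b = a 0 * b 0 + a 1 * b 1 := by
  simp [PiLp.inner_apply, Fin.sum_univ_two, mul_comm]

lemma angle_mem_Icc {a b : Plane} (ha : a ≠ 0) (hb : b ≠ 0)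
    (h : 4 * inner ℝ a b ^ 2 ≤ inner ℝ a a * inner ℝ b b) :
    InnerProductGeometry.angle a b ∈ Set.Icc (Real.pi / 3) (2 * Real.pi / 3) := by
  have ha' : 0 < ‖a‖ := norm_pos_iff.2 ha
  have hb' : 0 < ‖b‖ := norm_pos_iff.2 hb
  rw [real_inner_self_eq_norm_sq, real_inner_self_eq_norm_sq] at h
  have hab : 0 < ‖a‖ * ‖b‖ := by positivity
  have h1 : |inner ℝ a b| ≤ (1 / 2) * (‖a‖ * ‖b‖) := by
    apply abs_le_of_sq_le_sq _ (by positivity)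
    nlinarith
  have h2 : |inner ℝ a b / (‖a‖ * ‖b‖)| ≤ 1 / 2 := by
    rw [abs_div, abs_of_pos hab, div_le_iff₀ hab]; exact h1
  obtain ⟨h3, h4⟩ := abs_le.1 h2
  have e1 : Real.arccos (1 / 2) = Real.pi / 3 := by
    rw [← Real.cos_pi_div_three]
    exact Real.arccos_cos (by positivity) (by linarith [Real.pi_pos])
  rw [InnerProductGeometry.angle]
  constructor
  · rw [← e1]; exact Real.arccos_le_arccos h4
  · have := Real.arccos_le_arccos h3
    rw [Real.arccos_neg, e1] at this
    linarith

namespace Rectangle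

variable (R : Rectangle)

/-- The frame of the rectangle, scaled so that the rectangle is the image of `[0, W] × [0, H]`. -/
noncomputable def frame (W H : ℝ) : ℝ × ℝ →ᵃ[ℝ] Plane :=
  ((LinearMap.fst ℝ ℝ ℝ).smulRight (W⁻¹ • (R.corner 1 - R.corner 0)) +
    (LinearMap.snd ℝ ℝ ℝ).smulRight (H⁻¹ • (R.corner 3 - R.corner 0))).toAffineMap +
  AffineMap.const ℝ (ℝ × ℝ) (R.corner 0)

lemma frame_apply (W H : ℝ) (x : ℝ × ℝ) : R.frame W H x =
    R.corner 0 + ((x.1 / W) • (R.corner 1 - R.corner 0) +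
      (x.2 / H) • (R.corner 3 - R.corner 0)) := by
  simp [frame, smul_smul, div_eq_mul_inv]
  abel

variable {W H : ℝ} (hW : 0 < W) (hH : 0 < H)
include hW hH

lemma frame_injective : Function.Injective (R.frame W H) := by
  intro x y h
  rw [frame_apply, frame_apply, add_right_inj] at h
  obtain ⟨h1, h2⟩ := R.coord_unique h
  ext
  · field_simp at h1; exact h1
  · field_simp at h2; exact h2

lemma frame_surjective : Function.Surjective (R.frame W H) := by
  have hlin : ∀ x, ((LinearMap.fst ℝ ℝ ℝ).smulRight (W⁻¹ • (R.corner 1 - R.corner 0)) +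
      (LinearMap.snd ℝ ℝ ℝ).smulRight (H⁻¹ • (R.corner 3 - R.corner 0))) x =
      R.frame W H x - R.corner 0 := by
    intro x
    rw [frame_apply]
    simp [smul_smul, div_eq_mul_inv]
  have hinj : Function.Injective ((LinearMap.fst ℝ ℝ ℝ).smulRight
      (W⁻¹ • (R.corner 1 - R.corner 0)) +
      (LinearMap.snd ℝ ℝ ℝ).smulRight (H⁻¹ • (R.corner 3 - R.corner 0))) := by
    intro x y h
    apply R.frame_injective hW hH
    rw [hlin, hlin] at h
    exact sub_left_injective h
  have hs := (LinearMap.injective_iff_surjective_of_finrank_eq_finrank (by simp)).1 hinj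
  intro x
  obtain ⟨y, hy⟩ := hs (x - R.corner 0)
  refine ⟨y, ?_⟩
  rw [hlin] at hy
  exact sub_left_injective hy

lemma exists_homeomorph : ∃ e : (ℝ × ℝ) ≃ₜ Plane, ∀ x, e x = R.frame W H x := by
  let e := AffineEquiv.ofBijective (φ := R.frame W H)
    ⟨R.frame_injective hW hH, R.frame_surjective hW hH⟩
  exact ⟨(AffineEquiv.toContinuousAffineEquiv e).toHomeomorph, fun x => rfl⟩

lemma carrier_eq : R.toPolygon.carrier = R.frame W H '' (closedRect W H \ openRect W H) := by
  have hseg : ∀ x : ℝ × ℝ, ∀ i : Fin 4, ∀ a b : ℝ, 0 ≤ a → 0 ≤ b → a + b = 1 →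
      x.1 / W = a * cornerX i + b * cornerX (i + 1) →
      x.2 / H = a * cornerY i + b * cornerY (i + 1) →
      R.frame W H x ∈ segment ℝ (R.corner i) (R.corner (i + 1)) := by
    intro x i a b ha hb hab h1 h2
    refine ⟨a, b, ha, hb, hab, ?_⟩
    rw [frame_apply, h1, h2, R.corner_eq i, R.corner_eq (i + 1)]
    obtain rfl : b = 1 - a := by linarith
    module
  apply Set.Subset.antisymm
  · intro x hx
    obtain ⟨i, hi⟩ := Set.mem_iUnion.1 hx
    obtain ⟨a, b, ha, hb, hab, rfl⟩ := R.mem_segment hi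
    refine ⟨((a * cornerX i + b * cornerX (i + 1)) * W, (a * cornerY i + b * cornerY (i + 1)) * H),
      ?_, ?_⟩
    · obtain rfl : b = 1 - a := by linarith
      have ha1 : a ≤ 1 := by linarith
      have x0 : 0 ≤ a * cornerX i + (1 - a) * cornerX (i + 1) := by
        clear hi hx; fin_cases i <;> simp [cornerX] <;> linarith
      have x1 : a * cornerX i + (1 - a) * cornerX (i + 1) ≤ 1 := by
        clear hi hx; fin_cases i <;> simp [cornerX] <;> linarith
      have y0 : 0 ≤ a * cornerY i + (1 - a) * cornerY (i + 1) := by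
        clear hi hx; fin_cases i <;> simp [cornerY] <;> linarith
      have y1 : a * cornerY i + (1 - a) * cornerY (i + 1) ≤ 1 := by
        clear hi hx; fin_cases i <;> simp [cornerY] <;> linarith
      refine ⟨⟨by positivity, by dsimp only; nlinarith, by positivity, by dsimp only; nlinarith⟩, ?_⟩
      clear hi hx x0 x1 y0 y1
      simp only [openRect, Set.mem_ofPred_eq]
      fin_cases i <;> simp [cornerX, cornerY]
    · rw [frame_apply]
      congr 3 <;> field_simp
  · rintro _ ⟨x, ⟨⟨h1, h2, h3, h4⟩, hn⟩, rfl⟩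
    have : x.2 = 0 ∨ x.1 = W ∨ x.2 = H ∨ x.1 = 0 := by
      by_contra! h
      exact hn ⟨lt_of_le_of_ne h1 h.2.2.2.symm, lt_of_le_of_ne h2 h.2.1,
        lt_of_le_of_ne h3 h.1.symm, lt_of_le_of_ne h4 h.2.2.1⟩
    have q1 : 0 ≤ x.1 / W := by positivity
    have q2 : 0 ≤ x.2 / H := by positivity
    have q3 : x.1 / W ≤ 1 := (div_le_one hW).2 h2
    have q4 : x.2 / H ≤ 1 := (div_le_one hH).2 h4
    refine Set.mem_iUnion.2 ?_
    rcases this with h | h | h | h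
    · exact ⟨0, hseg x 0 (1 - x.1 / W) (x.1 / W) (by linarith) q1 (by ring)
        (by simp [cornerX]) (by simp [cornerY, h])⟩
    · exact ⟨1, hseg x 1 (1 - x.2 / H) (x.2 / H) (by linarith) q2 (by ring)
        (by simp [cornerX, h, hW.ne']) (by simp [cornerY])⟩
    · exact ⟨2, hseg x 2 (x.1 / W) (1 - x.1 / W) q1 (by linarith) (by ring)
        (by simp [cornerX]) (by simp [cornerY, h, hH.ne'])⟩
    · exact ⟨3, hseg x 3 (x.2 / H) (1 - x.2 / H) q2 (by linarith) (by ring)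
        (by simp [cornerX, h]) (by simp [cornerY])⟩

/-- For a rectangle no Jordan curve theorem is needed: from an outer point a ray escapes to infinity
without meeting the rectangle, while the component of an inner point cannot leave the open
rectangle, since the complement of the curve is the union of two disjoint open sets. -/
lemma region_eq {P : SimplePolygon} (hP : P.carrier = R.toPolygon.carrier) :
    P.region = R.frame W H '' closedRect W H := by
  obtain ⟨e, he⟩ := R.exists_homeomorph hW hH
  have hfe : ⇑(R.frame W H) = ⇑e := funext fun x => (he x).symm
  have hc : P.carrier = e '' (closedRect W H \ openRect W H) := by
    rw [hP, R.carrier_eq hW hH, hfe]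
  have hsub : openRect W H ⊆ closedRect W H := fun x ⟨h1, h2, h3, h4⟩ =>
    ⟨h1.le, h2.le, h3.le, h4.le⟩
  have hbdd : Bornology.IsBounded (closedRect W H) := by
    have : closedRect W H = Set.Icc 0 W ×ˢ Set.Icc 0 H := by
      ext; simp only [closedRect, Set.mem_ofPred_eq, Set.mem_prod, Set.mem_Icc, and_assoc]
    rw [this]
    exact (Metric.isBounded_Icc _ _).prod (Metric.isBounded_Icc _ _)
  have hcomp : IsCompact (closedRect W H) :=
    Metric.isCompact_of_isClosed_isBounded (isClosed_closedRect W H) hbdd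
  rw [SimplePolygon.region, hfe]
  apply Set.Subset.antisymm
  · rintro x (hx | ⟨hx, hb⟩)
    · rw [hc] at hx
      exact Set.image_mono Set.sdiff_subset hx
    · obtain ⟨z, rfl⟩ := e.surjective x
      by_contra hz
      have hz' : z ∉ closedRect W H := fun h => hz ⟨z, h, rfl⟩
      -- a ray from `z` that avoids the rectangle
      have : ∃ d : ℝ × ℝ, d ≠ 0 ∧ ∀ t : ℝ, 0 ≤ t → z + t • d ∉ closedRect W H := by
        by_cases g1 : z.1 < 0
        · refine ⟨(-1, 0), by simp, fun t ht h => ?_⟩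
          have := h.1
          simp at this; linarith
        by_cases g2 : W < z.1
        · refine ⟨(1, 0), by simp, fun t ht h => ?_⟩
          have := h.2.1
          simp at this; linarith
        by_cases g3 : z.2 < 0
        · refine ⟨(0, -1), by simp, fun t ht h => ?_⟩
          have := h.2.2.1
          simp at this; linarith
        by_cases g4 : H < z.2
        · refine ⟨(0, 1), by simp, fun t ht h => ?_⟩
          have := h.2.2.2
          simp at this; linarith
        exact absurd ⟨not_lt.1 g1, not_lt.1 g2, not_lt.1 g3, not_lt.1 g4⟩ hz'
      obtain ⟨d, hd, hray⟩ := this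
      let ray := (fun t : ℝ => e (z + t • d)) '' Set.Ici 0
      have hconn : IsPreconnected ray :=
        isPreconnected_Ici.image _ (by have := e.continuous; fun_prop)
      have hsubc : ray ⊆ P.carrierᶜ := by
        rintro _ ⟨t, ht, rfl⟩ h
        rw [hc] at h
        obtain ⟨w, hw, hw'⟩ := h
        exact hray t ht (e.injective hw' ▸ hw.1)
      have hmem : e z ∈ ray := ⟨0, by simp, by simp⟩
      have hb' := hb.subset (hconn.subset_connectedComponentIn hmem hsubc)
      have hcl : IsCompact (closure ray) := hb'.isCompact_closure
      have hcl2 := (hcl.image e.symm.continuous).isBounded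
      obtain ⟨C, hC⟩ := hcl2.exists_norm_le
      have hdn : 0 < ‖d‖ := norm_pos_iff.2 hd
      have ht : 0 ≤ (|C| + ‖z‖ + 1) / ‖d‖ := by positivity
      have h1 := hC (z + ((|C| + ‖z‖ + 1) / ‖d‖) • d)
        ⟨e (z + ((|C| + ‖z‖ + 1) / ‖d‖) • d), subset_closure ⟨_, ht, rfl⟩, by simp⟩
      have h2 : ‖((|C| + ‖z‖ + 1) / ‖d‖) • d‖ = |C| + ‖z‖ + 1 := by
        rw [norm_smul, Real.norm_of_nonneg ht]; field_simp
      have h3 := norm_sub_le (z + ((|C| + ‖z‖ + 1) / ‖d‖) • d) z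
      rw [add_sub_cancel_left, h2] at h3
      linarith [le_abs_self C]
  · rintro _ ⟨z, hz, rfl⟩
    by_cases ho : z ∈ openRect W H
    · refine Or.inr ⟨?_, ?_⟩
      · rw [hc]
        rintro ⟨w, hw, hw'⟩
        exact hw.2 (e.injective hw' ▸ ho)
      · have hb : Bornology.IsBounded (e '' openRect W H) :=
          ((hcomp.image e.continuous).isBounded).subset (Set.image_mono hsub)
        refine hb.subset ?_
        have hpre : IsPreconnected (connectedComponentIn P.carrierᶜ (e z)) :=
          isPreconnected_connectedComponentIn
        have hzc : e z ∈ P.carrierᶜ := by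
          rw [hc]
          rintro ⟨w, hw, hw'⟩
          exact hw.2 (e.injective hw' ▸ ho)
        refine hpre.subset_left_of_subset_union (u := e '' openRect W H)
          (v := e '' (closedRect W H)ᶜ) (e.isOpenMap _ (isOpen_openRect W H))
          (e.isOpenMap _ (isClosed_closedRect W H).isOpen_compl) ?_ ?_ ?_
        · rw [Set.disjoint_left]
          rintro _ ⟨a, ha, rfl⟩ ⟨b, hb, hab⟩
          exact hb (e.injective hab ▸ hsub ha)
        · refine (connectedComponentIn_subset _ _).trans ?_
          intro x hx
          obtain ⟨w, rfl⟩ := e.surjective x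
          by_cases hw : w ∈ closedRect W H
          · by_cases hw' : w ∈ openRect W H
            · exact Or.inl ⟨w, hw', rfl⟩
            · exact absurd (by rw [hc]; exact ⟨w, ⟨hw, hw'⟩, rfl⟩) hx
          · exact Or.inr ⟨w, hw, rfl⟩
        · exact ⟨e z, mem_connectedComponentIn hzc, z, ho, rfl⟩
    · exact Or.inl (by rw [hc]; exact ⟨z, ⟨hz, ho⟩, rfl⟩)

end Rectangle

/-! ### The frame as a similarity, and the passage from fillings to meshes in the plane. -/

namespace Rectangle

variable (R : Rectangle)

/-- The orientation of the rectangle. -/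
def orient : ℝ := cross (R.corner 1 - R.corner 0) (R.corner 3 - R.corner 0)

lemma orient_sq : R.orient ^ 2 = inner ℝ (R.corner 1 - R.corner 0) (R.corner 1 - R.corner 0) *
    inner ℝ (R.corner 3 - R.corner 0) (R.corner 3 - R.corner 0) := by
  have h := R.right_angle
  rw [plane_inner] at *
  rw [plane_inner, orient, cross]
  linear_combination (-(((R.corner 1 - R.corner 0) 0 * (R.corner 3 - R.corner 0) 0 +
    (R.corner 1 - R.corner 0) 1 * (R.corner 3 - R.corner 0) 1))) * h

lemma orient_ne : R.orient ≠ 0 := by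
  intro h
  have := R.orient_sq
  rw [h] at this
  have h1 : inner ℝ (R.corner 1 - R.corner 0) (R.corner 1 - R.corner 0) ≠ (0 : ℝ) := by
    simpa [sub_eq_zero] using R.ne_one
  have h2 : inner ℝ (R.corner 3 - R.corner 0) (R.corner 3 - R.corner 0) ≠ (0 : ℝ) := by
    simpa [sub_eq_zero] using R.ne_three
  exact mul_ne_zero h1 h2 (by rw [← this]; ring)

variable {W H : ℝ}

lemma cross_frame (a b c d : ℝ × ℝ) :
    cross (R.frame W H b - R.frame W H a) (R.frame W H d - R.frame W H c) =
      R.orient / (W * H) * det2 (b - a) (d - c) := by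
  simp only [frame_apply, cross, orient, det2, Prod.fst_sub, Prod.snd_sub, PiLp.sub_apply,
    PiLp.add_apply, PiLp.smul_apply, smul_eq_mul]
  ring

variable (hW : 0 < W) (hH : 0 < H)
  (hsim : inner ℝ (R.corner 1 - R.corner 0) (R.corner 1 - R.corner 0) * H ^ 2 =
    inner ℝ (R.corner 3 - R.corner 0) (R.corner 3 - R.corner 0) * W ^ 2)
include hW hH hsim

/-- By `hsim` the ratio `W : H` is that of the sides, so the frame multiplies all scalar products by
one factor and preserves angles. -/
lemma inner_frame (a b c d : ℝ × ℝ) :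
    inner ℝ (R.frame W H b - R.frame W H a) (R.frame W H d - R.frame W H c) =
      inner ℝ (R.corner 1 - R.corner 0) (R.corner 1 - R.corner 0) / W ^ 2 *
        dot2 (b - a) (d - c) := by
  have e : ∀ a b : ℝ × ℝ, R.frame W H b - R.frame W H a =
      ((b.1 - a.1) / W) • (R.corner 1 - R.corner 0) +
      ((b.2 - a.2) / H) • (R.corner 3 - R.corner 0) := by
    intro a b
    rw [frame_apply, frame_apply]
    module
  have huv := R.right_angle
  have hvu : inner ℝ (R.corner 3 - R.corner 0) (R.corner 1 - R.corner 0) = (0 : ℝ) := by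
    rw [real_inner_comm]; exact huv
  have hs : inner ℝ (R.corner 3 - R.corner 0) (R.corner 3 - R.corner 0) =
      inner ℝ (R.corner 1 - R.corner 0) (R.corner 1 - R.corner 0) / W ^ 2 * H ^ 2 := by
    field_simp; linarith
  rw [e, e]
  simp only [inner_add_left, inner_add_right, real_inner_smul_left, real_inner_smul_right, huv,
    hvu, hs, dot2, Prod.fst_sub, Prod.snd_sub]
  field_simp
  ring

lemma frame_nice {a b c : ℝ × ℝ} (h : NiceTurn (b - a) (c - b)) :
    EuclideanGeometry.angle (R.frame W H a) (R.frame W H b) (R.frame W H c) ∈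
      Set.Icc (Real.pi / 3) (2 * Real.pi / 3) := by
  obtain ⟨h1, h2⟩ := h
  have inj := R.frame_injective hW hH
  have hab : a ≠ b := by rintro rfl; simp [det2] at h1
  have hcb : c ≠ b := by rintro rfl; simp [det2] at h1
  have hK : 0 ≤ inner ℝ (R.corner 1 - R.corner 0) (R.corner 1 - R.corner 0) / W ^ 2 :=
    div_nonneg real_inner_self_nonneg (by positivity)
  rw [EuclideanGeometry.angle, vsub_eq_sub, vsub_eq_sub]
  refine angle_mem_Icc (sub_ne_zero.2 (inj.ne hab)) (sub_ne_zero.2 (inj.ne hcb)) ?_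
  rw [R.inner_frame hW hH hsim, R.inner_frame hW hH hsim, R.inner_frame hW hH hsim]
  have key : 4 * dot2 (a - b) (c - b) ^ 2 ≤ dot2 (a - b) (a - b) * dot2 (c - b) (c - b) := by
    have e1 : dot2 (a - b) (c - b) = -dot2 (b - a) (c - b) := by
      simp only [dot2, Prod.fst_sub, Prod.snd_sub]; ring
    have e2 : dot2 (a - b) (a - b) * dot2 (c - b) (c - b) =
        dot2 (b - a) (c - b) ^ 2 + det2 (b - a) (c - b) ^ 2 := by
      simp only [dot2, det2, Prod.fst_sub, Prod.snd_sub]; ring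
    rw [e1, e2, neg_sq]; linarith
  have := mul_le_mul_of_nonneg_left key (mul_nonneg hK hK)
  linarith

/-- A filling of the marked rectangle in coordinates yields a nice mesh. -/
theorem exists_niceMesh_of_fills {P : SimplePolygon} (hP : P.carrier = R.toPolygon.carrier)
    {B D T L : List ℝ}
    (hB : (full W B).IsChain (· < ·)) (hD : (full H D).IsChain (· < ·))
    (hT : (full W T).IsChain (· < ·)) (hL : (full H L).IsChain (· < ·))
    (hv : P.vertices = R.frame W H ''
      {x | ∃ e ∈ boundaryEdges W H B D T L, e.1 = x ∨ e.2 = x}) {N : ℕ}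
    (h : Fills Good N (boundarySum W H B D T L)) :
    ∃ M, IsNiceMeshExtending M P ∧ M.card ≤ N := by
  classical
  obtain ⟨Q, hQN, hQ, hM⟩ := exists_meshData hW hH hB hD hT hL h
  -- If the corners of the rectangle run clockwise, the frame reverses the orientation and the
  -- corners of each cell must be listed in the opposite order. `σ` is this relabeling, and `τ`
  -- gives the new index of a side.
  obtain ⟨σ, τ, hσ, hστ, hgood⟩ : ∃ σ τ : Fin 4 → Fin 4, (∀ i, σ (σ i) = i) ∧
      (∀ (q : Fin 4 → ℝ × ℝ) (i : Fin 4),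
        s(q i, q (i + 1)) = s(q (σ (τ i)), q (σ (τ i + 1)))) ∧
      ∀ q, Good q → IsConvexQuad (fun i => R.frame W H (q (σ i))) ∧
        IsNice (fun i => R.frame W H (q (σ i))) := by
    rcases R.orient_ne.lt_or_gt with ho | ho
    · refine ⟨![1, 0, 3, 2], ![0, 3, 2, 1], by decide, ?_, fun q hq => ⟨fun i => ?_, fun i => ?_⟩⟩
      · intro q i
        fin_cases i
        · exact Sym2.eq_swap
        · exact Sym2.eq_swap
        · exact Sym2.eq_swap
        · exact Sym2.eq_swap
      · rw [cross_frame]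
        refine mul_pos_of_neg_of_neg (div_neg_of_neg_of_pos ho (by positivity)) ?_
        have key : ∀ a b c : ℝ × ℝ, NiceTurn (b - a) (c - b) → det2 (b - c) (a - b) < 0 := by
          intro a b c h
          have := h.1
          simp only [det2, Prod.fst_sub, Prod.snd_sub] at *
          linarith
        fin_cases i
        · exact key _ _ _ (hq 3)
        · exact key _ _ _ (hq 2)
        · exact key _ _ _ (hq 1)
        · exact key _ _ _ (hq 0)
      · fin_cases i
        · rw [EuclideanGeometry.angle_comm]; exact R.frame_nice hW hH hsim (hq 3)
        · rw [EuclideanGeometry.angle_comm]; exact R.frame_nice hW hH hsim (hq 2)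
        · rw [EuclideanGeometry.angle_comm]; exact R.frame_nice hW hH hsim (hq 1)
        · rw [EuclideanGeometry.angle_comm]; exact R.frame_nice hW hH hsim (hq 0)
    · refine ⟨id, id, fun i => rfl, fun _ _ => rfl, fun q hq => ⟨fun i => ?_, fun i => ?_⟩⟩
      · rw [cross_frame]
        exact mul_pos (by positivity) (hq i).1
      · exact R.frame_nice hW hH hsim (hq i)
  have hrange : ∀ q : Fin 4 → ℝ × ℝ, Set.range (fun i => R.frame W H (q (σ i))) =
      R.frame W H '' Set.range q := by
    intro q
    ext x
    constructor
    · rintro ⟨i, rfl⟩; exact ⟨_, ⟨σ i, rfl⟩, rfl⟩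
    · rintro ⟨_, ⟨i, rfl⟩, rfl⟩; exact ⟨σ i, by simp [hσ]⟩
  have hcell : ∀ q ∈ Q, cell (fun i => R.frame W H (q (σ i))) = R.frame W H '' closedQuad q := by
    intro q hq
    rw [cell, hrange, (hM.convex q hq).closedQuad_eq, AffineMap.image_convexHull]
  have inj := R.frame_injective hW hH
  refine ⟨(Q.map fun q i => R.frame W H (q (σ i))).toFinset, ⟨?_, ?_, ?_, ?_, ?_⟩, ?_⟩
  · simp only [List.mem_toFinset, List.mem_map]
    rintro _ ⟨q, hq, rfl⟩
    exact (hgood q (hQ q hq)).1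
  · simp only [List.mem_toFinset, List.mem_map]
    rintro _ ⟨q, hq, rfl⟩
    exact (hgood q (hQ q hq)).2
  · rw [R.region_eq hW hH hP, ← hM.iUnion_closedQuad]
    simp only [List.mem_toFinset, List.mem_map, Set.iUnion_exists, Set.biUnion_and',
      Set.iUnion_iUnion_eq_right, Set.image_iUnion]
    exact Set.iUnion₂_congr hcell
  · simp only [List.mem_toFinset, List.mem_map]
    rintro _ ⟨q, hq, rfl⟩ _ ⟨q', hq', rfl⟩ hne
    have hne' : q ≠ q' := by rintro rfl; exact hne rfl
    have hseg : ∀ i, segment ℝ (R.frame W H (q (σ (τ i)))) (R.frame W H (q (σ (τ i + 1)))) =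
        R.frame W H '' segment ℝ (q i) (q (i + 1)) := by
      intro i
      rw [image_segment]
      rcases Sym2.eq_iff.1 (hστ q i) with ⟨h1, h2⟩ | ⟨h1, h2⟩
      · rw [h1, h2]
      · rw [h1, h2, segment_symm]
    rw [MeetProperly, hcell q hq, hcell q' hq', ← Set.image_inter inj]
    rcases hM.meet hq hq' hne' with h0 | ⟨i, j, h1, h2⟩ | ⟨i, j, h1, h2⟩
    · exact Or.inl (by rw [h0, Set.image_empty])
    · refine Or.inr (Or.inl ⟨σ i, σ j, by simp [hσ, h1], ?_⟩)
      rw [h2, Set.image_singleton, hσ]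
    · refine Or.inr (Or.inr ⟨τ i, τ j, ?_, ?_⟩)
      · rw [hστ q i, hστ q' j] at h1
        have := congrArg (Sym2.map (R.frame W H)) h1
        simpa only [Sym2.map_mk] using this
      · rw [h2, hseg]
  · rw [hv, hP, R.carrier_eq hW hH]
    simp only [List.mem_toFinset, List.mem_map, Set.iUnion_exists, Set.biUnion_and',
      Set.iUnion_iUnion_eq_right, hrange]
    rw [← Set.image_iUnion₂, ← Set.image_inter inj]
    congr 1
    ext x
    rw [Set.mem_ofPred_eq, ← hM.boundary_vertices x]
    constructor
    · rintro ⟨h1, h2⟩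
      obtain ⟨q, hq, i, hi⟩ := Set.mem_iUnion₂.1 h1
      exact ⟨⟨q, hq, i, hi⟩, h2.2⟩
    · rintro ⟨⟨q, hq, i, rfl⟩, h2⟩
      exact ⟨Set.mem_iUnion₂.2 ⟨q, hq, i, rfl⟩,
        hM.closedQuad_subset hq ((hM.convex q hq).vertex_mem i), h2⟩
  · exact (List.toFinset_card_le _).trans (by simpa using hQN)

end Rectangle

/-! ### Turns -/

/-- The slope of a line at `30°`. -/
noncomputable def kap : ℝ := 1 / √3

lemma kap_pos : 0 < kap := by unfold kap; positivity

lemma kap_sq : 3 * kap ^ 2 = 1 := by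
  unfold kap
  rw [div_pow, Real.sq_sqrt (by norm_num)]; norm_num

lemma kap_lt : kap < 58 / 100 := by
  by_contra! h
  nlinarith [kap_sq]

lemma niceTurn_scale {u v : ℝ × ℝ} {a b : ℝ} (ha : 0 < a) (hb : 0 < b) (h : NiceTurn u v) :
    NiceTurn (a • u) (b • v) := by
  obtain ⟨h1, h2⟩ := h
  have e1 : det2 (a • u) (b • v) = a * b * det2 u v := by simp [det2]; ring
  have e2 : dot2 (a • u) (b • v) = a * b * dot2 u v := by simp [dot2]; ring
  rw [NiceTurn, e1, e2]
  refine ⟨by positivity, ?_⟩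
  have := mul_le_mul_of_nonneg_left h2 (sq_nonneg (a * b))
  linarith

lemma NiceTurn.of_eq {u v u' v' : ℝ × ℝ} {a b : ℝ} (h : NiceTurn u v) (ha : 0 < a) (hb : 0 < b)
    (hu : u' = a • u) (hv : v' = b • v) : NiceTurn u' v' := by
  rw [hu, hv]; exact niceTurn_scale ha hb h

/-- A nearly horizontal and a nearly vertical side, tilted in different directions. -/
lemma niceTurn_mixed {c e p t : ℝ} (hc : 0 < c) (ht : 0 < t) (hep : e * p ≤ 0)
    (he : 3 * e ^ 2 ≤ c ^ 2) (hp : 3 * p ^ 2 ≤ t ^ 2) : NiceTurn (c, e) (p, t) := by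
  have hct : 0 < c * t := mul_pos hc ht
  have hd : c * t ≤ det2 (c, e) (p, t) := by simp only [det2]; linarith
  refine ⟨by linarith, ?_⟩
  have h1 : (c * t) ^ 2 ≤ det2 (c, e) (p, t) ^ 2 := pow_le_pow_left₀ hct.le hd 2
  have h2 : 3 * (c * p) ^ 2 ≤ (c * t) ^ 2 := by
    have := mul_le_mul_of_nonneg_left hp (sq_nonneg c); nlinarith
  have h3 : 3 * (e * t) ^ 2 ≤ (c * t) ^ 2 := by
    have := mul_le_mul_of_nonneg_left he (sq_nonneg t); nlinarith
  have h4 : (c * p) * (e * t) ≤ 0 := by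
    nlinarith [mul_nonneg (neg_nonneg.2 hep) hct.le]
  have h5 : dot2 (c, e) (p, t) = c * p + e * t := rfl
  rw [h5]
  -- The two terms of the scalar product have opposite signs, so its square is at most the larger of
  -- their squares.
  rcases le_total ((c * p) ^ 2) ((e * t) ^ 2) with h | h <;> nlinarith

lemma niceTurn_flat {c p t : ℝ} (hc : 0 < c) (ht : 0 < t) (hp : 3 * p ^ 2 ≤ t ^ 2) :
    NiceTurn (c, 0) (p, t) := niceTurn_mixed hc ht (by simp) (by nlinarith) hp

/-- A nearly horizontal and a nearly vertical side. -/
lemma niceTurn_robust {c e p t : ℝ} (hc : 0 < c) (ht : 0 < t) (he : |e| ≤ c / 100)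
    (hp : |p| ≤ 56 / 100 * t) : NiceTurn (c, e) (p, t) := by
  have hct : 0 < c * t := mul_pos hc ht
  have h1 : |e * p| ≤ (c / 100) * (56 / 100 * t) := by
    rw [abs_mul]; exact mul_le_mul he hp (abs_nonneg _) (by positivity)
  have h2 : |c * p + e * t| ≤ 57 / 100 * (c * t) := by
    refine (abs_add_le _ _).trans ?_
    rw [abs_mul, abs_mul, abs_of_pos hc, abs_of_pos ht]
    nlinarith
  have hd : 994 / 1000 * (c * t) ≤ det2 (c, e) (p, t) := by
    simp only [det2]
    have := (abs_le.1 h1).2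
    nlinarith
  refine ⟨by linarith, ?_⟩
  have h5 : dot2 (c, e) (p, t) = c * p + e * t := rfl
  -- The margin is `3 * 0.57 ^ 2 < 0.994 ^ 2`.
  have h6 := pow_le_pow_left₀ (by positivity) hd 2
  have h7 := pow_le_pow_left₀ (abs_nonneg _) h2 2
  rw [sq_abs] at h7
  rw [h5]
  nlinarith

/-! ### Strips along a side -/

/-- A strip between a path of marks from `a` to `b` and a wall from `a'` to `b'` can be filled. -/
def Strip (N : ℕ) (a b a' b' : ℝ × ℝ) (m x : List (ℝ × ℝ)) : Prop :=
  Fills Good N fun f => pathSum f (a :: (m ++ [b])) + f b b' - pathSum f (a' :: (x ++ [b'])) -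
    f a a'

lemma Strip.append {N N' : ℕ} {a b c a' b' c' : ℝ × ℝ} {m m' x x' : List (ℝ × ℝ)}
    (h : Strip N a b a' b' m x) (h' : Strip N' b c b' c' m' x') :
    Strip (N + N') a c a' c' (m ++ b :: m') (x ++ b' :: x') := by
  refine (Fills.add h h').mono le_rfl fun f _ => ?_
  have e : ∀ (a b c : ℝ × ℝ) (m m' : List (ℝ × ℝ)), pathSum f (a :: ((m ++ b :: m') ++ [c])) =
      pathSum f (a :: (m ++ [b])) + pathSum f (b :: (m' ++ [c])) := by
    intro a b c m m'
    have := pathSum_append f (a :: m) (m' ++ [c]) b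
    simpa using this
  rw [e, e]; ring

lemma strip_of_cells {S : ℝ → ℝ → Prop} (z w : ℝ → ℝ × ℝ) {a b : ℝ} {m : List ℝ}
    (hm : (a :: (m ++ [b])).IsChain S)
    (hG : ∀ y y', S y y' → Good ![w y, z y, z y', w y']) :
    Strip (m.length + 1) (z a) (z b) (w a) (w b) (m.map z) (m.map w) := by
  refine (fills_column w z hG a (m ++ [b]) hm).mono (by simp) fun f hf => ?_
  have := hf (w b) (z b)
  have := hf (w a) (z a)
  simp only [List.map_cons, List.map_append, List.map_nil, List.getLastD_concat]
  linarith

/-- The inner part of a strip between two rings. -/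
lemma strip_gap {θ d d' : ℝ} (hθ : 0 < θ) (hd : 2 * θ ≤ d' - d) {m : List ℝ}
    (hm : (d :: (m ++ [d'])).IsChain (· < ·)) :
    ∃ g : ℝ → ℝ, StrictMono g ∧ g d = d + kap * θ ∧ g d' = d' - kap * θ ∧
      Strip (m.length + 1) (d, 0) (d', 0) (g d, θ) (g d', θ) (m.map fun z => (z, 0))
        (m.map fun z => (g z, θ)) := by
  have hk := kap_pos
  have hk' := kap_lt
  have hD : 0 < d' - d := by linarith
  -- The factor for which both ends of the stretch move inwards by `kap * θ`, that is, by 30° over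
  -- the depth `θ`.
  let r := 1 - 2 * kap * θ / (d' - d)
  have hr : 0 < r := by
    have : 2 * kap * θ / (d' - d) < 1 := by rw [div_lt_one hD]; nlinarith
    simp only [r]; linarith
  let g : ℝ → ℝ := fun z => d + kap * θ + r * (z - d)
  have hgd : g d = d + kap * θ := by simp [g]
  have hgd' : g d' = d' - kap * θ := by simp only [g, r]; field_simp; ring
  have hg : StrictMono g := fun a b hab => by
    simp only [g]; have := mul_lt_mul_of_pos_left hab hr; linarith
  refine ⟨g, hg, hgd, hgd', ?_⟩
  have hmem : ∀ z ∈ d :: (m ++ [d']), d ≤ z ∧ z ≤ d' := by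
    have hp := List.isChain_iff_pairwise.1 hm
    rw [List.pairwise_cons, List.pairwise_append] at hp
    obtain ⟨h1, -, -, h2⟩ := hp
    intro z hz
    rcases List.mem_cons.1 hz with rfl | hz
    · exact ⟨le_rfl, by linarith⟩
    · refine ⟨(h1 z hz).le, ?_⟩
      rcases List.mem_append.1 hz with hz | hz
      · exact (h2 z hz d' (by simp)).le
      · simp at hz; exact hz.le
  have hm' : (d :: (m ++ [d'])).IsChain fun a b => a < b ∧ d ≤ a ∧ b ≤ d' := by
    refine List.IsChain.imp_of_mem_imp (fun a b ha hb hab => ?_) hm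
    exact ⟨hab, (hmem a ha).1, (hmem b hb).2⟩
  refine strip_of_cells (fun z => ((z, 0) : ℝ × ℝ)) (fun z => (g z, θ)) hm' ?_
  rintro z z' ⟨hz, h1, h2⟩
  have hgz := hg hz
  -- The horizontal shift of a mark is `kap * θ` times a number in `[-1, 1]`, so every line is
  -- within 30° of the vertical.
  have bound : ∀ z, d ≤ z → z ≤ d' → 3 * (g z - z) ^ 2 ≤ θ ^ 2 := by
    intro z h1 h2
    have e : g z - z = kap * θ * (1 - 2 * ((z - d) / (d' - d))) := by
      simp only [g, r]; field_simp; ring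
    have q0 : 0 ≤ (z - d) / (d' - d) := div_nonneg (by linarith) hD.le
    have q1 : (z - d) / (d' - d) ≤ 1 := by rw [div_le_one hD]; linarith
    rw [e]
    have : (1 - 2 * ((z - d) / (d' - d))) ^ 2 ≤ 1 := by nlinarith
    have h3 : 3 * (kap * θ * (1 - 2 * ((z - d) / (d' - d)))) ^ 2 =
        θ ^ 2 * (1 - 2 * ((z - d) / (d' - d))) ^ 2 := by
      linear_combination (θ ^ 2 * (1 - 2 * ((z - d) / (d' - d))) ^ 2) * kap_sq
    rw [h3]
    nlinarith [sq_nonneg θ]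
  have b1 := bound z h1 (by linarith)
  have b2 := bound z' (by linarith) h2
  have key : Good ![(z, 0), (z', 0), (g z', θ), (g z, θ)] := by
    refine good_mk ?_ ?_ ?_ ?_ <;> simp only [Prod.mk_sub_mk, sub_zero, sub_self]
    · exact niceTurn_flat (by linarith) hθ b1
    · exact niceTurn_flat (by linarith) hθ b2
    · exact niceTurn_flat (by linarith) hθ b2
    · exact niceTurn_flat (by linarith) hθ b1
  -- `strip_of_cells` lists the same corners from another starting point.
  intro i
  have := key (i + 3)
  fin_cases i <;> exact this

/-- A ring of `K` new lines on each side of the segment from `d` to `d'`. -/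
lemma strip_ring {θ d d' : ℝ} (hθ : 0 < θ) (hd : d < d') {K : ℕ} (hK : 0 < K) :
    ∃ X Y : List ℝ, X.length = K ∧ Y.length = K ∧
      ((d - kap * θ) :: (X ++ Y ++ [d' + kap * θ])).IsChain (· < ·) ∧
      (∀ x ∈ X, x ≤ d) ∧ (∀ y ∈ Y, d' ≤ y) ∧
      Strip (3 * K + 1) (d, 0) (d', 0) (d - kap * θ, θ) (d' + kap * θ, θ) []
        ((X ++ Y).map fun z => (z, θ)) := by
  have hk := kap_pos
  have hk' := kap_lt
  have hk3 := kap_sq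
  -- `μ` is the height of the highest arch. The bound by `θ` keeps the upper ends of the arches
  -- outside of the segment from `d` to `d'`, that by `d' - d` keeps the two bends of an arch apart.
  obtain ⟨μ, hμ0, hμθ, hμd⟩ : ∃ μ : ℝ, 0 < μ ∧ 2 * μ ≤ θ ∧ 2 * μ ≤ d' - d := by
    refine ⟨min θ (d' - d) / 2, half_pos (lt_min hθ (by linarith)), ?_, ?_⟩
    · linarith [min_le_left θ (d' - d)]
    · linarith [min_le_right θ (d' - d)]
  obtain ⟨n, rfl⟩ : ∃ n, K = n + 1 := ⟨K - 1, by omega⟩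
  let ks : List ℝ := (List.range n).map fun k : ℕ => μ * (k + 1) / (n + 1)
  have hn : (0 : ℝ) < n + 1 := by positivity
  have hks : (0 :: (ks ++ [μ])).IsChain (· < ·) := by
    have e : 0 :: (ks ++ [μ]) = (List.range (n + 2)).map fun k : ℕ => μ * k / (n + 1) := by
      rw [List.range_succ, List.range_succ_eq_map]
      simp [ks, Function.comp_def, hn.ne']
    rw [e, List.isChain_iff_pairwise, List.pairwise_map]
    refine List.Pairwise.imp ?_ List.pairwise_lt_range
    intro a b hab
    have : (a : ℝ) < b := by exact_mod_cast hab
    have := mul_lt_mul_of_pos_left this hμ0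
    gcongr
  have hmem : ∀ z ∈ 0 :: (ks ++ [μ]), 0 ≤ z ∧ z ≤ μ := by
    have hp := List.isChain_iff_pairwise.1 hks
    rw [List.pairwise_cons, List.pairwise_append] at hp
    obtain ⟨h1, -, -, h2⟩ := hp
    intro z hz
    rcases List.mem_cons.1 hz with rfl | hz
    · exact ⟨le_rfl, by linarith⟩
    · refine ⟨(h1 z hz).le, ?_⟩
      rcases List.mem_append.1 hz with hz | hz
      · exact (h2 z hz μ (by simp)).le
      · simp at hz; exact hz.le
  have hch : (0 :: (ks ++ [μ])).IsChain fun a b => a < b ∧ 0 ≤ a ∧ b ≤ μ :=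
    List.IsChain.imp_of_mem_imp (fun a b ha hb hab =>
      ⟨hab, (hmem a ha).1, (hmem b hb).2⟩) hks
  -- The arch at height `l` descends from `(m l, θ)` to `o l`, runs horizontally to `o' l` and rises
  -- to `(m' l, θ)`. Its three parts and the lines traced by the bends `o` and `o'` have directions
  -- that differ by multiples of 60°, so all angles are 60° or 120°. At the mark `d` the straight
  -- angle is divided into three angles of 60°: one in the adjacent gap and two in the ring.
  let o : ℝ → ℝ × ℝ := fun l => (d + kap * l, l)
  let o' : ℝ → ℝ × ℝ := fun l => (d' - kap * l, l)
  let m : ℝ → ℝ := fun l => d + kap * (2 * l - θ)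
  let m' : ℝ → ℝ := fun l => d' - kap * (2 * l - θ)
  have tL : NiceTurn (kap, -1) (1, 0) := by
    refine ⟨by simp [det2], ?_⟩; simp only [det2, dot2]; nlinarith
  have tL' : NiceTurn (kap, -1) (kap, 1) := by
    refine ⟨by simp [det2]; linarith, ?_⟩
    simp only [det2, dot2]
    have : kap ^ 2 = 1 / 3 := by linarith
    nlinarith
  have tR : NiceTurn (kap, 1) (-kap, 1) := by
    refine ⟨by simp [det2]; linarith, ?_⟩
    simp only [det2, dot2]
    have : kap ^ 2 = 1 / 3 := by linarith
    nlinarith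
  have tR' : NiceTurn (kap, 1) (-1, 0) := by
    refine ⟨by simp [det2], ?_⟩; simp only [det2, dot2]; nlinarith
  have tM : NiceTurn (-kap, -1) (1, 0) := by
    refine ⟨by simp [det2], ?_⟩; simp only [det2, dot2]; nlinarith
  have cap := fills_column (G := Good) o o' (S := fun a b => a < b ∧ 0 ≤ a ∧ b ≤ μ) (by
    rintro l l' ⟨h1, h2, h3⟩
    have p1 : kap * l ≤ μ := by nlinarith
    have p2 : kap * l' ≤ kap * μ := by gcongr
    have p3 : kap * μ < μ := by nlinarith
    have p4 : kap * l < kap * l' := by gcongr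
    have hs : 3 * (kap * (l' - l)) ^ 2 ≤ (l' - l) ^ 2 := by nlinarith
    refine good_mk ?_ ?_ ?_ ?_ <;> simp only [o, o', Prod.mk_sub_mk, sub_self]
    · exact niceTurn_flat (by linarith) (by linarith) (by
        rw [show d + kap * l' - (d + kap * l) = kap * (l' - l) by ring]; exact hs)
    · exact niceTurn_flat (by linarith) (by linarith) (by
        rw [show d' - kap * l' - (d' - kap * l) = -(kap * (l' - l)) by ring, neg_sq]; exact hs)
    · exact niceTurn_flat (by linarith) (by linarith) (by
        rw [show d' - kap * l' - (d' - kap * l) = -(kap * (l' - l)) by ring, neg_sq]; exact hs)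
    · exact niceTurn_flat (by linarith) (by linarith) (by
        rw [show d + kap * l' - (d + kap * l) = kap * (l' - l) by ring]; exact hs)) 0 _ hch
  have left := fills_column (G := Good) (fun l => (m l, θ)) o
    (S := fun a b => a < b ∧ 0 ≤ a ∧ b ≤ μ) (by
    rintro l l' ⟨h1, h2, h3⟩
    have q1 : 0 < θ - l := by linarith
    have q2 : 0 < θ - l' := by linarith
    have q3 : 0 < l' - l := by linarith
    have q4 : 0 < 2 * kap * (l' - l) := by positivity
    refine good_mk ?_ ?_ ?_ ?_
    · refine tL.of_eq q1 q4 ?_ ?_ <;> ext <;> simp [o, m] <;> ring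
    · refine tL'.of_eq q1 q3 ?_ ?_ <;> ext <;> simp [o, m] <;> ring
    · refine tL'.of_eq q2 q3 ?_ ?_ <;> ext <;> simp [o, m] <;> ring
    · refine tL.of_eq q2 q4 ?_ ?_ <;> ext <;> simp [o, m] <;> ring) 0 _ hch
  have right := fills_column (G := Good) o' (fun l => (m' l, θ))
    (S := fun a b => a < b ∧ 0 ≤ a ∧ b ≤ μ) (by
    rintro l l' ⟨h1, h2, h3⟩
    have q1 : 0 < θ - l := by linarith
    have q2 : 0 < θ - l' := by linarith
    have q3 : 0 < l' - l := by linarith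
    have q4 : 0 < 2 * kap * (l' - l) := by positivity
    refine good_mk ?_ ?_ ?_ ?_
    · refine tR.of_eq q1 q3 ?_ ?_ <;> ext <;> simp [o', m'] <;> ring
    · refine tR'.of_eq q1 q4 ?_ ?_ <;> ext <;> simp [o', m'] <;> ring
    · refine tR'.of_eq q2 q4 ?_ ?_ <;> ext <;> simp [o', m'] <;> ring
    · refine tR.of_eq q2 q3 ?_ ?_ <;> ext <;> simp [o', m'] <;> ring) 0 _ hch
  have hmm : m μ < m' μ := by
    simp only [m, m']
    have := mul_nonneg hk.le (show 0 ≤ θ - 2 * μ by linarith)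
    linarith
  have mid := Fills.single (G := Good) (a := (m μ, θ)) (b := o μ) (d := o' μ) (e := (m' μ, θ)) (by
    have q1 : 0 < θ - μ := by linarith
    have q2 : 0 < m' μ - m μ := by linarith
    have q3 : 0 < d' - d - 2 * kap * μ := by nlinarith
    refine good_mk ?_ ?_ ?_ ?_
    · refine tL.of_eq q1 q2 ?_ ?_ <;> ext <;> simp [o, m] <;> ring
    · refine tL.of_eq q1 q3 ?_ ?_ <;> ext <;> simp [o, m, o'] <;> ring
    · refine tM.of_eq q1 q3 ?_ ?_ <;> ext <;> simp [o, m', o'] <;> ring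
    · refine tM.of_eq q1 q2 ?_ ?_ <;> ext <;> simp [m', o'] <;> ring)
  have hmono : ∀ a b, a < b → m a < m b := fun a b hab => by
    simp only [m]; have := mul_lt_mul_of_pos_left hab hk; linarith
  have hmono' : ∀ a b, a < b → m' b < m' a := fun a b hab => by
    simp only [m']; have := mul_lt_mul_of_pos_left hab hk; linarith
  have m0 : m 0 = d - kap * θ := by simp only [m]; ring
  have m0' : m' 0 = d' + kap * θ := by simp only [m']; ring
  have hks' : ∀ z ∈ ks ++ [μ], 0 ≤ z ∧ z ≤ μ := fun z hz => hmem z (List.mem_cons_of_mem _ hz)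
  refine ⟨(ks ++ [μ]).map m, (μ :: ks.reverse).map m', by simp [ks], by simp [ks], ?_, ?_, ?_, ?_⟩
  · have c1 : ((0 :: (ks ++ [μ])).map m).IsChain (· < ·) := by
      rw [List.isChain_map]
      exact hks.imp hmono
    have c2 : (((0 :: (ks ++ [μ])).reverse).map m').IsChain (· < ·) := by
      rw [List.isChain_map, List.isChain_reverse]
      exact hks.imp hmono'
    have := List.IsChain.append c1 c2 (by
      intro x hx y hy
      have hx' : m μ = x := by
        rw [← List.cons_append, List.map_append, List.map_singleton, List.getLast?_concat] at hx
        exact Option.some_inj.1 hx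
      have hy' : m' μ = y := by simpa using hy
      rw [← hx', ← hy']; exact hmm)
    simpa [m0, m0'] using this
  · intro x hx
    obtain ⟨l, hl, rfl⟩ := List.mem_map.1 hx
    have := hks' l hl
    simp only [m]
    have := mul_nonneg hk.le (show 0 ≤ θ - 2 * l by linarith)
    linarith
  · intro x hx
    obtain ⟨l, hl, rfl⟩ := List.mem_map.1 hx
    have := hks' l (by simpa [or_comm] using hl)
    simp only [m']
    have := mul_nonneg hk.le (show 0 ≤ θ - 2 * l by linarith)
    linarith
  · refine (((cap.add left).add right).add mid).mono (by simp [ks]; omega) fun f hf => ?_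
    have w1 : pathSum f ((d - kap * θ, θ) :: (List.map (fun z => (z, θ))
        ((ks ++ [μ]).map m ++ (μ :: ks.reverse).map m') ++ [(d' + kap * θ, θ)])) =
        pathSum f ((0 :: (ks ++ [μ])).map fun l => (m l, θ)) + f (m μ, θ) (m' μ, θ) -
        pathSum f ((0 :: (ks ++ [μ])).map fun l => (m' l, θ)) := by
      have e1 := pathSum_append f ((0 :: ks).map fun l => (m l, θ))
        ((μ :: (ks.reverse ++ [0])).map fun l => (m' l, θ)) (m μ, θ)
      have e2 := pathSum_reverse f hf ((0 :: (ks ++ [μ])).map fun l => (m' l, θ))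
      have e3 : ((0 :: (ks ++ [μ])).map fun l => (m' l, θ)).reverse =
          (μ :: (ks.reverse ++ [0])).map fun l => (m' l, θ) := by simp
      rw [e3] at e2
      have e6 : pathSum f ((m μ, θ) :: (μ :: (ks.reverse ++ [0])).map fun l => (m' l, θ)) =
          f (m μ, θ) (m' μ, θ) + pathSum f ((μ :: (ks.reverse ++ [0])).map fun l => (m' l, θ)) :=
        rfl
      have e4 : ((d - kap * θ, θ) :: (List.map (fun z => (z, θ))
        ((ks ++ [μ]).map m ++ (μ :: ks.reverse).map m') ++ [(d' + kap * θ, θ)])) =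
        ((0 :: ks).map fun l => (m l, θ)) ++ (m μ, θ) ::
          ((μ :: (ks.reverse ++ [0])).map fun l => (m' l, θ)) := by
        simp [m0, m0', Function.comp_def]
      have e5 : ((0 :: ks).map fun l => (m l, θ)) ++ [(m μ, θ)] =
          (0 :: (ks ++ [μ])).map fun l => (m l, θ) := by simp
      rw [e4, e1, e5, e6]
      linarith
    rw [w1]
    have a1 := hf (d, 0) (d - kap * θ, θ)
    have a2 := hf (m μ, θ) (m' μ, θ)
    have o0 : o 0 = (d, 0) := by simp [o]
    have o0' : o' 0 = (d', 0) := by simp [o']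
    simp only [List.getLastD_concat, m0, m0', o0, o0', List.nil_append, pathSum_cons_cons,
      pathSum_singleton]
    linarith

/-! ### The strip along a whole side -/

/-- The depth of the strips along the sides. -/
noncomputable def th : ℝ := 1 / 10000

/-- A hat function that is `1` at `th` and vanishes from `1 / 10` on. -/
noncomputable def hat (t : ℝ) : ℝ := max 0 ((1 / 10 - t) / (1 / 10 - th))

lemma hat_eq_zero {t : ℝ} (h : 1 / 10 ≤ t) : hat t = 0 := by
  have : (0 : ℝ) < 1 / 10 - th := by norm_num [th]
  exact max_eq_left (div_nonpos_of_nonpos_of_nonneg (by linarith) this.le)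

lemma hat_th : hat th = 1 := by
  have : (1 / 10 - th : ℝ) ≠ 0 := by norm_num [th]
  rw [hat, div_self this]; norm_num

/-- The wall of a side of length `W`, whose first and last marks are `a` and `b`, between
neighboring sides with first marks at the heights `l` and `r`. -/
noncomputable def wall (W a b l r x : ℝ) : ℝ × ℝ :=
  (x + (a - th) * hat x + (b - (W - th)) * hat (W - x),
    th + (l - th) * hat x + (r - th) * hat (W - x))

/-- Affine maps that preserve scalar products and reverse the orientation. -/
def IsReflection (φ : ℝ × ℝ → ℝ × ℝ) : Prop := ∀ a b c d,
  det2 (φ b - φ a) (φ d - φ c) = -det2 (b - a) (d - c) ∧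
  dot2 (φ b - φ a) (φ d - φ c) = dot2 (b - a) (d - c)

/-- Affine maps that preserve scalar products and the orientation. -/
def IsRotation (φ : ℝ × ℝ → ℝ × ℝ) : Prop := ∀ a b c d,
  det2 (φ b - φ a) (φ d - φ c) = det2 (b - a) (d - c) ∧
  dot2 (φ b - φ a) (φ d - φ c) = dot2 (b - a) (d - c)

lemma IsRotation.fills {φ : ℝ × ℝ → ℝ × ℝ} (hφ : IsRotation φ) {N : ℕ}
    {c : (ℝ × ℝ → ℝ × ℝ → ℝ) → ℝ} (h : Fills Good N c) :
    Fills Good N fun f => c fun x y => f (φ x) (φ y) := by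
  refine Fills.map φ (h.imp fun q hq i => ?_)
  have := hq i
  rw [NiceTurn] at this ⊢
  rw [(hφ _ _ _ _).1, (hφ _ _ _ _).2]
  exact this

lemma IsReflection.fills {φ : ℝ × ℝ → ℝ × ℝ} (hφ : IsReflection φ) {N : ℕ}
    {c : (ℝ × ℝ → ℝ × ℝ → ℝ) → ℝ} (h : Fills Good N c) :
    Fills Good N fun f => -c fun x y => f (φ x) (φ y) := by
  refine Fills.map_reverse φ (h.imp fun q hq => ?_)
  have key : ∀ a b c : ℝ × ℝ, NiceTurn (b - a) (c - b) → NiceTurn (φ b - φ c) (φ a - φ b) := by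
    intro a b c h
    rw [NiceTurn] at h ⊢
    rw [(hφ _ _ _ _).1, (hφ _ _ _ _).2]
    have e1 : -det2 (b - c) (a - b) = det2 (b - a) (c - b) := by
      simp only [det2, Prod.fst_sub, Prod.snd_sub]; ring
    have e2 : dot2 (b - c) (a - b) = dot2 (b - a) (c - b) := by
      simp only [dot2, Prod.fst_sub, Prod.snd_sub]; ring
    rw [e1, e2]; exact h
  intro i
  fin_cases i
  · exact key _ _ _ (hq 3)
  · exact key _ _ _ (hq 2)
  · exact key _ _ _ (hq 1)
  · exact key _ _ _ (hq 0)

/-- Allows the far end of a side to be treated as a mirror image of its beginning. -/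
lemma Strip.reflect {φ : ℝ × ℝ → ℝ × ℝ} (hφ : IsReflection φ) {N : ℕ} {a b a' b' : ℝ × ℝ}
    {m x : List (ℝ × ℝ)} (h : Strip N a b a' b' m x) :
    Strip N (φ b) (φ a) (φ b') (φ a') (m.map φ).reverse (x.map φ).reverse := by
  refine (hφ.fills h).mono le_rfl fun f hf => ?_
  have e : ∀ (a b : ℝ × ℝ) (m : List (ℝ × ℝ)),
      pathSum f (φ b :: ((m.map φ).reverse ++ [φ a])) =
        -pathSum (fun x y => f (φ x) (φ y)) (a :: (m ++ [b])) := by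
    intro a b m
    rw [← pathSum_map f φ, ← pathSum_reverse f hf]
    simp
  rw [e, e]; ring

lemma isReflection_flip (W : ℝ) : IsReflection fun x => (W - x.1, x.2) := by
  intro a b c d
  simp only [det2, dot2, Prod.fst_sub, Prod.snd_sub]
  constructor <;> ring

lemma max_zero_sub {x y : ℝ} (h : x ≤ y) : 0 ≤ max 0 y - max 0 x ∧ max 0 y - max 0 x ≤ y - x := by
  have h1 : max 0 x ≤ max 0 y := max_le_max le_rfl h
  have h2 : max 0 y ≤ max 0 x + (y - x) :=
    max_le (by linarith [le_max_left 0 x]) (by linarith [le_max_right 0 x])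
  exact ⟨by linarith, by linarith⟩

/-- The wall starts at the inner corner `(a, l)` of the box in the corner of the rectangle. Up to `1
/ 10` the lines are vertical and the depth grows linearly from `l` to `th`; from there on the depth
is `th` and the lines lean back more and more, until they reach the 30° required by a ring at `d`.
The map `g` gives the position of the wall point before the distortion by `hat`, in the model where
the wall is straight. -/
lemma strip_first {a l d : ℝ} (ha : 0 < a) (ha' : a ≤ th) (hl : 0 < l) (hl' : l ≤ th)
    (hd : 12 / 100 ≤ d) {m : List ℝ} (hm : (a :: (m ++ [d])).IsChain (· < ·)) :
    ∃ g : ℝ → ℝ, StrictMono g ∧ g a = th ∧ g d = d - kap * th ∧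
      Strip (m.length + 1) (a, 0) (d, 0) (a, l) (d - kap * th, th) (m.map fun z => (z, 0))
        (m.map fun z => (g z + (a - th) * hat (g z), th + (l - th) * hat (g z))) := by
  have hk := kap_pos
  have hk' := kap_lt
  have hk3 := kap_sq
  have hth : th = 1 / 10000 := rfl
  have hsa : 0 < 1 / 10 - a := by linarith
  have hsd : 0 < d - 1 / 10 := by linarith
  -- The rate at which the lean grows, so that it is exactly `kap * th` at `d`.
  let k := kap * th / (d - 1 / 10)
  have hkd : k * (d - 1 / 10) = kap * th := div_mul_cancel₀ _ hsd.ne'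
  have hk0 : 0 < k := div_pos (mul_pos hk (by norm_num [th])) hsd
  have hk1 : k ≤ 1 / 100 := by
    rw [div_le_iff₀ hsd, hth]; linarith
  let hh : ℝ → ℝ := fun z => max 0 ((1 / 10 - z) / (1 / 10 - a))
  let M : ℝ → ℝ := fun z => max 0 (z - 1 / 10)
  let g : ℝ → ℝ := fun z => z + (th - a) * hh z - k * M z
  have hM : ∀ z z', z < z' → 0 ≤ M z' - M z ∧ M z' - M z ≤ z' - z := by
    intro z z' h
    have := max_zero_sub (show z - 1 / 10 ≤ z' - 1 / 10 by linarith)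
    exact ⟨this.1, by linarith [this.2]⟩
  have hhh : ∀ z z', z < z' → 0 ≤ hh z - hh z' ∧ hh z - hh z' ≤ 11 * (z' - z) := by
    intro z z' h
    have e : ∀ z, hh z = (1 / (1 / 10 - a)) * max 0 (1 / 10 - z) := by
      intro z
      simp only [hh]
      rcases le_total 0 (1 / 10 - z) with h | h
      · rw [max_eq_right h, max_eq_right (div_nonneg h hsa.le)]; ring
      · rw [max_eq_left h, max_eq_left (div_nonpos_of_nonpos_of_nonneg h hsa.le)]; ring
    have h11 : 1 / (1 / 10 - a) ≤ 11 := by rw [div_le_iff₀ hsa]; linarith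
    have h0 : 0 < 1 / (1 / 10 - a) := by positivity
    have h3 : 0 ≤ max 0 (1 / 10 - z) - max 0 (1 / 10 - z') ∧
        max 0 (1 / 10 - z) - max 0 (1 / 10 - z') ≤ z' - z := by
      have := max_zero_sub (show 1 / 10 - z' ≤ 1 / 10 - z by linarith)
      exact ⟨this.1, by linarith [this.2]⟩
    rw [e, e, ← mul_sub]
    exact ⟨mul_nonneg h0.le h3.1, mul_le_mul h11 h3.2 h3.1 (by norm_num)⟩
  have hg : StrictMono g := by
    intro z z' h
    obtain ⟨m1, m2⟩ := hM z z' h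
    obtain ⟨h1, h2⟩ := hhh z z' h
    simp only [g]
    have e1 : (th - a) * (hh z - hh z') ≤ th * (11 * (z' - z)) :=
      mul_le_mul (by linarith) h2 h1 (by rw [hth]; norm_num)
    have e2 : k * (M z' - M z) ≤ 1 / 100 * (z' - z) := mul_le_mul hk1 m2 m1 (by norm_num)
    rw [hth] at e1 ⊢
    linarith
  have hhat : ∀ z, hat (g z) = hh z := by
    intro z
    rcases le_total z (1 / 10) with h | h
    · have hM0 : M z = 0 := max_eq_left (by linarith)
      have e1 : hh z = (1 / 10 - z) / (1 / 10 - a) :=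
        max_eq_right (div_nonneg (by linarith) hsa.le)
      have hth' : (1 / 10 - th : ℝ) ≠ 0 := by norm_num [th]
      have e3 : hh z * (1 / 10 - a) = 1 / 10 - z := by rw [e1]; exact div_mul_cancel₀ _ hsa.ne'
      have e2 : (1 / 10 - g z) / (1 / 10 - th) = hh z := by
        rw [div_eq_iff hth']
        simp only [g, hM0]
        linarith
      rw [hat, e2]
      exact max_eq_right (le_max_left _ _)
    · have e1 : hh z = 0 := max_eq_left (div_nonpos_of_nonpos_of_nonneg (by linarith) hsa.le)
      have hM0 : M z = z - 1 / 10 := max_eq_right (by linarith)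
      rw [e1]
      apply hat_eq_zero
      simp only [g, e1, hM0]
      nlinarith
  have hha : hh a = 1 := by simp only [hh]; rw [div_self hsa.ne']; norm_num
  have hMa : M a = 0 := max_eq_left (by linarith)
  have hhd : hh d = 0 := max_eq_left (div_nonpos_of_nonpos_of_nonneg (by linarith) hsa.le)
  have hMd : M d = d - 1 / 10 := max_eq_right (by linarith)
  have hga : g a = th := by simp only [g, hha, hMa]; ring
  have hgd : g d = d - kap * th := by simp only [g, hhd, hMd]; linarith
  have hwall : ∀ z, (g z + (a - th) * hat (g z), th + (l - th) * hat (g z)) =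
      ((z - k * M z, th + (l - th) * hh z) : ℝ × ℝ) := by
    intro z
    rw [hhat]
    ext
    · simp only [g]; ring
    · rfl
  refine ⟨g, hg, hga, hgd, ?_⟩
  have hmem : ∀ z ∈ a :: (m ++ [d]), a ≤ z ∧ z ≤ d := by
    have hp := List.isChain_iff_pairwise.1 hm
    rw [List.pairwise_cons, List.pairwise_append] at hp
    obtain ⟨h1, -, -, h2⟩ := hp
    intro z hz
    rcases List.mem_cons.1 hz with rfl | hz
    · exact ⟨le_rfl, by linarith⟩
    · refine ⟨(h1 z hz).le, ?_⟩
      rcases List.mem_append.1 hz with hz | hz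
      · exact (h2 z hz d (by simp)).le
      · simp at hz; exact hz.le
  have hm' : (a :: (m ++ [d])).IsChain fun x y => x < y ∧ a ≤ x ∧ y ≤ d := by
    refine List.IsChain.imp_of_mem_imp (fun x y hx hy hxy => ?_) hm
    exact ⟨hxy, (hmem x hx).1, (hmem y hy).2⟩
  have hstrip := strip_of_cells (fun z => ((z, 0) : ℝ × ℝ))
    (fun z => (z - k * M z, th + (l - th) * hh z)) hm' (by
    rintro z z' ⟨hz, h1, h2⟩
    obtain ⟨m1, m2⟩ := hM z z' hz
    obtain ⟨n1, n2⟩ := hhh z z' hz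
    have hc : 99 / 100 * (z' - z) ≤ z' - k * M z' - (z - k * M z) := by
      have e2 : k * (M z' - M z) ≤ 1 / 100 * (z' - z) := mul_le_mul hk1 m2 m1 (by norm_num)
      linarith
    have hdepth : ∀ y, a ≤ y → y ≤ d → 0 < th + (l - th) * hh y ∧
        3 * (k * M y) ^ 2 ≤ (th + (l - th) * hh y) ^ 2 := by
      intro y hy hyd
      have hh0 : 0 ≤ hh y := le_max_left _ _
      have hh1 : hh y ≤ 1 := by
        simp only [hh]
        exact max_le (by norm_num) ((div_le_one hsa).2 (by linarith))
      have hpos : 0 < th + (l - th) * hh y := by nlinarith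
      refine ⟨hpos, ?_⟩
      rcases le_total y (1 / 10) with h | h
      · have hM0 : M y = 0 := max_eq_left (by linarith)
        rw [hM0]; simp; positivity
      · have e1 : hh y = 0 := max_eq_left (div_nonpos_of_nonpos_of_nonneg (by linarith) hsa.le)
        have hM0 : M y = y - 1 / 10 := max_eq_right (by linarith)
        have e3 : k * M y ≤ kap * th := by
          rw [hM0]
          have : k * (y - 1 / 10) ≤ k * (d - 1 / 10) := by gcongr
          linarith
        have e5 : 0 ≤ k * M y := mul_nonneg hk0.le (le_max_left _ _)
        have e6 := pow_le_pow_left₀ e5 e3 2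
        rw [e1, mul_zero, add_zero]
        have : 3 * (kap * th) ^ 2 = th ^ 2 := by linear_combination th ^ 2 * hk3
        linarith
    obtain ⟨t1, s1⟩ := hdepth z h1 (by linarith)
    obtain ⟨t2, s2⟩ := hdepth z' (by linarith) h2
    have he0 : 0 ≤ (th + (l - th) * hh z') - (th + (l - th) * hh z) := by nlinarith
    have he1 : (th + (l - th) * hh z') - (th + (l - th) * hh z) ≤ 11 / 10000 * (z' - z) := by
      have : (th - l) * (hh z - hh z') ≤ th * (11 * (z' - z)) :=
        mul_le_mul (by linarith) n2 n1 (by rw [hth]; norm_num)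
      rw [hth] at this ⊢
      linarith
    have hzz : 0 < z' - z := by linarith
    have hcpos : 0 < z' - k * M z' - (z - k * M z) := by linarith
    have hMz : 0 ≤ k * M z := mul_nonneg hk0.le (le_max_left _ _)
    have hMz' : 0 ≤ k * M z' := mul_nonneg hk0.le (le_max_left _ _)
    have he2 : 3 * ((th + (l - th) * hh z') - (th + (l - th) * hh z)) ^ 2 ≤
        (z' - k * M z' - (z - k * M z)) ^ 2 := by
      have g1 := pow_le_pow_left₀ he0 he1 2
      have g2 := pow_le_pow_left₀ (by linarith) hc 2
      rw [mul_pow] at g1 g2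
      linarith [sq_nonneg (z' - z)]
    have key : Good ![((z, 0) : ℝ × ℝ), (z', 0), (z' - k * M z', th + (l - th) * hh z'),
        (z - k * M z, th + (l - th) * hh z)] := by
      refine good_mk ?_ ?_ ?_ ?_ <;> simp only [Prod.mk_sub_mk, sub_zero, sub_self]
      · exact niceTurn_flat hzz t1 (by rw [sub_sub_cancel_left, neg_sq]; exact s1)
      · exact niceTurn_flat hzz t2 (by rw [sub_sub_cancel_left, neg_sq]; exact s2)
      -- The wall rises while the lines lean backwards: the tilts are opposite, so even the full 30°
      -- is admissible.
      · refine niceTurn_mixed hcpos t2 ?_ he2 (by rw [sub_sub_cancel_left, neg_sq]; exact s2)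
        exact mul_nonpos_of_nonneg_of_nonpos he0 (by linarith)
      · refine niceTurn_mixed hcpos t1 ?_ he2 (by rw [sub_sub_cancel_left, neg_sq]; exact s1)
        exact mul_nonpos_of_nonneg_of_nonpos he0 (by linarith)
    intro i
    have := key (i + 3)
    fin_cases i <;> exact this)
  simp only [hwall]
  have w1 : ((a, l) : ℝ × ℝ) = (a - k * M a, th + (l - th) * hh a) := by
    rw [hMa, hha]; simp
  have w2 : ((d - kap * th, th) : ℝ × ℝ) = (d - k * M d, th + (l - th) * hh d) := by
    rw [hMd, hhd, hkd]; simp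
  rw [w1, w2]
  exact hstrip

lemma Strip.mono {N N' : ℕ} {a b a' b' : ℝ × ℝ} {m x : List (ℝ × ℝ)}
    (h : Strip N a b a' b' m x) (hN : N ≤ N') : Strip N' a b a' b' m x :=
  Fills.mono h hN fun _ _ => rfl

/-- The wall near the left end of a side. -/
noncomputable def leftWall (a l x : ℝ) : ℝ × ℝ := (x + (a - th) * hat x, th + (l - th) * hat x)

lemma leftWall_eq {a l x : ℝ} (hx : 1 / 10 ≤ x) : leftWall a l x = (x, th) := by
  simp [leftWall, hat_eq_zero hx]

/-- An initial part of the strip along a side, up to the mark `d` and the point `w` of the wall,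
with the marks `m` and the wall points `X` in between. -/
def Partial (a l d w : ℝ) (m X : List ℝ) : Prop :=
  Strip (2 * (X.length + 1)) (a, 0) (d, 0) (a, l) (w, th) (m.map fun z => (z, 0))
    (X.map (leftWall a l)) ∧ (th :: (X ++ [w])).IsChain (· < ·)

lemma th_pos : 0 < th := by norm_num [th]

lemma partial_first {a l d : ℝ} (ha : 0 < a) (ha' : a ≤ th) (hl : 0 < l) (hl' : l ≤ th)
    (hd : 12 / 100 ≤ d) {m : List ℝ} (hm : (a :: (m ++ [d])).IsChain (· < ·)) :
    ∃ X, X.length = m.length ∧ Partial a l d (d - kap * th) m X := by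
  obtain ⟨g, hg, hga, hgd, h⟩ := strip_first ha ha' hl hl' hd hm
  refine ⟨m.map g, by simp, ?_, ?_⟩
  · have := h.mono (show m.length + 1 ≤ 2 * ((m.map g).length + 1) by simp)
    rw [List.map_map]
    exact this
  · have : ((a :: (m ++ [d])).map g).IsChain (· < ·) := by
      rw [List.isChain_map]; exact hm.imp fun _ _ h => hg h
    simpa [hga, hgd] using this

/-- Beyond `1 / 10` the distorted wall is straight at depth `th`, so undistorted pieces can follow.
-/
lemma Partial.append {a l d d' w w' : ℝ} {m X g Y : List ℝ} {N : ℕ} (h : Partial a l d w m X)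
    (hw : 1 / 10 ≤ w) (h' : Strip N (d, 0) (d', 0) (w, th) (w', th) (g.map fun z => (z, 0))
      (Y.map fun z => (z, th))) (hN : N ≤ 2 * (Y.length + 1))
    (hY : (w :: (Y ++ [w'])).IsChain (· < ·)) :
    Partial a l d' w' (m ++ d :: g) (X ++ w :: Y) := by
  have hYw : ∀ y ∈ Y, w < y := by
    rw [List.isChain_iff_pairwise, List.pairwise_cons] at hY
    exact fun y hy => hY.1 y (by simp [hy])
  constructor
  · have := (h.1.append h').mono (show _ ≤ 2 * ((X ++ w :: Y).length + 1) by simp; omega)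
    have e : Y.map (leftWall a l) = Y.map fun z => (z, th) :=
      List.map_congr_left fun y hy => leftWall_eq (by linarith [hYw y hy])
    rw [List.map_append, List.map_cons, List.map_append, List.map_cons, leftWall_eq hw, e]
    exact this
  · have h2 := h.2
    rw [← List.cons_append] at h2 ⊢
    simp only [List.append_assoc, List.cons_append]
    rw [← List.cons_append, List.isChain_split]
    exact ⟨h2, hY⟩

/-- A ring turns the backward lean at `d` into a forward lean at `d'`, and `partial_gap` turns it
back; so rings and gaps alternate. Its `3 * K + 1` cells come with `2 * K` new wall points, within
the bound of two cells per point. -/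
lemma partial_ring {a l d d' : ℝ} {m X : List ℝ} (h : Partial a l d (d - kap * th) m X)
    (hd : 12 / 100 ≤ d) (hdd : d < d') {K : ℕ} (hK : 0 < K) :
    ∃ Y Z : List ℝ, Y.length = K ∧ Z.length = K ∧ (∀ y ∈ Y, |y - d| ≤ kap * th) ∧
      (∀ z ∈ Z, |z - d'| ≤ kap * th) ∧
      Partial a l d' (d' + kap * th) (m ++ [d]) (X ++ (d - kap * th) :: (Y ++ Z)) := by
  obtain ⟨Y, Z, hY, hZ, hc, hYd, hZd, hs⟩ := strip_ring th_pos hdd hK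
  have hk := kap_lt
  have hth : th = 1 / 10000 := rfl
  have hp := List.isChain_iff_pairwise.1 hc
  rw [List.pairwise_cons, List.pairwise_append] at hp
  obtain ⟨h1, -, -, h2⟩ := hp
  refine ⟨Y, Z, hY, hZ, fun y hy => ?_, fun z hz => ?_, ?_⟩
  · rw [abs_le]
    have := h1 y (by simp [hy])
    have := hYd y hy
    have := mul_pos kap_pos th_pos
    constructor <;> linarith
  · rw [abs_le]
    have := h2 z (by simp [hz]) (d' + kap * th) (by simp)
    have := hZd z hz
    have := mul_pos kap_pos th_pos
    constructor <;> linarith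
  · refine h.append (by rw [hth]; linarith) hs ?_ hc
    simp [hY, hZ]; omega

lemma partial_gap {a l d d' : ℝ} {m X : List ℝ} (h : Partial a l d (d + kap * th) m X)
    (hd : 12 / 100 ≤ d) (hdd : 2 * th ≤ d' - d) {g : List ℝ}
    (hg : (d :: (g ++ [d'])).IsChain (· < ·)) :
    ∃ Y : List ℝ, Y.length = g.length ∧
      Partial a l d' (d' - kap * th) (m ++ d :: g) (X ++ (d + kap * th) :: Y) := by
  obtain ⟨φ, hφ, h1, h2, hs⟩ := strip_gap th_pos hdd hg
  have := mul_pos kap_pos th_pos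
  refine ⟨g.map φ, by simp, h.append (N := g.length + 1) (by linarith) ?_ (by simp) ?_⟩
  · rw [List.map_map, ← h1, ← h2]
    exact hs
  · have : ((d :: (g ++ [d'])).map φ).IsChain (· < ·) := by
      rw [List.isChain_map]; exact hg.imp fun _ _ h => hφ h
    simpa [h1, h2] using this

/-- Four consecutive points of the list, from index `i` on, are near `y`. -/
def Ctl (P : List ℝ) (i : ℕ) (y : ℝ) : Prop :=
  ∀ k, i ≤ k → k ≤ i + 3 → ∃ z, P[k]? = some z ∧ |z - y| ≤ 3 * th

lemma Ctl.append {P : List ℝ} {i : ℕ} {y : ℝ} (h : Ctl P i y) (Q : List ℝ) :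
    Ctl (P ++ Q) i y := by
  intro k h1 h2
  obtain ⟨z, hz, h3⟩ := h k h1 h2
  refine ⟨z, ?_, h3⟩
  rw [List.getElem?_append_left]
  · exact hz
  · exact (List.getElem?_eq_some_iff.1 hz).1

lemma Ctl.cons_append {X : List ℝ} {i : ℕ} {y t : ℝ} (h : Ctl (t :: X) i y) (Q : List ℝ) :
    Ctl (t :: (X ++ Q)) i y := by
  rw [← List.cons_append]; exact h.append Q

lemma ctl_of_forall {P Y Q : List ℝ} {i : ℕ} {y : ℝ} (h1 : P.length ≤ i)
    (h2 : i + 3 < P.length + Y.length) (hY : ∀ z ∈ Y, |z - y| ≤ 3 * th) :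
    Ctl (P ++ (Y ++ Q)) i y := by
  intro k hk1 hk2
  rw [List.getElem?_append_right (by omega), List.getElem?_append_left (by omega)]
  have hk : k - P.length < Y.length := by omega
  exact ⟨Y[k - P.length], List.getElem?_eq_getElem hk, hY _ (List.getElem_mem hk)⟩

lemma exists_next {m m₁ t : List ℝ} {d y : ℝ} (hm : m.Pairwise (· < ·)) (h : m = m₁ ++ d :: t)
    (hy : y ∈ m) (hdy : d < y) : ∃ v t', t = v :: t' ∧ d < v ∧ v ≤ y := by
  subst h
  rw [List.pairwise_append, List.pairwise_cons] at hm
  obtain ⟨-, ⟨h1, h2⟩, h3⟩ := hm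
  have hyt : y ∈ t := by
    rcases List.mem_append.1 hy with hy | hy
    · have := h3 y hy d (by simp); linarith
    · rcases List.mem_cons.1 hy with rfl | hy
      · exact absurd hdy (lt_irrefl _)
      · exact hy
  obtain _ | ⟨v, t'⟩ := t
  · simp at hyt
  · refine ⟨v, t', rfl, h1 v (by simp), ?_⟩
    rcases List.mem_cons.1 hyt with rfl | hy
    · exact le_rfl
    · exact ((List.pairwise_cons.1 h2).1 y hy).le

lemma exists_split {m m₁ t : List ℝ} {d y : ℝ} (hm : m.Pairwise (· < ·)) (h : m = m₁ ++ d :: t)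
    (hy : y ∈ m) (hdy : d < y) :
    ∃ g t', t = g ++ y :: t' ∧ (d :: (g ++ [y])).IsChain (· < ·) := by
  subst h
  rw [List.pairwise_append] at hm
  obtain ⟨-, h2, h3⟩ := hm
  have hyt : y ∈ t := by
    rcases List.mem_append.1 hy with hy | hy
    · have := h3 y hy d (by simp); linarith
    · rcases List.mem_cons.1 hy with rfl | hy
      · exact absurd hdy (lt_irrefl _)
      · exact hy
  obtain ⟨g, t', rfl⟩ := List.append_of_mem hyt
  refine ⟨g, t', rfl, ?_⟩
  rw [List.isChain_iff_pairwise]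
  refine h2.sublist ?_
  simp

/-- From the first mark `a` to a ring at the last site `x (r - 1)` of a side. -/
lemma exists_partial_end {a l : ℝ} {m : List ℝ} {x : ℕ → ℝ} {r u e : ℕ}
    (hm : m.Pairwise (· < ·)) (hx0 : ∀ j < r, 12 / 100 ≤ x j - 2 * th)
    (hx : ∀ j, j + 1 < r → x j + 1 / 10 ≤ x (j + 1)) (hxm : ∀ j < r, x j ∈ m)
    (hx' : x (r - 1) + 3 * th ∈ m) (hu : m.length + e + 2 ≤ u) (n : ℕ) :
    ∀ j, j + n + 1 = r → (∃ m₁ t X, m = m₁ ++ x j :: t ∧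
      Partial a l (x j) (x j - kap * th) m₁ X ∧ X.length = m₁.length + 4 * u * j ∧
      ∀ i < j, Ctl (th :: X) ((4 * i + 1) * u) (x i)) →
    ∃ d m₁ t X, m = m₁ ++ d :: t ∧ Partial a l d (d + kap * th) m₁ X ∧
      X.length = m₁.length + 4 * u * r + 2 * e ∧
      (∀ i < r, Ctl (th :: X) ((4 * i + 1) * u) (x i)) ∧ 12 / 100 ≤ d ∧
      d ≤ x (r - 1) + 3 * th := by
  have hk := kap_pos
  have hk' := kap_lt
  have hth : th = 1 / 10000 := rfl
  have hkt : 0 < kap * th := mul_pos hk th_pos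
  have hkt' : kap * th ≤ 58 / 100 * th := by rw [hth]; linarith
  -- the ring at a site
  have ring : ∀ j < r, ∀ (m₁ t X : List ℝ) (v : ℝ) (K : ℕ), m = m₁ ++ x j :: v :: t →
      Partial a l (x j) (x j - kap * th) m₁ X → X.length = m₁.length + 4 * u * j →
      (∀ i < j, Ctl (th :: X) ((4 * i + 1) * u) (x i)) → x j < v → 2 * u ≤ K →
      ∃ X', Partial a l v (v + kap * th) (m₁ ++ [x j]) X' ∧
        X'.length = (m₁ ++ [x j]).length + 4 * u * j + 2 * K ∧
        (∀ i < j + 1, Ctl (th :: X') ((4 * i + 1) * u) (x i)) ∧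
        (4 * u ≤ K → K ≤ 4 * u + e → ∀ y, v ≤ y → y - 2 * th ≤ v →
          Ctl (th :: X') ((4 * (j + 1) + 1) * u) y) := by
    intro j hj m₁ t X v K hms hp hX hc hv hK
    have hlen : m.length = m₁.length + (t.length + 2) := by rw [hms]; simp
    have hup : 0 < u := by omega
    obtain ⟨Y, Z, hY, hZ, hYd, hZd, hp'⟩ := partial_ring hp (by linarith [hx0 j hj, th_pos]) hv
      (show 0 < K by omega)
    refine ⟨_, hp', by simp [hY, hZ, hX]; ring, ?_, ?_⟩
    · intro i hi
      rcases Nat.lt_succ_iff_lt_or_eq.1 hi with hi | rfl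
      · exact (hc i hi).cons_append _
      -- Fewer than `u` marks precede the site, so index `(4 * i + 1) * u` is past the points before
      -- the ring; and the left half of the ring has at least `2 * u` points, so the following three
      -- indices are still in it.
      · have h1 : (4 * i + 1) * u = 4 * u * i + u := by ring
        have := ctl_of_forall (P := th :: (X ++ [x i - kap * th])) (Y := Y) (Q := Z)
          (i := (4 * i + 1) * u) (y := x i) (by simp [hX]; omega) (by simp [hX, hY]; omega)
          (fun z hz => (hYd z hz).trans (by linarith [th_pos]))
        simpa using this
    · intro h4 h4' y hy1 hy2
      -- The right half of a double ring starts after at most `m.length + e + 4 * u` points beyond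
      -- `4 * u * j`, up to a bounded shift; this is where the lower bound on `u` includes `e`.
      have h1 : (4 * (j + 1) + 1) * u = 4 * u * j + 5 * u := by ring
      have := ctl_of_forall (P := th :: (X ++ (x j - kap * th) :: Y)) (Y := Z) (Q := [])
        (i := (4 * (j + 1) + 1) * u) (y := y) (by simp [hX, hY]; omega)
        (by simp [hX, hY, hZ]; omega)
        (fun z hz => by
          have := abs_le.1 (hZd z hz)
          rw [abs_le]; constructor <;> linarith [this.1, this.2, th_pos])
      simpa using this
  -- `n` is the number of sites after the `j`-th. One step may dispose of two sites.
  induction n using Nat.strong_induction_on with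
  | _ n ih =>
  rintro j hj ⟨m₁, t, X, hms, hp, hX, hc⟩
  -- The ring at the last site also provides the `2 * e` surplus points. The special mark `3 * th`
  -- behind this site ensures that the ring ends near it.
  obtain _ | n := n
  · obtain ⟨v, t', rfl, hv, hv'⟩ := exists_next hm hms hx' (by
      have : r - 1 = j := by omega
      rw [this]; linarith [th_pos])
    obtain ⟨X', hp', hX', hc', -⟩ := ring j (by omega) m₁ t' X v (2 * u + e) hms hp hX hc hv
      (by omega)
    refine ⟨v, m₁ ++ [x j], t', X', by simp [hms], hp', ?_, ?_, ?_, hv'⟩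
    · rw [hX', ← hj]; ring
    · intro i hi; exact hc' i (by omega)
    · linarith [hx0 j (by omega), th_pos]
  · have hxx := hx j (by omega)
    obtain ⟨v, t', rfl, hv, hv'⟩ := exists_next hm hms (hxm (j + 1) (by omega)) (by linarith)
    have hd : 12 / 100 ≤ v := by linarith [hx0 j (by omega), th_pos]
    have hms' : m = (m₁ ++ [x j]) ++ v :: t' := by simp [hms]
    -- If the next mark `v` is already within `2 * th` of the next site, the gap between them may be
    -- too short for `strip_gap`. Then a single ring of double size serves both sites, its right
    -- half giving the control at the second one.
    rcases lt_or_ge (x (j + 1) - 2 * th) v with hlt | hge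
    · obtain _ | n := n
      · obtain ⟨X', hp', hX', hc', hc''⟩ := ring j (by omega) m₁ t' X v (4 * u + e) hms hp hX hc hv
          (by omega)
        refine ⟨v, m₁ ++ [x j], t', X', hms', hp', ?_, ?_, hd, ?_⟩
        · rw [hX', ← hj]; ring
        · intro i hi
          rcases Nat.lt_or_ge i (j + 1) with h | h
          · exact hc' i h
          · obtain rfl : i = j + 1 := by omega
            exact hc'' (by omega) le_rfl _ hv' hlt.le
        · have : r - 1 = j + 1 := by omega
          rw [this]; linarith [th_pos]
      · obtain ⟨X', hp', hX', hc', hc''⟩ := ring j (by omega) m₁ t' X v (4 * u) hms hp hX hc hv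
          (by omega)
        have hxx' := hx (j + 1) (by omega)
        obtain ⟨g, t'', rfl, hg⟩ := exists_split hm hms' (hxm (j + 2) (by omega))
          (show v < x (j + 2) by rw [show j + 2 = j + 1 + 1 from rfl]; linarith)
        obtain ⟨Y, hY, hpY⟩ := partial_gap hp' hd (by
          rw [show j + 2 = j + 1 + 1 from rfl, hth]; linarith) hg
        refine ih n (by omega) (j + 2) (by omega) ⟨_, t'', _, ?_, hpY, ?_, ?_⟩
        · simp [hms]
        · simp [hX', hY]; ring
        · intro i hi
          refine Ctl.cons_append ?_ _
          rcases Nat.lt_or_ge i (j + 1) with h | h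
          · exact hc' i h
          · obtain rfl : i = j + 1 := by omega
            exact hc'' (by omega) (by omega) _ hv' hlt.le
    · obtain ⟨X', hp', hX', hc', -⟩ := ring j (by omega) m₁ t' X v (2 * u) hms hp hX hc hv le_rfl
      obtain ⟨g, t'', rfl, hg⟩ := exists_split hm hms' (hxm (j + 1) (by omega))
        (show v < x (j + 1) by linarith [th_pos])
      obtain ⟨Y, hY, hpY⟩ := partial_gap hp' hd (by linarith) hg
      refine ih n (by omega) (j + 1) (by omega) ⟨_, t'', _, ?_, hpY, ?_, ?_⟩
      · simp [hms]
      · simp [hX', hY]; ring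
      · exact fun i hi => (hc' i hi).cons_append _

/-- The `j`-th of `r` equidistant sites, shifted by `s`, on a side of length `W`. -/
noncomputable def site (W : ℝ) (r : ℕ) (s : ℝ) (j : ℕ) : ℝ := s + (j + 1) * (W / (r + 1))

/-- The marks `M` on a side of length `W` are in order and include `r + 3` special ones. -/
structure Marked (W : ℝ) (r : ℕ) (s : ℝ) (M : List ℝ) : Prop where
  chain : (0 :: (M ++ [W])).IsChain (· < ·)
  first : th ∈ M
  last : W - th ∈ M
  sites : ∀ j < r, site W r s j ∈ M
  double : site W r s (r - 1) + 3 * th ∈ M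

lemma wall_eq_leftWall {W a b l r x : ℝ} (hx : x ≤ W - 1 / 10) :
    wall W a b l r x = leftWall a l x := by
  simp [wall, leftWall, hat_eq_zero (show 1 / 10 ≤ W - x by linarith)]

/-- Any number of wall points of the right parity can be reached, with control on their position. -/
theorem exists_strip_of_marked {W s : ℝ} {r : ℕ} {M : List ℝ} (hM : Marked W r s M) (hr : 0 < r)
    (hW : 1 / 8 ≤ W / (r + 1)) (hs : 0 ≤ s) (hs' : s ≤ 30 * th) :
    ∃ a b m, M = a :: (m ++ [b]) ∧ 0 < a ∧ a ≤ th ∧ W - th ≤ b ∧ b < W ∧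
      ∀ u e, m.length + e + 2 ≤ u → ∀ l ρ, 0 < l → l ≤ th → 0 < ρ → ρ ≤ th →
      ∃ X : List ℝ, X.length = m.length + 4 * u * r + 2 * e ∧
        (th :: (X ++ [W - th])).IsChain (· < ·) ∧
        (∀ j < r, Ctl (th :: (X ++ [W - th])) ((4 * j + 1) * u) (site W r s j)) ∧
        Strip (2 * (X.length + 1)) (a, 0) (b, 0) (a, l) (b, ρ) (m.map fun z => (z, 0))
          (X.map (wall W a b l ρ)) := by
  have hth : th = 1 / 10000 := rfl
  have hk := kap_pos
  have hk' := kap_lt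
  obtain ⟨hch, hfirst, hlast, hsite, hdouble⟩ := hM
  have hr1 : (0 : ℝ) < r + 1 := by positivity
  have hx0 : ∀ j < r, 12 / 100 ≤ site W r s j - 2 * th := by
    intro j hj
    have : 1 * (W / (r + 1)) ≤ ((j : ℝ) + 1) * (W / (r + 1)) := by gcongr; simp
    simp only [site]; rw [hth]; linarith
  have hx : ∀ j, j + 1 < r → site W r s j + 1 / 10 ≤ site W r s (j + 1) := by
    intro j _
    simp only [site]; push_cast; linarith
  have hlastx : site W r s (r - 1) = s + W - W / (r + 1) := by
    have : ((r - 1 : ℕ) : ℝ) + 1 = r := by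
      rw [Nat.cast_sub (by omega : 1 ≤ r)]; simp
    simp only [site, this]; field_simp; ring
  have hpw := List.isChain_iff_pairwise.1 hch
  -- first and last mark
  obtain _ | ⟨a, M⟩ := M
  · simp at hfirst
  have hMne : M ≠ [] := by
    rintro rfl
    simp only [List.mem_singleton] at hfirst hdouble
    have := hx0 (r - 1) (by omega)
    linarith [th_pos]
  obtain ⟨m, b, rfl⟩ : ∃ m b, M = m ++ [b] := by
    rcases List.eq_nil_or_concat M with h | ⟨m, b, h⟩
    · exact absurd h hMne
    · exact ⟨m, b, by simpa using h⟩
  simp only [List.cons_append, List.append_assoc, List.pairwise_cons, List.pairwise_append,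
    List.nil_append, List.mem_append, List.mem_cons, List.not_mem_nil, or_false] at hpw
  obtain ⟨p0, pa, pm, pbW, pmb⟩ := hpw
  have hbW : b < W := by simpa using pbW
  have ha0 : 0 < a := p0 a (by simp)
  have haa : a ≤ th := by
    simp only [List.mem_cons, List.mem_append, List.not_mem_nil, or_false] at hfirst
    rcases hfirst with h | h | h
    · exact h.ge
    · exact (pa _ (Or.inl h)).le
    · exact (pa _ (Or.inr (Or.inl h))).le
  have hWb : W - th ≤ b := by
    simp only [List.mem_cons, List.mem_append, List.not_mem_nil, or_false] at hlast
    rcases hlast with h | h | h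
    · rw [h]; exact (pa _ (by simp)).le
    · exact (pmb _ h b (by simp)).le
    · exact h.le
  have inm : ∀ y ∈ a :: (m ++ [b]), th < y → y < W - th → y ∈ m := by
    intro y hy h1 h2
    simp only [List.mem_cons, List.mem_append, List.not_mem_nil, or_false] at hy
    rcases hy with h | h | h
    · linarith
    · exact h
    · linarith
  have hxW : ∀ j < r, site W r s j ≤ site W r s (r - 1) := by
    intro j hj
    simp only [site]
    have : (j : ℝ) ≤ (r - 1 : ℕ) := by exact_mod_cast (by omega : j ≤ r - 1)
    have h0 : 0 ≤ W / (r + 1) := by linarith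
    have := mul_le_mul_of_nonneg_right this h0
    linarith
  -- The last ring ends before this point, so there is room for a reflected `strip_first` behind it.
  have hlast' : site W r s (r - 1) + 3 * th ≤ W - 12 / 100 := by
    rw [hlastx]; rw [hth] at hs' ⊢; linarith
  refine ⟨a, b, m, rfl, ha0, haa, hWb, hbW, fun u e hu l ρ hl hl' hρ hρ' => ?_⟩
  have hxm : ∀ j < r, site W r s j ∈ m := fun j hj => inm _ (hsite j hj)
    (by linarith [hx0 j hj, hth]) (by linarith [hxW j hj, th_pos])
  have hdm := inm _ hdouble (by linarith [hx0 (r - 1) (by omega)]) (by linarith [th_pos])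
  have hcm : (a :: (m ++ [b])).IsChain (· < ·) := by
    rw [List.isChain_iff_pairwise, List.pairwise_cons, List.pairwise_append]
    refine ⟨fun y hy => pa y ?_, pm, by simp, fun y hy z hz => pmb y hy z ?_⟩
    · simp only [List.mem_append, List.mem_singleton] at hy
      tauto
    · simp only [List.mem_singleton] at hz
      exact Or.inl hz
  obtain ⟨n, hn⟩ : ∃ n, 0 + n + 1 = r := ⟨r - 1, by omega⟩
  obtain ⟨d, m₁, t, X, hms, ⟨hst, hXc⟩, hX, hc, hd1, hd2⟩ := exists_partial_end (a := a) (l := l)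
    (m := m) pm hx0 hx hxm hdm (e := e) (u := u) (by omega) n 0 hn (by
      obtain ⟨m₁, t, hms⟩ := List.append_of_mem (hxm 0 hr)
      have hc1 : (a :: (m₁ ++ [site W r s 0])).IsChain (· < ·) := by
        rw [List.isChain_iff_pairwise] at hcm ⊢
        refine hcm.sublist ?_
        rw [hms]; simp
      obtain ⟨X, hX, hp⟩ := partial_first ha0 haa hl hl' (by linarith [hx0 0 hr, th_pos]) hc1
      exact ⟨m₁, t, X, hms, hp, by simp [hX], by simp⟩)
  have hdt : (d :: (t ++ [b])).IsChain (· < ·) := by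
    rw [List.isChain_iff_pairwise] at hcm ⊢
    refine hcm.sublist ?_
    rw [hms]; simp
  have hdW : d ≤ W - 12 / 100 := by linarith
  have hkt : kap * th ≤ 58 / 100 * th := by rw [hth]; linarith
  have hkt0 : 0 < kap * th := mul_pos hk th_pos
  -- the last stretch
  have hrev : ((W - b) :: ((t.map fun z => W - z).reverse ++ [W - d])).IsChain (· < ·) := by
    have : ((d :: (t ++ [b])).map fun z => W - z).reverse.IsChain (· < ·) := by
      rw [List.isChain_reverse, List.isChain_map]
      exact hdt.imp fun _ _ h => by linarith
    simpa using this
  obtain ⟨g, hg, hga, hgd, hs2⟩ := strip_first (show 0 < W - b by linarith)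
    (by linarith : W - b ≤ th) hρ hρ' (show 12 / 100 ≤ W - d by linarith) hrev
  have hs3 := Strip.reflect (isReflection_flip W) hs2
  let Y := t.map fun z => W - g (W - z)
  have hYc : ((d + kap * th) :: (Y ++ [W - th])).IsChain (· < ·) := by
    have : ((d :: (t ++ [b])).map fun z => W - g (W - z)).IsChain (· < ·) := by
      rw [List.isChain_map]
      exact hdt.imp fun x y h => by
        have := hg (show W - y < W - x by linarith)
        linarith
    have e : W - g (W - d) = d + kap * th := by rw [hgd]; ring
    simpa [hga, e] using this
  have hXw : ∀ x ∈ X, x ≤ W - 1 / 10 := by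
    intro x hx
    have := List.isChain_iff_pairwise.1 hXc
    rw [List.pairwise_cons, List.pairwise_append] at this
    have := this.2.2.2 x hx (d + kap * th) (by simp)
    rw [hth] at hkt this
    linarith
  have hYw : ∀ y ∈ Y, 1 / 10 ≤ y := by
    intro y hy
    have := List.isChain_iff_pairwise.1 hYc
    rw [List.pairwise_cons] at this
    have := this.1 y (by simp [hy])
    linarith
  refine ⟨X ++ (d + kap * th) :: Y, ?_, ?_, ?_, ?_⟩
  · simp only [List.length_append, List.length_cons, hX, hms, Y, List.length_map]; ring
  · simp only [List.append_assoc, List.cons_append]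
    rw [← List.cons_append, List.isChain_split]
    exact ⟨hXc, hYc⟩
  · intro j hj
    rw [List.append_assoc]
    exact (hc j hj).cons_append _
  · have e1 : X.map (wall W a b l ρ) = X.map (leftWall a l) :=
      List.map_congr_left fun x hx => wall_eq_leftWall (hXw x hx)
    have e2 : wall W a b l ρ (d + kap * th) = (d + kap * th, th) := by
      rw [wall_eq_leftWall (by rw [hth] at hkt ⊢; linarith), leftWall_eq (by linarith)]
    have e3 : Y.map (wall W a b l ρ) = t.map fun z => (W - (g (W - z) + (W - b - th) *
        hat (g (W - z))), th + (ρ - th) * hat (g (W - z))) := by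
      simp only [Y, List.map_map]
      refine List.map_congr_left fun z hz => ?_
      have h1 := hYw (W - g (W - z)) (List.mem_map_of_mem hz)
      simp only [Function.comp_apply, wall, hat_eq_zero h1, sub_sub_cancel]
      ext <;> dsimp only <;> ring
    have key := (hst.append (b' := (d + kap * th, th)) (b := (d, 0)) (N' := t.length + 1)
      (m' := t.map fun z => (z, 0)) (c := (b, 0)) (c' := (b, ρ))
      (x' := Y.map (wall W a b l ρ)) (by
        have c1 : W - (W - d - kap * th) = d + kap * th := by ring
        rw [e3]
        convert hs3 using 2 <;> simp [Function.comp_def, c1])).mono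
          (N' := 2 * ((X ++ (d + kap * th) :: Y).length + 1)) (by simp [Y]; omega)
    rw [hms, List.map_append, List.map_cons, List.map_append, List.map_cons, e1, e2]
    exact key

/-! ### Grids of nearly vertical and horizontal lines -/

/-- All trapezoids with horizontal bases and legs of slope at most `54 / 100` to the vertical. -/
def HasVertical (G : (Fin 4 → ℝ × ℝ) → Prop) : Prop := ∀ x₁ x₂ x₁' x₂' y y' : ℝ,
  x₁ < x₂ → x₁' < x₂' → y < y' → |x₁' - x₁| ≤ 54 / 100 * (y' - y) →
  |x₂' - x₂| ≤ 54 / 100 * (y' - y) → G ![(x₁, y), (x₂, y), (x₂', y'), (x₁', y')]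

/-- All trapezoids with vertical bases and legs of slope at most `54 / 100`. -/
def HasHorizontal (G : (Fin 4 → ℝ × ℝ) → Prop) : Prop := ∀ x x' y₁ y₂ y₁' y₂' : ℝ,
  x < x' → y₁ < y₂ → y₁' < y₂' → |y₁' - y₁| ≤ 54 / 100 * (x' - x) →
  |y₂' - y₂| ≤ 54 / 100 * (x' - x) → G ![(x, y₂), (x, y₁), (x', y₁'), (x', y₂')]

/-- Corresponding entries of two lists of the same length differ by at most `ε`. -/
def Close (ε : ℝ) (X X' : List ℝ) : Prop :=
  X.length = X'.length ∧ ∀ p ∈ X.zip X', |p.2 - p.1| ≤ ε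

lemma isChain_zip {X X' : List ℝ} (h : X.IsChain (· < ·)) (h' : X'.IsChain (· < ·)) :
    (X.zip X').IsChain fun p p' => p.1 < p'.1 ∧ p.2 < p'.2 := by
  induction X generalizing X' with
  | nil => simp
  | cons a X ih =>
    cases X' with
    | nil => simp
    | cons a' X' =>
      cases X with
      | nil => simp
      | cons b X =>
        cases X' with
        | nil => simp
        | cons b' X' =>
          rw [List.isChain_cons_cons] at h h'
          have := ih h.2 h'.2
          rw [List.zip_cons_cons, List.zip_cons_cons, List.isChain_cons_cons]
          rw [List.zip_cons_cons] at this
          exact ⟨⟨h.1, h'.1⟩, this⟩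

/-- Straight lines join the corresponding entries of `X` and `X'`. Both lists increase, so the lines
do not cross, and `Close` bounds their slopes. -/
lemma fills_vertical {G : (Fin 4 → ℝ × ℝ) → Prop} (hG : HasVertical G) {c c' Y Y' : ℝ}
    {X X' Q : List ℝ} (hX : (c :: (X ++ [c'])).IsChain (· < ·))
    (hX' : (c :: (X' ++ [c'])).IsChain (· < ·)) (hXX : Close (54 / 100 * (Y' - Y)) X X')
    (hQ : (Y :: (Q ++ [Y'])).IsChain (· < ·)) :
    Fills G ((X.length + 1) * (Q.length + 1)) fun f =>
      pathSum f ((c :: (X ++ [c'])).map fun x => (x, Y)) +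
      pathSum f ((Y :: (Q ++ [Y'])).map fun y => (c', y)) -
      pathSum f ((c :: (X' ++ [c'])).map fun x => (x, Y')) -
      pathSum f ((Y :: (Q ++ [Y'])).map fun y => (c, y)) := by
  have hYY : Y < Y' := by
    have := List.isChain_iff_pairwise.1 hQ
    exact (List.pairwise_cons.1 this).1 _ (by simp)
  have hz : (c :: (X ++ [c'])).zip (c :: (X' ++ [c'])) = (c, c) :: (X.zip X' ++ [(c', c')]) := by
    rw [List.zip_cons_cons, List.zip_append hXX.1]; rfl
  have hch := isChain_zip hX hX'
  rw [hz] at hch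
  have hs : ∀ p ∈ (c, c) :: (X.zip X' ++ [(c', c')]), |p.2 - p.1| ≤ 54 / 100 * (Y' - Y) := by
    intro p hp
    simp only [List.mem_cons, List.mem_append, List.not_mem_nil, or_false] at hp
    rcases hp with rfl | hp | rfl
    · simp; linarith
    · exact hXX.2 p hp
    · simp; linarith
  have hch' := List.IsChain.imp_of_mem_imp (S := fun p p' : ℝ × ℝ => (p.1 < p'.1 ∧ p.2 < p'.2) ∧
    |p.2 - p.1| ≤ 54 / 100 * (Y' - Y) ∧ |p'.2 - p'.1| ≤ 54 / 100 * (Y' - Y))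
    (fun p p' hp hp' h => ⟨h, hs p hp, hs p' hp'⟩) hch
  have hQm : ∀ y ∈ Y :: (Q ++ [Y']), Y ≤ y ∧ y ≤ Y' := by
    have hp := List.isChain_iff_pairwise.1 hQ
    rw [List.pairwise_cons, List.pairwise_append] at hp
    obtain ⟨h1, -, -, h2⟩ := hp
    intro z hz
    rcases List.mem_cons.1 hz with rfl | hz
    · exact ⟨le_rfl, hYY.le⟩
    · refine ⟨(h1 z hz).le, ?_⟩
      rcases List.mem_append.1 hz with hz | hz
      · exact (h2 z hz Y' (by simp)).le
      · simp at hz; exact hz.le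
  have hQ' := List.IsChain.imp_of_mem_imp (S := fun y y' : ℝ => y < y' ∧ Y ≤ y ∧ y' ≤ Y')
    (fun p p' hp hp' h => ⟨h, (hQm p hp).1, (hQm p' hp').2⟩) hQ
  let s : ℝ → ℝ := fun y => (y - Y) / (Y' - Y)
  have hs0 : s Y = 0 := by simp [s]
  have hs1 : s Y' = 1 := div_self (by linarith)
  have hD : 0 < Y' - Y := by linarith
  let e : ℝ × ℝ → ℝ → ℝ × ℝ := fun p y => (p.1 + (p.2 - p.1) * s y, y)
  have grid := fills_grid (G := G) e (by
    rintro p p' y y' ⟨⟨h1, h2⟩, h3, h4⟩ ⟨h5, h6, h7⟩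
    have key : ∀ p : ℝ × ℝ, |p.2 - p.1| ≤ 54 / 100 * (Y' - Y) →
        |p.1 + (p.2 - p.1) * s y' - (p.1 + (p.2 - p.1) * s y)| ≤ 54 / 100 * (y' - y) := by
      intro p hp
      have : p.1 + (p.2 - p.1) * s y' - (p.1 + (p.2 - p.1) * s y) =
          (p.2 - p.1) * ((y' - y) / (Y' - Y)) := by simp only [s]; ring
      rw [this, abs_mul, abs_of_pos (show 0 < (y' - y) / (Y' - Y) from div_pos (by linarith) hD)]
      calc _ ≤ 54 / 100 * (Y' - Y) * ((y' - y) / (Y' - Y)) := by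
            gcongr
        _ = _ := by field_simp
    have mono : ∀ y, Y ≤ y → y ≤ Y' → p.1 + (p.2 - p.1) * s y < p'.1 + (p'.2 - p'.1) * s y := by
      intro y h h'
      have s0 : 0 ≤ s y := div_nonneg (by linarith) hD.le
      have s1 : s y ≤ 1 := (div_le_one hD).2 (by linarith)
      rcases s0.eq_or_lt with h0 | h0
      · rw [← h0]; linarith
      · have := mul_lt_mul_of_pos_right h2 h0
        have := mul_le_mul_of_nonneg_right h1.le (sub_nonneg.2 s1)
        linarith
    exact hG _ _ _ _ _ _ (mono y h6 (by linarith)) (mono y' (by linarith) h7) h5 (key p h3)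
      (key p' h4)) _ _ hch' _ _ hQ'
  refine grid.mono (by simp [hXX.1]) fun f hf => ?_
  have m1 : ((c, c) :: (X.zip X' ++ [(c', c')])).map (e · Y) =
      (c :: (X ++ [c'])).map fun x => (x, Y) := by
    have : (X.zip X').map Prod.fst = X := List.map_fst_zip hXX.1.le
    conv_rhs => rw [← this]
    simp [e, hs0]
  have m2 : ((c, c) :: (X.zip X' ++ [(c', c')])).map (e · Y') =
      (c :: (X' ++ [c'])).map fun x => (x, Y') := by
    have : (X.zip X').map Prod.snd = X' := List.map_snd_zip hXX.1.ge
    conv_rhs => rw [← this]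
    simp [e, hs1]
  rw [List.getLastD_concat, List.getLastD_concat, m1, m2]
  simp [e]

lemma fills_horizontal {G : (Fin 4 → ℝ × ℝ) → Prop} (hG : HasHorizontal G) {c c' Y Y' : ℝ}
    {X X' Q : List ℝ} (hX : (c :: (X ++ [c'])).IsChain (· < ·))
    (hX' : (c :: (X' ++ [c'])).IsChain (· < ·)) (hXX : Close (54 / 100 * (Y' - Y)) X X')
    (hQ : (Y :: (Q ++ [Y'])).IsChain (· < ·)) :
    Fills G ((X.length + 1) * (Q.length + 1)) fun f =>
      pathSum f ((Y :: (Q ++ [Y'])).map fun y => (y, c)) +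
      pathSum f ((c :: (X' ++ [c'])).map fun x => (Y', x)) -
      pathSum f ((Y :: (Q ++ [Y'])).map fun y => (y, c')) -
      pathSum f ((c :: (X ++ [c'])).map fun x => (Y, x)) := by
  have h := fills_vertical (G := fun q => G ![(q 1).swap, (q 0).swap, (q 3).swap, (q 2).swap]) (by
    intro x₁ x₂ x₁' x₂' y y' h1 h2 h3 h4 h5
    exact hG y y' x₁ x₂ x₁' x₂' h3 h1 h2 h4 h5) hX hX' hXX hQ
  refine (Fills.map_reverse Prod.swap h).mono le_rfl fun f hf => ?_
  simp only [← pathSum_map, List.map_map, Function.comp_def, Prod.swap_prod_mk]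
  ring

/-- Four grids around a central tile. -/
lemma fills_windmill {G : (Fin 4 → ℝ × ℝ) → Prop} (hV : HasVertical G) (hH : HasHorizontal G)
    {x₀ x₁ y₀ y₁ a b a' b' : ℝ} {Bl Br Tl Tr Ll Lr Rl Rr pb pr pl : List ℝ}
    (hB : (x₀ :: (Bl ++ b :: (Br ++ [x₁]))).IsChain (· < ·))
    (hT : (x₀ :: (Tl ++ a :: (Tr ++ [x₁]))).IsChain (· < ·))
    (hL : (y₀ :: (Ll ++ a' :: (Lr ++ [y₁]))).IsChain (· < ·))
    (hR : (y₀ :: (Rl ++ b' :: (Rr ++ [y₁]))).IsChain (· < ·))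
    (hpb : (a :: (pb ++ [b])).IsChain (· < ·)) (hpr : (a' :: (pr ++ [b'])).IsChain (· < ·))
    (hpl : (a' :: (pl ++ [b'])).IsChain (· < ·))
    (cB : Close (54 / 100 * (a' - y₀)) Bl (Tl ++ a :: pb))
    (cT : Close (54 / 100 * (y₁ - b')) (b :: Br) Tr)
    (cL : Close (54 / 100 * (a - x₀)) Lr (pl ++ b' :: Rr))
    (cR : Close (54 / 100 * (x₁ - b)) (Ll ++ a' :: pr) Rl) {N : ℕ}
    (hC : Fills G N fun f => pathSum f ((a :: (pb ++ [b])).map fun x => (x, a')) +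
      pathSum f ((a' :: (pr ++ [b'])).map fun y => (b, y)) - f (a, b') (b, b') -
      pathSum f ((a' :: (pl ++ [b'])).map fun y => (a, y))) :
    Fills G ((Bl.length + 1) * (Ll.length + 1) + (Rl.length + 1) * (Br.length + 1) +
        (Tr.length + 1) * (Rr.length + 1) + (Lr.length + 1) * (Tl.length + 1) + N) fun f =>
      pathSum f ((x₀ :: (Bl ++ b :: (Br ++ [x₁]))).map fun x => (x, y₀)) +
      pathSum f ((y₀ :: (Rl ++ b' :: (Rr ++ [y₁]))).map fun y => (x₁, y)) -
      pathSum f ((x₀ :: (Tl ++ a :: (Tr ++ [x₁]))).map fun x => (x, y₁)) -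
      pathSum f ((y₀ :: (Ll ++ a' :: (Lr ++ [y₁]))).map fun y => (x₀, y)) := by
  rw [← List.cons_append, List.isChain_split] at hB hT hL hR
  rw [List.cons_append] at hB hT hL hR
  have join : ∀ {s t u : ℝ} {l l' : List ℝ}, (s :: (l ++ [t])).IsChain (· < ·) →
      (t :: (l' ++ [u])).IsChain (· < ·) → (s :: ((l ++ t :: l') ++ [u])).IsChain (· < ·) := by
    intro s t u l l' h h'
    rw [List.append_assoc, List.cons_append, ← List.cons_append, List.isChain_split]
    exact ⟨h, h'⟩
  have hab : (a :: ([] ++ [b])).IsChain (· < ·) := by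
    rw [List.isChain_iff_pairwise] at hpb
    simpa using (List.pairwise_cons.1 hpb).1 b (by simp)
  have hab' : (a' :: ([] ++ [b'])).IsChain (· < ·) := by
    rw [List.isChain_iff_pairwise] at hpr
    simpa using (List.pairwise_cons.1 hpr).1 b' (by simp)
  -- In each arm one family of lines is tilted to match the two lists, while the other passes
  -- straight through. Counting the lines, bottom exceeds top by `pb.length`, and right exceeds left
  -- by `pr.length - pl.length`.
  have LL := fills_vertical hV hB.1 (join hT.1 hpb) cB hL.1
  have UR := fills_vertical hV (c := a) (c' := x₁) (by simpa using join hab hB.2) hT.2 cT hR.2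
  have LR := fills_horizontal hH (join hL.1 hpr) hR.1 cR hB.2
  have UL := fills_horizontal hH hL.2 (join hpl hR.2) cL hT.1
  refine ((((LL.add LR).add UR).add UL).add hC).mono ?_ fun f hf => ?_
  · rw [← cR.1, ← cT.1]
  · have split : ∀ (g : ℝ → ℝ × ℝ) (s t u : ℝ) (l l' : List ℝ),
        pathSum f ((s :: (l ++ t :: (l' ++ [u]))).map g) =
          pathSum f ((s :: (l ++ [t])).map g) + pathSum f ((t :: (l' ++ [u])).map g) := by
      intro g s t u l l'
      have := pathSum_append f ((s :: l).map g) ((l' ++ [u]).map g) (g t)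
      simpa using this
    simp only [List.append_assoc, List.cons_append, split]
    have e : ∀ (g : ℝ → ℝ × ℝ), pathSum f ((a :: b :: (Br ++ [x₁])).map g) =
      f (g a) (g b) + pathSum f ((b :: (Br ++ [x₁])).map g) := fun g => rfl
    rw [e]
    ring

/-! ### Comparison of two walls -/

lemma getElem?_mono {P : List ℝ} (hP : P.IsChain (· < ·)) {k l : ℕ} (hkl : k ≤ l) {z z' : ℝ}
    (h : P[k]? = some z) (h' : P[l]? = some z') : z ≤ z' := by
  obtain ⟨hk, rfl⟩ := List.getElem?_eq_some_iff.1 h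
  obtain ⟨hl, rfl⟩ := List.getElem?_eq_some_iff.1 h'
  rcases hkl.eq_or_lt with rfl | hlt
  · exact le_rfl
  · exact (List.pairwise_iff_getElem.1 (List.isChain_iff_pairwise.1 hP) k l hk hl hlt).le

/-- A list of wall points on a side of length `W` with control at the sites. -/
structure Wall (W : ℝ) (r : ℕ) (s : ℝ) (u : ℕ) (P : List ℝ) : Prop where
  chain : P.IsChain (· < ·)
  mem : ∀ z ∈ P, 0 ≤ z ∧ z ≤ W
  ctl : ∀ j < r, Ctl P ((4 * j + 1) * u) (site W r s j)

/-- The wall points with a given index lie between neighboring sites. -/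
lemma exists_site {W : ℝ} (hW : 0 ≤ W) (r u i : ℕ) : ∃ j : ℕ, ∀ (s' : ℝ) (P' : List ℝ),
      Wall W r s' u P' → 0 ≤ s' → s' ≤ 26 * th → ∀ δ ≤ 1, ∀ z, P'[i + δ]? = some z →
      j * (W / (r + 1)) - 3 * th ≤ z ∧ z ≤ (j + 1) * (W / (r + 1)) + 29 * th := by
  -- The first site whose controlled index is at least `i`, or `r` if all of them are smaller. The
  -- previous site bounds the point from below, this one from above; control of consecutive indices
  -- leaves room for the offset `δ`.
  have hex : ∃ j, j = r ∨ i ≤ (4 * j + 1) * u := ⟨r, Or.inl rfl⟩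
  classical
  refine ⟨Nat.find hex, fun s' P' h' h0 h1 δ hδ z hz => ?_⟩
  have hg : 0 ≤ W / (r + 1) := by positivity
  have hzm := h'.mem z (List.mem_of_getElem? hz)
  have hle : Nat.find hex ≤ r := Nat.find_min' hex (Or.inl rfl)
  constructor
  · obtain h0 | ⟨j, hj⟩ : Nat.find hex = 0 ∨ ∃ j, Nat.find hex = j + 1 := by
      rcases Nat.find hex with _ | j
      · exact Or.inl rfl
      · exact Or.inr ⟨j, rfl⟩
    · rw [h0]; simp; linarith [th_pos]
    · have := Nat.find_min hex (m := j) (by omega)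
      push Not at this
      obtain ⟨y, hy, hy'⟩ := h'.ctl j (by omega) ((4 * j + 1) * u) le_rfl (by omega)
      have h2 := getElem?_mono h'.chain (show (4 * j + 1) * u ≤ i + δ by omega) hy hz
      rw [hj]
      have := (abs_le.1 hy').1
      simp only [site] at this
      push_cast
      linarith
  · rcases Nat.find_spec hex with hr | hi
    · rw [hr]
      have : ((r : ℝ) + 1) * (W / (r + 1)) = W := by field_simp
      linarith [th_pos]
    · rcases hle.eq_or_lt with hr | hr
      · rw [hr]
        have : ((r : ℝ) + 1) * (W / (r + 1)) = W := by field_simp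
        linarith [th_pos]
      · obtain ⟨y, hy, hy'⟩ := h'.ctl _ hr ((4 * Nat.find hex + 1) * u + δ) (by omega) (by omega)
        have h2 := getElem?_mono h'.chain (by omega) hz hy
        have := (abs_le.1 hy').2
        simp only [site] at this
        linarith

/-- Both points lie in the same interval of `exists_site`, whatever the shifts of the sites are. The
excess `32 * th` is made up of the shift `26 * th` and two tolerances of `3 * th`. Indices that
differ by one are allowed because the odd tile displaces part of the matching. -/
lemma Wall.dist_le {W s s' : ℝ} {r u : ℕ} {P P' : List ℝ} (h : Wall W r s u P)
    (h' : Wall W r s' u P') (hW : 0 ≤ W) (hs : 0 ≤ s) (hs1 : s ≤ 26 * th) (hs' : 0 ≤ s')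
    (hs1' : s' ≤ 26 * th) {i δ : ℕ} (hδ : δ ≤ 1) {z z' : ℝ} (hz : P[i]? = some z)
    (hz' : P'[i + δ]? = some z') : |z - z'| ≤ W / (r + 1) + 32 * th := by
  obtain ⟨j, hj⟩ := exists_site hW r u i
  obtain ⟨h1, h2⟩ := hj _ _ h hs hs1 0 (by omega) z hz
  obtain ⟨h3, h4⟩ := hj _ _ h' hs' hs1' δ hδ z' hz'
  rw [abs_le]
  constructor <;> linarith

lemma close_of_getElem? {ε : ℝ} {X X' : List ℝ} (h : X.length = X'.length)
    (h' : ∀ (i : ℕ) (z z' : ℝ), X[i]? = some z → X'[i]? = some z' → |z' - z| ≤ ε) : Close ε X X' := by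
  refine ⟨h, fun p hp => ?_⟩
  obtain ⟨i, hi⟩ := List.mem_iff_getElem?.1 hp
  rw [List.getElem?_zip_eq_some] at hi
  exact h' i _ _ hi.1 hi.2

lemma Close.append {ε : ℝ} {X X' Y Y' : List ℝ} (h : Close ε X X') (h' : Close ε Y Y') :
    Close ε (X ++ Y) (X' ++ Y') := by
  refine ⟨by simp [h.1, h'.1], fun p hp => ?_⟩
  rw [List.zip_append h.1, List.mem_append] at hp
  exact hp.elim (h.2 p) (h'.2 p)

lemma Close.symm {ε : ℝ} {X X' : List ℝ} (h : Close ε X X') : Close ε X' X := by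
  refine ⟨h.1.symm, fun p hp => ?_⟩
  rw [abs_sub_comm]
  refine h.2 p.swap ?_
  rw [← List.zip_swap, List.mem_map] at hp
  obtain ⟨q, hq, rfl⟩ := hp
  simpa using hq

lemma close_cons {ε a b : ℝ} {X X' : List ℝ} (h : |b - a| ≤ ε) (h' : Close ε X X') :
    Close ε (a :: X) (b :: X') := by
  refine ⟨by simp [h'.1], fun p hp => ?_⟩
  rw [List.zip_cons_cons, List.mem_cons] at hp
  rcases hp with rfl | hp
  · exact h
  · exact h'.2 p hp

lemma close_nil {ε : ℝ} : Close ε [] [] := ⟨rfl, by simp⟩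

lemma exists_split_at {X : List ℝ} {i : ℕ} (hi : i < X.length) :
    ∃ l a l', X = l ++ a :: l' ∧ l.length = i :=
  ⟨X.take i, X[i], X.drop (i + 1), by simp, by simp; omega⟩

/-- The windmill's central tile when the parities are odd. -/
lemma fills_tile {G : (Fin 4 → ℝ × ℝ) → Prop} {a b a' b' : ℝ} (hG : ∀ q : Fin 4 → ℝ × ℝ,
    (∀ i, (a ≤ (q i).1 ∧ (q i).1 ≤ b) ∧ a' ≤ (q i).2 ∧ (q i).2 ≤ b') → Good q → G q)
    (hab : a < b) (hab' : a' + 2 * (kap * (b - a)) < b') :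
    Fills G 4 fun f => pathSum f ((a :: ([(a + b) / 2] ++ [b])).map fun x => (x, a')) +
      pathSum f ((a' :: ([a' + kap * (b - a), a' + 2 * (kap * (b - a))] ++ [b'])).map
        fun y => (b, y)) - f (a, b') (b, b') -
      pathSum f ((a' :: ([a' + kap * (b - a)] ++ [b'])).map fun y => (a, y)) := by
  have hk := kap_pos
  have hk2 : kap ^ 2 = 1 / 3 := by linarith [kap_sq]
  -- Half of the width. The three lower cells meet at `(a + w, a' + k)`, where three sides form
  -- angles of 120°; two cells stand on the bottom, a third lies above them, and the last one
  -- extends the tile up to `b'`.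
  obtain ⟨w, hw, rfl⟩ : ∃ w, 0 < w ∧ b = a + 2 * w := ⟨(b - a) / 2, by linarith, by ring⟩
  have e1 : (a + (a + 2 * w)) / 2 = a + w := by ring
  have e2 : kap * (a + 2 * w - a) = 2 * (kap * w) := by ring
  rw [e1, e2]
  rw [e2] at hab'
  have hkw : 0 < kap * w := mul_pos hk hw
  set k := kap * w with hkdef
  have t1 : NiceTurn (1, 0) (0, 1) := ⟨by simp [det2], by simp [det2, dot2]⟩
  have t2 : NiceTurn (1, -kap) (0, 1) := ⟨by simp [det2], by simp [det2, dot2]; linarith⟩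
  have t3 : NiceTurn (1, kap) (0, 1) := ⟨by simp [det2], by simp [det2, dot2]; linarith⟩
  have t4 : NiceTurn (1, -kap) (1, kap) := by
    refine ⟨by simp [det2]; linarith, ?_⟩
    simp only [det2, dot2]
    nlinarith
  have t5 : NiceTurn (0, -1) (1, kap) := ⟨by simp [det2], by simp [det2, dot2]; linarith⟩
  have q1 := Fills.single (G := G) (a := (a, a')) (b := (a + w, a')) (d := (a + w, a' + k))
    (e := (a, a' + 2 * k))
    (hG _ (by intro i; fin_cases i <;> simp <;> (try and_intros) <;> linarith)
    (by
      refine good_mk ?_ ?_ ?_ ?_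
      · refine t1.of_eq (a := w) (b := 2 * k) (by linarith) (by linarith) ?_ ?_ <;>
          ext <;> simp [hkdef]
      · refine t1.of_eq (a := w) (b := k) (by linarith) (by linarith) ?_ ?_ <;>
          ext <;> simp [hkdef]
      · refine t2.of_eq (a := w) (b := k) (by linarith) (by linarith) ?_ ?_ <;>
          ext <;> simp [hkdef] <;> ring
      · refine t2.of_eq (a := w) (b := 2 * k) (by linarith) (by linarith) ?_ ?_ <;>
          ext <;> simp [hkdef] <;> ring))
  have q2 := Fills.single (G := G) (a := (a + w, a')) (b := (a + 2 * w, a'))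
    (d := (a + 2 * w, a' + 2 * k)) (e := (a + w, a' + k))
    (hG _ (by intro i; fin_cases i <;> simp <;> (try and_intros) <;> linarith)
    (by
      refine good_mk ?_ ?_ ?_ ?_
      · refine t1.of_eq (a := w) (b := k) (by linarith) (by linarith) ?_ ?_ <;>
          ext <;> simp [hkdef] <;> ring
      · refine t1.of_eq (a := w) (b := 2 * k) (by linarith) (by linarith) ?_ ?_ <;>
          ext <;> simp [hkdef] <;> ring
      · refine t3.of_eq (a := w) (b := 2 * k) (by linarith) (by linarith) ?_ ?_ <;>
          ext <;> simp [hkdef] <;> ring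
      · refine t3.of_eq (a := w) (b := k) (by linarith) (by linarith) ?_ ?_ <;>
          ext <;> simp [hkdef] <;> ring))
  have q3 := Fills.single (G := G) (a := (a, a' + 2 * k)) (b := (a + w, a' + k))
    (d := (a + 2 * w, a' + 2 * k)) (e := (a + 2 * w, a' + 4 * k))
    (hG _ (by intro i; fin_cases i <;> simp <;> (try and_intros) <;> linarith)
    (by
      refine good_mk ?_ ?_ ?_ ?_
      · refine t4.of_eq (a := w) (b := 2 * w) (by linarith) (by linarith) ?_ ?_ <;>
          ext <;> simp [hkdef] <;> ring
      · refine t4.of_eq (a := w) (b := w) (by linarith) (by linarith) ?_ ?_ <;>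
          ext <;> simp [hkdef] <;> ring
      · refine t5.of_eq (a := 2 * k) (b := w) (by linarith) (by linarith) ?_ ?_ <;>
          ext <;> simp [hkdef] <;> ring
      · refine t5.of_eq (a := 2 * k) (b := 2 * w) (by linarith) (by linarith) ?_ ?_ <;>
          ext <;> simp [hkdef] <;> ring))
  have q4 := Fills.single (G := G) (a := (a, a' + 2 * k)) (b := (a + 2 * w, a' + 4 * k))
    (d := (a + 2 * w, b')) (e := (a, b'))
    (hG _ (by intro i; fin_cases i <;> simp <;> (try and_intros) <;> linarith)
    (by
      refine good_mk ?_ ?_ ?_ ?_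
      · refine t3.of_eq (a := 2 * w) (b := b' - a' - 2 * k) (by linarith) (by linarith) ?_ ?_ <;>
          ext <;> simp [hkdef] <;> ring
      · refine t3.of_eq (a := 2 * w) (b := b' - a' - 4 * k) (by linarith) (by linarith) ?_ ?_ <;>
          ext <;> simp [hkdef] <;> ring
      · refine t1.of_eq (a := 2 * w) (b := b' - a' - 4 * k) (by linarith) (by linarith) ?_ ?_ <;>
          ext <;> simp [hkdef] <;> ring
      · refine t1.of_eq (a := 2 * w) (b := b' - a' - 2 * k) (by linarith) (by linarith) ?_ ?_ <;>
          ext <;> simp [hkdef] <;> ring))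
  refine (((q1.add q2).add q3).add q4).mono le_rfl fun f hf => ?_
  have := hf (a + w, a') (a + w, a' + k)
  have := hf (a + w, a' + k) (a, a' + 2 * k)
  have := hf (a + 2 * w, a' + 2 * k) (a + w, a' + k)
  have := hf (a, a' + 2 * k) (a + 2 * w, a' + 4 * k)
  have := hf (a, b') (a + 2 * w, b')
  have := hf (a, a') (a, a' + 2 * k)
  have := hf (a, a' + 2 * k) (a, b')
  have : 2 * (2 * k) = 4 * k := by ring
  simp [this]
  linarith

lemma Wall.close {W s s' ε : ℝ} {r u : ℕ} {P P' p S q p' S' q' : List ℝ} {δ : ℕ}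
    (h : Wall W r s u P) (h' : Wall W r s' u P') (hP : P = p ++ (S ++ q))
    (hP' : P' = p' ++ (S' ++ q')) (hW : 0 ≤ W) (hs : 0 ≤ s) (hs1 : s ≤ 26 * th) (hs' : 0 ≤ s')
    (hs1' : s' ≤ 26 * th) (hδ : δ ≤ 1) (hp : p'.length = p.length + δ)
    (hS : S.length = S'.length) (hε : W / (r + 1) + 32 * th ≤ ε) : Close ε S S' := by
  refine close_of_getElem? hS fun i z z' hz hz' => ?_
  rw [abs_sub_comm]
  have get : ∀ (p S q : List ℝ) (z : ℝ), S[i]? = some z → (p ++ (S ++ q))[p.length + i]? = some z := by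
    intro p S q z hz
    rw [List.getElem?_append_right (by omega), Nat.add_sub_cancel_left,
      List.getElem?_append_left (List.getElem?_eq_some_iff.1 hz).1]
    exact hz
  refine (h.dist_le h' hW hs hs1 hs' hs1' (i := p.length + i) hδ ?_ ?_).trans hε
  · rw [hP]; exact get _ _ _ _ hz
  · rw [hP', show p.length + i + δ = p'.length + i by omega]; exact get _ _ _ _ hz'

lemma Wall.near {W s : ℝ} {c u k : ℕ} {P p q : List ℝ} {z : ℝ}
    (h : Wall W (2 * c + 1) s u P) (hP : P = p ++ z :: q) (hp : p.length = (4 * c + 1) * u + k)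
    (hk : k ≤ 3) : |z - (W / 2 + s)| ≤ 3 * th := by
  have hsite : site W (2 * c + 1) s c = W / 2 + s := by
    simp only [site]; push_cast
    have e : (2 * (c : ℝ) + 1 + 1) = 2 * (c + 1) := by ring
    rw [e]; field_simp; ring
  obtain ⟨z', hz, hz'⟩ := h.ctl c (by omega) ((4 * c + 1) * u + k) (by omega) (by omega)
  rw [hP, ← hp, List.getElem?_append_right le_rfl, Nat.sub_self, List.getElem?_cons_zero,
    Option.some_inj] at hz
  rw [hz, ← hsite]; exact hz'

lemma isChain_triple {a b c : ℝ} (h : a < b) (h' : b < c) : (a :: ([b] ++ [c])).IsChain (· < ·) := by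
  simp [h, h']

/-- Splitting a wall at a point near the middle of the side. -/
lemma Wall.split {W s : ℝ} {c u : ℕ} {X : List ℝ} {x y : ℝ}
    (h : Wall W (2 * c + 1) s u (x :: (X ++ [y]))) (hu : 0 < u) {k : ℕ} (hk : k ≤ 3)
    (hy : W / 2 + s + 3 * th < y) :
    ∃ l a l', X = l ++ a :: l' ∧ l.length + 1 = (4 * c + 1) * u + k ∧
      |a - (W / 2 + s)| ≤ 3 * th := by
  have hI : 0 < (4 * c + 1) * u := by positivity
  have hlt : (4 * c + 1) * u + k - 1 < X.length := by
    by_contra! hge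
    obtain ⟨z', hz, -⟩ := h.ctl c (by omega) ((4 * c + 1) * u + k) (by omega) (by omega)
    have hlen := (List.getElem?_eq_some_iff.1 hz).1
    simp only [List.length_cons, List.length_append, List.length_nil] at hlen
    have := h.near (p := x :: X) (q := []) (z := y) (k := k) rfl (by simp; omega) hk
    linarith [(abs_le.1 this).2]
  obtain ⟨l, a, l', rfl, hl⟩ := exists_split_at hlt
  exact ⟨l, a, l', rfl, by omega, h.near (p := x :: l) (q := l' ++ [y]) (by simp)
    (by simp; omega) hk⟩

set_option maxHeartbeats 800000 in
/-- The inner part of the rectangle, in model coordinates. -/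
theorem fills_inner {G : (Fin 4 → ℝ × ℝ) → Prop} (hV : HasVertical G) (hH : HasHorizontal G)
    {W H : ℝ} (hC : ∀ q : Fin 4 → ℝ × ℝ, (∀ i, (1 / 10 ≤ (q i).1 ∧ (q i).1 ≤ W - 1 / 10) ∧
      1 / 10 ≤ (q i).2 ∧ (q i).2 ≤ H - 1 / 10) → Good q → G q) {c c' u u' δ : ℕ}
    {XB XT XL XR : List ℝ} (hW : 1 / 2 ≤ W) (hH' : 1 / 2 ≤ H)
    (hWH : W / ((2 * c + 1 : ℕ) + 1) ≤ H / 4) (hHW : H / ((2 * c' + 1 : ℕ) + 1) ≤ W / 4)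
    (hu : 0 < u) (hu' : 0 < u')
    (hB : Wall W (2 * c + 1) (7 * th) u (th :: (XB ++ [W - th])))
    (hT : Wall W (2 * c + 1) 0 u (th :: (XT ++ [W - th])))
    (hL : Wall H (2 * c' + 1) 0 u' (th :: (XL ++ [H - th])))
    (hR : Wall H (2 * c' + 1) (26 * th) u' (th :: (XR ++ [H - th])))
    (hδ : δ ≤ 1) (lB : XB.length = XT.length + δ) (lR : XR.length = XL.length + δ) :
    Fills G (4 * ((XB.length + 1) * (XR.length + 1)) + 4) fun f =>
      pathSum f ((th :: (XB ++ [W - th])).map fun x => (x, th)) +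
      pathSum f ((th :: (XR ++ [H - th])).map fun y => (W - th, y)) -
      pathSum f ((th :: (XT ++ [W - th])).map fun x => (x, H - th)) -
      pathSum f ((th :: (XL ++ [H - th])).map fun y => (th, y)) := by
  have hth : th = 1 / 10000 := rfl
  -- The walls are cut at the middle sites. The offsets `0`, `1 + δ`, `0`, `1 + 2 * δ` of the
  -- indices give the windmill `δ` additional points at the bottom of the tile and `2 * δ` on its
  -- right. With tolerance `3 * th`, the shifts `0` and `7 * th` force `a < b ≤ a + 13 * th`, and
  -- the shifts `0` and `26 * th` make the tile high enough for `fills_tile`.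
  obtain ⟨Tl, a, Tr, rfl, lT, ha⟩ := hT.split hu (k := 0) (by omega) (by rw [hth]; linarith)
  obtain ⟨Bl, b, Br, rfl, lBl, hb⟩ := hB.split hu (k := 1 + δ) (by omega) (by rw [hth]; linarith)
  obtain ⟨Ll, a', Lr, rfl, lL, ha'⟩ := hL.split hu' (k := 0) (by omega) (by rw [hth]; linarith)
  obtain ⟨Rl, b', Rr, rfl, lRl, hb'⟩ := hR.split hu' (k := 1 + 2 * δ) (by omega) (by rw [hth]; linarith)
  obtain ⟨ha1, ha2⟩ := abs_le.1 ha
  obtain ⟨hb1, hb2⟩ := abs_le.1 hb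
  obtain ⟨ha1', ha2'⟩ := abs_le.1 ha'
  obtain ⟨hb1', hb2'⟩ := abs_le.1 hb'
  have hab : a < b := by linarith
  have hab' : a' + 18 * th < b' := by linarith
  -- Lines are displaced by little more than the site distance, at most a quarter of the other
  -- dimension, over arms nearly half as long: the slopes are about `1 / 2`.
  have e1 : W / ((2 * c + 1 : ℕ) + 1) + 32 * th ≤ 54 / 100 * (a' - th) := by
    linarith only [hth, hWH, hHW, hW, hH', ha1, ha2, hb1, hb2, ha1', ha2', hb1', hb2']
  have e2 : W / ((2 * c + 1 : ℕ) + 1) + 32 * th ≤ 54 / 100 * (H - th - b') := by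
    linarith only [hth, hWH, hHW, hW, hH', ha1, ha2, hb1, hb2, ha1', ha2', hb1', hb2']
  have e3 : H / ((2 * c' + 1 : ℕ) + 1) + 32 * th ≤ 54 / 100 * (a - th) := by
    linarith only [hth, hWH, hHW, hW, hH', ha1, ha2, hb1, hb2, ha1', ha2', hb1', hb2']
  have e4 : H / ((2 * c' + 1 : ℕ) + 1) + 32 * th ≤ 54 / 100 * (W - th - b) := by
    linarith only [hth, hWH, hHW, hW, hH', ha1, ha2, hb1, hb2, ha1', ha2', hb1', hb2']
  have hW0 : 0 ≤ W := by linarith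
  have hH0 : 0 ≤ H := by linarith
  have g1 : 0 ≤ W / ((2 * c + 1 : ℕ) + 1) := by positivity
  have g2 : 0 ≤ H / ((2 * c' + 1 : ℕ) + 1) := by positivity
  have s0 : (0 : ℝ) ≤ 26 * th := by rw [hth]; norm_num
  have s7 : (0 : ℝ) ≤ 7 * th := by rw [hth]; norm_num
  have s7' : 7 * th ≤ 26 * th := by rw [hth]; norm_num
  simp only [List.length_append, List.length_cons] at lB lR
  simp only [List.append_assoc, List.cons_append] at hB hT hL hR ⊢
  have count : ∀ N, N ≤ 4 → (Bl.length + 1) * (Ll.length + 1) + (Rl.length + 1) * (Br.length + 1) +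
        (Tr.length + 1) * (Rr.length + 1) + (Lr.length + 1) * (Tl.length + 1) + N ≤
      4 * (((Bl ++ b :: Br).length + 1) * ((Rl ++ b' :: Rr).length + 1)) + 4 := by
    intro N hN
    simp only [List.length_append, List.length_cons]
    have c1 : (Bl.length + 1) * (Ll.length + 1) ≤
      (Bl.length + (Br.length + 1) + 1) * (Rl.length + (Rr.length + 1) + 1) := by
      gcongr <;> omega
    have c2 : (Rl.length + 1) * (Br.length + 1) ≤
      (Bl.length + (Br.length + 1) + 1) * (Rl.length + (Rr.length + 1) + 1) := by
      rw [mul_comm]; gcongr <;> omega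
    have c3 : (Tr.length + 1) * (Rr.length + 1) ≤
      (Bl.length + (Br.length + 1) + 1) * (Rl.length + (Rr.length + 1) + 1) := by
      gcongr <;> omega
    have c4 : (Lr.length + 1) * (Tl.length + 1) ≤
      (Bl.length + (Br.length + 1) + 1) * (Rl.length + (Rr.length + 1) + 1) := by
      rw [mul_comm]; gcongr <;> omega
    omega
  obtain rfl | rfl : δ = 0 ∨ δ = 1 := by omega
  · refine (fills_windmill hV hH hB.chain hT.chain hL.chain hR.chain (pb := []) (pr := [])
      (pl := []) (by simpa using hab) (by simp; linarith [th_pos]) (by simp; linarith [th_pos])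
      ?_ ?_ ?_ ?_ (N := 1) ?_).mono (count 1 (by omega)) fun f _ => rfl
    · exact (hB.close hT (p := [th]) (p' := [th]) (q := b :: (Br ++ [W - th]))
        (q' := Tr ++ [W - th]) (by simp) (by simp) hW0 s7 s7' le_rfl s0
        (Nat.zero_le 1) rfl (by simp; omega) e1)
    · exact (hB.close hT (p := th :: Bl) (p' := th :: (Tl ++ [a])) (q := [W - th])
        (q' := [W - th]) (by simp) (by simp) hW0 s7 s7' le_rfl s0
        (Nat.zero_le 1) (by simp; omega) (by simp; omega) e2)
    · exact (hL.close hR (p := th :: (Ll ++ [a'])) (p' := th :: Rl) (q := [H - th])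
        (q' := [H - th]) (by simp) (by simp) hH0 le_rfl s0 s0 le_rfl
        (Nat.zero_le 1) (by simp; omega) (by simp; omega) e3)
    · exact (hL.close hR (p := [th]) (p' := [th]) (q := Lr ++ [H - th])
        (q' := b' :: (Rr ++ [H - th])) (by simp) (by simp) hH0 le_rfl s0 s0 le_rfl
        (Nat.zero_le 1) rfl (by simp; omega) e4)
    · have := Fills.single (hV a b a b a' b' hab hab (by linarith [th_pos])
        (by simp; linarith [th_pos]) (by simp; linarith [th_pos]))
      refine this.mono le_rfl fun f hf => ?_
      have := hf (a, b') (b, b')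
      have := hf (a, b') (a, a')
      simp
      linarith
  -- For odd defects, the wall points `t`, `l₁`, `r₁` and `r₂` are singled out; they are joined to
  -- the additional points of the tile, not to points of the opposite wall.
  · obtain ⟨Bl, t, rfl, hBl⟩ : ∃ l t, Bl = l ++ [t] ∧ l.length = (4 * c + 1) * u := by
      obtain ⟨l, t, l', rfl, hl⟩ := exists_split_at (show (4 * c + 1) * u < Bl.length by omega)
      obtain rfl : l' = [] := List.eq_nil_of_length_eq_zero (by simp at lBl; omega)
      exact ⟨l, t, rfl, hl⟩
    obtain ⟨l₁, Lr, rfl⟩ : ∃ l₁ l, Lr = l₁ :: l := by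
      obtain _ | ⟨l₁, l⟩ := Lr
      · simp at lR; omega
      · exact ⟨l₁, l, rfl⟩
    obtain ⟨Rl, r₁, r₂, rfl, hRl⟩ :
        ∃ l r₁ r₂, Rl = l ++ [r₁, r₂] ∧ l.length = (4 * c' + 1) * u' := by
      obtain ⟨l, r₁, l', rfl, hl⟩ := exists_split_at (show (4 * c' + 1) * u' < Rl.length by omega)
      have : l'.length = 1 := by simp at lRl; omega
      obtain ⟨r₂, rfl⟩ := List.length_eq_one_iff.1 this
      exact ⟨l, r₁, r₂, rfl, hl⟩
    simp only [List.append_assoc, List.cons_append, List.nil_append] at hB hL hR ⊢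
    simp only [List.length_append, List.length_cons, List.length_nil] at lB lR lBl lRl
    have nt := abs_le.1 (hB.near (p := th :: Bl) (z := t) (q := b :: (Br ++ [W - th])) (k := 1)
      (by simp) (by simp; omega) (by omega))
    have nl := abs_le.1 (hL.near (p := th :: (Ll ++ [a'])) (z := l₁) (q := Lr ++ [H - th]) (k := 1)
      (by simp) (by simp; omega) (by omega))
    have nr₁ := abs_le.1 (hR.near (p := th :: Rl) (z := r₁) (q := r₂ :: b' :: (Rr ++ [H - th]))
      (k := 1) (by simp) (by simp; omega) (by omega))
    have nr₂ := abs_le.1 (hR.near (p := th :: (Rl ++ [r₁])) (z := r₂) (q := b' :: (Rr ++ [H - th]))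
      (k := 2) (by simp) (by simp; omega) (by omega))
    have hw : kap * (b - a) ≤ 58 / 100 * (13 * th) :=
      mul_le_mul kap_lt.le (by linarith) (by linarith) (by norm_num)
    have hw0 : 0 < kap * (b - a) := mul_pos kap_pos (by linarith)
    have tile := fills_tile (G := G) (a := a) (b := b) (a' := a') (b' := b')
      (fun q hq => hC q fun i => by
        obtain ⟨⟨h1, h2⟩, h3, h4⟩ := hq i
        refine ⟨⟨?_, ?_⟩, ?_, ?_⟩ <;>
          linarith only [h1, h2, h3, h4, hth, ha1, hb2, ha1', hb2', hW, hH']) hab (by linarith [th_pos])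
    generalize kap * (b - a) = w at *
    have m₁ : a < (a + b) / 2 := by linarith only [hab]
    have m₂ : (a + b) / 2 < b := by linarith only [hab]
    have m₃ : a' + w < a' + 2 * w := by linarith only [hw0]
    have m₄ : a' + 2 * w < b' := by linarith only [hw, hab', hth]
    have m₅ : a' < a' + w := by linarith only [hw0]
    have m₆ : a' + w < b' := m₃.trans m₄
    have n₁ : |(a + b) / 2 - t| ≤ 54 / 100 * (a' - th) := by
      rw [abs_le]
      constructor <;> linarith only [e1, g1, nt.1, nt.2, ha1, ha2, hb1, hb2, th_pos]
    have n₂ : |a' + w - l₁| ≤ 54 / 100 * (a - th) := by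
      rw [abs_le]
      constructor <;> linarith only [e3, g2, nl.1, nl.2, ha1', ha2', hw, hw0, th_pos]
    have n₃ : |r₁ - (a' + w)| ≤ 54 / 100 * (W - th - b) := by
      rw [abs_le]
      constructor <;> linarith only [e4, g2, nr₁.1, nr₁.2, ha1', ha2', hw, hw0, th_pos]
    have n₄ : |r₂ - (a' + 2 * w)| ≤ 54 / 100 * (W - th - b) := by
      rw [abs_le]
      constructor <;> linarith only [e4, g2, nr₂.1, nr₂.2, ha1', ha2', hw, hw0, th_pos]
    refine (fills_windmill hV hH (Bl := Bl ++ [t]) (Rl := Rl ++ [r₁, r₂]) (Lr := l₁ :: Lr)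
      (by simpa using hB.chain) hT.chain hL.chain (by simpa using hR.chain)
      (isChain_triple m₁ m₂) (by simpa [m₅] using ⟨(add_lt_add_iff_left a').1 m₃, m₄⟩) (isChain_triple m₅ m₆)
      ?_ ?_ ?_ ?_ tile).mono ((count 4 le_rfl).trans (by simp)) fun f _ => by simp
    · have := hB.close hT (p := [th]) (p' := [th]) (S := Bl) (S' := Tl ++ [a])
        (q := t :: b :: (Br ++ [W - th])) (q' := Tr ++ [W - th]) (by simp) (by simp) hW0 s7 s7'
        le_rfl s0 (Nat.zero_le 1) rfl (by simp; omega) e1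
      have := this.append (close_cons (a := t) (b := (a + b) / 2) n₁ close_nil)
      simpa using this
    · exact (hT.close hB (p' := th :: (Bl ++ [t])) (p := th :: (Tl ++ [a])) (q := [W - th])
        (q' := [W - th]) (by simp) (by simp) hW0 le_rfl s0 s7 s7'
        le_rfl (by simp; omega) (by simp; omega) e2).symm
    · refine close_cons n₂ ?_
      exact (hL.close hR (p := th :: (Ll ++ [a', l₁])) (p' := th :: (Rl ++ [r₁, r₂]))
        (q := [H - th]) (q' := [H - th]) (by simp) (by simp) hH0 le_rfl s0 s0 le_rfl
        le_rfl (by simp; omega) (by simp; omega) e3)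
    · have := hL.close hR (p := [th]) (p' := [th]) (S := Ll ++ [a']) (S' := Rl)
        (q := l₁ :: (Lr ++ [H - th])) (q' := r₁ :: r₂ :: b' :: (Rr ++ [H - th])) (by simp) (by simp)
        hH0 le_rfl s0 s0 le_rfl (Nat.zero_le 1) rfl (by simp; omega) e4
      have := this.append (close_cons (a := a' + w) (b := r₁) n₃ (close_cons (a := a' + 2 * w) (b := r₂) n₄ close_nil))
      simpa using this

/-! ### The distortion near the corners -/

/-- The hat function, cut off at `1`. -/
noncomputable def chat (t : ℝ) : ℝ := min 1 (hat t)

lemma chat_nonneg (t : ℝ) : 0 ≤ chat t := le_min zero_le_one (le_max_left _ _)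

lemma chat_le_one (t : ℝ) : chat t ≤ 1 := min_le_left _ _

lemma chat_eq_zero {t : ℝ} (h : 1 / 10 ≤ t) : chat t = 0 := by
  rw [chat, hat_eq_zero h]; norm_num

lemma chat_eq_hat {t : ℝ} (h : th ≤ t) : chat t = hat t := by
  have h0 : (0 : ℝ) < 1 / 10 - th := by norm_num [th]
  refine min_eq_right (max_le zero_le_one ?_)
  rw [div_le_one h0]; linarith

lemma chat_th : chat th = 1 := by rw [chat_eq_hat le_rfl, hat_th]

/-- The Lipschitz constant `1 / (1 / 10 - th)` is slightly larger than `10`. -/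
lemma abs_chat_sub_le (t t' : ℝ) : |chat t - chat t'| ≤ 11 * |t - t'| := by
  have h0 : (0 : ℝ) < 1 / 10 - th := by norm_num [th]
  have h1 : |chat t - chat t'| ≤ |hat t - hat t'| := by
    have := abs_min_sub_min_le_max 1 (hat t) 1 (hat t')
    simpa [chat] using this
  have h2 : |hat t - hat t'| ≤ |(1 / 10 - t) / (1 / 10 - th) - (1 / 10 - t') / (1 / 10 - th)| := by
    have := abs_max_sub_max_le_max 0 ((1 / 10 - t) / (1 / 10 - th)) 0 ((1 / 10 - t') / (1 / 10 - th))
    simpa [hat] using this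
  refine h1.trans (h2.trans ?_)
  have : (1 / 10 - t) / (1 / 10 - th) - (1 / 10 - t') / (1 / 10 - th) =
      (t' - t) / (1 / 10 - th) := by ring
  rw [this, abs_div, abs_of_pos h0, div_le_iff₀ h0, abs_sub_comm]
  have h3 := abs_nonneg (t - t')
  have : (th : ℝ) = 1 / 10000 := rfl
  rw [this]; linarith

lemma abs_chat_mul_sub_le (a b a' b' : ℝ) :
    |chat a * chat b - chat a' * chat b'| ≤ 11 * (|a - a'| + |b - b'|) := by
  have e : chat a * chat b - chat a' * chat b' =
      (chat a - chat a') * chat b + chat a' * (chat b - chat b') := by ring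
  rw [e]
  refine (abs_add_le _ _).trans ?_
  rw [abs_mul, abs_mul, abs_of_nonneg (chat_nonneg b), abs_of_nonneg (chat_nonneg a')]
  have h1 := mul_le_mul (abs_chat_sub_le a a') (chat_le_one b) (chat_nonneg b) (by positivity)
  have h2 := mul_le_mul (chat_le_one a') (abs_chat_sub_le b b') (abs_nonneg _) zero_le_one
  linarith

/-- The displacement that takes the corners of the model to prescribed positions. -/
noncomputable def bump (W H d₀₀ d₁₀ d₀₁ d₁₁ : ℝ) (p : ℝ × ℝ) : ℝ :=
  d₀₀ * (chat p.1 * chat p.2) + d₁₀ * (chat (W - p.1) * chat p.2) +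
    d₀₁ * (chat p.1 * chat (H - p.2)) + d₁₁ * (chat (W - p.1) * chat (H - p.2))

lemma abs_bump_sub_le {W H d₀₀ d₁₀ d₀₁ d₁₁ : ℝ} (h₀₀ : |d₀₀| ≤ th) (h₁₀ : |d₁₀| ≤ th)
    (h₀₁ : |d₀₁| ≤ th) (h₁₁ : |d₁₁| ≤ th) (p q : ℝ × ℝ) :
    |bump W H d₀₀ d₁₀ d₀₁ d₁₁ p - bump W H d₀₀ d₁₀ d₀₁ d₁₁ q| ≤
      1 / 200 * (|p.1 - q.1| + |p.2 - q.2|) := by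
  -- Each of the four corner terms has Lipschitz constant at most `11 * th`, which is less than `1 /
  -- 800`.
  have key : ∀ d a b a' b' : ℝ, |d| ≤ th → |a - a'| = |p.1 - q.1| → |b - b'| = |p.2 - q.2| →
      |d * (chat a * chat b) - d * (chat a' * chat b')| ≤
        1 / 800 * (|p.1 - q.1| + |p.2 - q.2|) := by
    intro d a b a' b' hd ha hb
    rw [← mul_sub, abs_mul]
    have h1 := abs_chat_mul_sub_le a b a' b'
    rw [ha, hb] at h1
    have h2 := mul_le_mul hd h1 (abs_nonneg _) th_pos.le
    have h3 : 0 ≤ |p.1 - q.1| + |p.2 - q.2| := by positivity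
    have : (th : ℝ) = 1 / 10000 := rfl
    rw [this] at h2
    linarith
  have f1 : |W - p.1 - (W - q.1)| = |p.1 - q.1| := by
    rw [sub_sub_sub_cancel_left, abs_sub_comm]
  have f2 : |H - p.2 - (H - q.2)| = |p.2 - q.2| := by
    rw [sub_sub_sub_cancel_left, abs_sub_comm]
  have k1 := abs_le.1 (key d₀₀ p.1 p.2 q.1 q.2 h₀₀ rfl rfl)
  have k2 := abs_le.1 (key d₁₀ (W - p.1) p.2 (W - q.1) q.2 h₁₀ f1 rfl)
  have k3 := abs_le.1 (key d₀₁ p.1 (H - p.2) q.1 (H - q.2) h₀₁ rfl f2)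
  have k4 := abs_le.1 (key d₁₁ (W - p.1) (H - p.2) (W - q.1) (H - q.2) h₁₁ f1 f2)
  simp only [bump]
  rw [abs_le]
  constructor <;> linarith only [k1.1, k1.2, k2.1, k2.2, k3.1, k3.2, k4.1, k4.2]

/-- A map that is close to the identity. -/
def NearId (φ : ℝ × ℝ → ℝ × ℝ) : Prop := ∀ p q,
  |(φ p).1 - (φ q).1 - (p.1 - q.1)| ≤ 1 / 200 * (|p.1 - q.1| + |p.2 - q.2|) ∧
  |(φ p).2 - (φ q).2 - (p.2 - q.2)| ≤ 1 / 200 * (|p.1 - q.1| + |p.2 - q.2|)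

/-- The distortion increases a slope of `54 / 100` to less than `56 / 100` and tilts the horizontal
side by less than `1 / 100`, as `niceTurn_robust` requires. -/
lemma NearId.niceTurn_vertical {φ : ℝ × ℝ → ℝ × ℝ} (hφ : NearId φ) {x y z w : ℝ × ℝ}
    (h1 : x.1 < y.1) (h2 : y.2 = x.2) (h3 : z.2 < w.2)
    (h4 : |w.1 - z.1| ≤ 54 / 100 * (w.2 - z.2)) : NiceTurn (φ y - φ x) (φ w - φ z) := by
  obtain ⟨a1, a2⟩ := hφ y x
  obtain ⟨b1, b2⟩ := hφ w z
  rw [h2, sub_self, abs_zero, abs_of_pos (show 0 < y.1 - x.1 by linarith)] at a1 a2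
  rw [abs_of_pos (show 0 < w.2 - z.2 by linarith)] at b1 b2
  obtain ⟨a3, a4⟩ := abs_le.1 a1
  obtain ⟨a5, a6⟩ := abs_le.1 a2
  obtain ⟨b3, b4⟩ := abs_le.1 b1
  obtain ⟨b5, b6⟩ := abs_le.1 b2
  obtain ⟨c1, c2⟩ := abs_le.1 h4
  have e1 : φ y - φ x = ((φ y).1 - (φ x).1, (φ y).2 - (φ x).2) := rfl
  have e2 : φ w - φ z = ((φ w).1 - (φ z).1, (φ w).2 - (φ z).2) := rfl
  rw [e1, e2]
  refine niceTurn_robust (by linarith) (by linarith) ?_ ?_ <;> rw [abs_le] <;>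
    constructor <;> linarith

lemma NiceTurn.rotate_iff {c e p t : ℝ} : NiceTurn (e, -c) (t, -p) ↔ NiceTurn (c, e) (p, t) := by
  have e1 : det2 (e, -c) (t, -p) = det2 (c, e) (p, t) := by simp only [det2]; ring
  have e2 : dot2 (e, -c) (t, -p) = dot2 (c, e) (p, t) := by simp only [dot2]; ring
  rw [NiceTurn, NiceTurn, e1, e2]

lemma NearId.niceTurn_horizontal {φ : ℝ × ℝ → ℝ × ℝ} (hφ : NearId φ) {x y z w : ℝ × ℝ}
    (h1 : y.2 < x.2) (h2 : y.1 = x.1) (h3 : z.1 < w.1)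
    (h4 : |w.2 - z.2| ≤ 54 / 100 * (w.1 - z.1)) : NiceTurn (φ y - φ x) (φ w - φ z) := by
  obtain ⟨a1, a2⟩ := hφ y x
  obtain ⟨b1, b2⟩ := hφ w z
  rw [h2, sub_self, abs_zero, abs_of_neg (show y.2 - x.2 < 0 by linarith)] at a1 a2
  rw [abs_of_pos (show 0 < w.1 - z.1 by linarith)] at b1 b2
  obtain ⟨a3, a4⟩ := abs_le.1 a1
  obtain ⟨a5, a6⟩ := abs_le.1 a2
  obtain ⟨b3, b4⟩ := abs_le.1 b1
  obtain ⟨b5, b6⟩ := abs_le.1 b2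
  obtain ⟨c1, c2⟩ := abs_le.1 h4
  have e1 : φ y - φ x = ((φ y).1 - (φ x).1, -((φ x).2 - (φ y).2)) := by ext <;> simp
  have e2 : φ w - φ z = ((φ w).1 - (φ z).1, -((φ z).2 - (φ w).2)) := by ext <;> simp
  rw [e1, e2, NiceTurn.rotate_iff]
  refine niceTurn_robust (by linarith) (by linarith) ?_ ?_ <;> rw [abs_le] <;>
    constructor <;> linarith

lemma comp_quad (φ : ℝ × ℝ → ℝ × ℝ) (a b c d : ℝ × ℝ) :
    (fun i => φ (![a, b, c, d] i)) = ![φ a, φ b, φ c, φ d] := by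
  funext i; fin_cases i <;> rfl

lemma NearId.hasVertical {φ : ℝ × ℝ → ℝ × ℝ} (hφ : NearId φ) :
    HasVertical fun q => Good fun i => φ (q i) := by
  intro x₁ x₂ x₁' x₂' y y' h1 h2 h3 h4 h5
  rw [comp_quad]
  exact good_mk (hφ.niceTurn_vertical h1 rfl h3 h4) (hφ.niceTurn_vertical h1 rfl h3 h5)
    (hφ.niceTurn_vertical h2 rfl h3 h5) (hφ.niceTurn_vertical h2 rfl h3 h4)

lemma NearId.hasHorizontal {φ : ℝ × ℝ → ℝ × ℝ} (hφ : NearId φ) :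
    HasHorizontal fun q => Good fun i => φ (q i) := by
  intro x x' y₁ y₂ y₁' y₂' h1 h2 h3 h4 h5
  rw [comp_quad]
  exact good_mk (hφ.niceTurn_horizontal h2 rfl h1 h5) (hφ.niceTurn_horizontal h2 rfl h1 h4)
    (hφ.niceTurn_horizontal h3 rfl h1 h4) (hφ.niceTurn_horizontal h3 rfl h1 h5)

/-- The map of the model that moves its corners to the inner corners of the corner tiles. -/
noncomputable def warp (W H : ℝ) (d₀₀ d₁₀ d₀₁ d₁₁ : ℝ × ℝ) (p : ℝ × ℝ) : ℝ × ℝ :=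
  (p.1 + bump W H d₀₀.1 d₁₀.1 d₀₁.1 d₁₁.1 p, p.2 + bump W H d₀₀.2 d₁₀.2 d₀₁.2 d₁₁.2 p)

lemma warp_nearId {W H : ℝ} {d₀₀ d₁₀ d₀₁ d₁₁ : ℝ × ℝ} (h₀₀ : |d₀₀.1| ≤ th ∧ |d₀₀.2| ≤ th)
    (h₁₀ : |d₁₀.1| ≤ th ∧ |d₁₀.2| ≤ th) (h₀₁ : |d₀₁.1| ≤ th ∧ |d₀₁.2| ≤ th)
    (h₁₁ : |d₁₁.1| ≤ th ∧ |d₁₁.2| ≤ th) : NearId (warp W H d₀₀ d₁₀ d₀₁ d₁₁) := by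
  intro p q
  have h1 := abs_bump_sub_le (W := W) (H := H) h₀₀.1 h₁₀.1 h₀₁.1 h₁₁.1 p q
  have h2 := abs_bump_sub_le (W := W) (H := H) h₀₀.2 h₁₀.2 h₀₁.2 h₁₁.2 p q
  constructor
  · convert h1 using 2; simp only [warp]; ring
  · convert h2 using 2; simp only [warp]; ring

/-- The central tile has angles of exactly 60° and 120° and tolerates no distortion. -/
lemma warp_eq_self {W H : ℝ} {d₀₀ d₁₀ d₀₁ d₁₁ p : ℝ × ℝ}
    (h : (1 / 10 ≤ p.1 ∧ p.1 ≤ W - 1 / 10) ∧ 1 / 10 ≤ p.2 ∧ p.2 ≤ H - 1 / 10) :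
    warp W H d₀₀ d₁₀ d₀₁ d₁₁ p = p := by
  obtain ⟨⟨h1, h2⟩, h3, h4⟩ := h
  simp [warp, bump, chat_eq_zero h1, chat_eq_zero h3,
    chat_eq_zero (show 1 / 10 ≤ W - p.1 by linarith),
    chat_eq_zero (show 1 / 10 ≤ H - p.2 by linarith)]

/-! ### Filling a rectangle -/

/-- A surplus changes the number of wall points by an even amount, so only the parity matters. The
bounds on `e` and `e'` make it possible to choose `u` beforehand. -/
lemma exists_equalizer (m m' : ℕ) (δ : ℕ) (hδ : (m + m' + δ) % 2 = 0) :
    ∃ e e', m + 2 * e = m' + 2 * e' + δ ∧ e ≤ m' + δ ∧ e' ≤ m := by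
  rcases le_total m (m' + δ) with h | h
  · exact ⟨(m' + δ - m) / 2, 0, by omega, by omega, by omega⟩
  · exact ⟨0, (m - m' - δ) / 2, by omega, by omega, by omega⟩

lemma wall_of_strip {W s : ℝ} {r u : ℕ} {X : List ℝ}
    (hX : (th :: (X ++ [W - th])).IsChain (· < ·))
    (hc : ∀ j < r, Ctl (th :: (X ++ [W - th])) ((4 * j + 1) * u) (site W r s j)) :
    Wall W r s u (th :: (X ++ [W - th])) ∧ ∀ x ∈ X, th ≤ x ∧ x ≤ W - th := by
  have hp := List.isChain_iff_pairwise.1 hX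
  rw [List.pairwise_cons, List.pairwise_append] at hp
  obtain ⟨h1, -, -, h2⟩ := hp
  have hw : th < W - th := h1 _ (by simp)
  have hm : ∀ x ∈ X, th ≤ x ∧ x ≤ W - th := fun x hx =>
    ⟨(h1 x (by simp [hx])).le, (h2 x hx _ (by simp)).le⟩
  refine ⟨⟨hX, fun z hz => ?_, hc⟩, hm⟩
  have := th_pos
  rcases List.mem_cons.1 hz with rfl | hz
  · constructor <;> linarith
  · rcases List.mem_append.1 hz with hz | hz
    · have := hm z hz
      constructor <;> linarith
    · simp only [List.mem_singleton] at hz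
      rw [hz]
      constructor <;> linarith

lemma isRotation_right (W : ℝ) : IsRotation fun p => (W - p.2, p.1) := by
  intro a b c d
  simp only [det2, dot2, Prod.fst_sub, Prod.snd_sub]
  constructor <;> ring

lemma isReflection_up (H : ℝ) : IsReflection fun p => (p.1, H - p.2) := by
  intro a b c d
  simp only [det2, dot2, Prod.fst_sub, Prod.snd_sub]
  constructor <;> ring

lemma isReflection_swap : IsReflection Prod.swap := by
  intro a b c d
  simp only [det2, dot2, Prod.fst_sub, Prod.snd_sub, Prod.fst_swap, Prod.snd_swap]
  constructor <;> ring

lemma fills_box {x₁ x₂ y₁ y₂ : ℝ} (hx : x₁ < x₂) (hy : y₁ < y₂) : Fills Good 1 fun f =>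
    f (x₁, y₁) (x₂, y₁) + f (x₂, y₁) (x₂, y₂) + f (x₂, y₂) (x₁, y₂) + f (x₁, y₂) (x₁, y₁) := by
  refine Fills.single ?_
  have key : NiceTurn (x₂ - x₁, 0) (0, y₂ - y₁) :=
    niceTurn_flat (by linarith) (by linarith) (by nlinarith)
  refine good_mk ?_ ?_ ?_ ?_ <;> simpa using key

lemma wall_first {W a b l r : ℝ} (hW : 1 / 2 ≤ W) : wall W a b l r th = (a, l) := by
  have : hat (W - th) = 0 := hat_eq_zero (by have : th = 1 / 10000 := rfl; linarith)
  simp [wall, this, hat_th]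

lemma wall_last {W a b l r : ℝ} (hW : 1 / 2 ≤ W) : wall W a b l r (W - th) = (b, r) := by
  have : hat (W - th) = 0 := hat_eq_zero (by have : th = 1 / 10000 := rfl; linarith)
  simp [wall, this, hat_th]

/-- Comparison of two descriptions of a wall. -/
lemma wall_path_eq {W a b l r : ℝ} (hW : 1 / 2 ≤ W) {X : List ℝ}
    (hX : ∀ x ∈ X, th ≤ x ∧ x ≤ W - th) (ψ : ℝ × ℝ → ℝ × ℝ) {g : ℝ → ℝ × ℝ}
    (h : ∀ x, th ≤ x ∧ x ≤ W - th → g x = ψ (wall W a b l r x)) :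
    (th :: (X ++ [W - th])).map g = ((a, l) :: (X.map (wall W a b l r) ++ [(b, r)])).map ψ := by
  have : th = 1 / 10000 := rfl
  simp only [List.map_cons, List.map_append, List.map_map, List.map_nil]
  rw [h th ⟨le_rfl, by linarith⟩, h (W - th) ⟨by linarith, le_rfl⟩, wall_first hW, wall_last hW,
    List.map_congr_left fun x hx => h x (hX x hx)]
  rfl

section Warp

variable {W H b₁ b₂ t₁ t₂ l₁ l₂ r₁ r₂ : ℝ}

/-- The map of the model for given first and last marks on the sides. -/
noncomputable def cornerWarp (W H b₁ b₂ t₁ t₂ l₁ l₂ r₁ r₂ : ℝ) : ℝ × ℝ → ℝ × ℝ :=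
  warp W H (b₁ - th, l₁ - th) (b₂ - (W - th), r₁ - th) (t₁ - th, l₂ - (H - th))
    (t₂ - (W - th), r₂ - (H - th))

lemma chat_far {W : ℝ} (hW : 1 / 2 ≤ W) : chat (W - th) = 0 :=
  chat_eq_zero (by have : th = 1 / 10000 := rfl; linarith)

/-- The warp of the straight model wall is the actual wall of the strip, so strip and grid share
their edges. The other three sides are described by the same `wall` after a reflection or rotation.
-/
lemma cornerWarp_bottom (hH : 1 / 2 ≤ H) {x : ℝ} (hx : th ≤ x ∧ x ≤ W - th) :
    cornerWarp W H b₁ b₂ t₁ t₂ l₁ l₂ r₁ r₂ (x, th) = wall W b₁ b₂ l₁ r₁ x := by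
  simp only [cornerWarp, warp, bump, chat_th, chat_far hH, wall, chat_eq_hat hx.1,
    chat_eq_hat (show th ≤ W - x by linarith [hx.2])]
  ext <;> simp <;> ring

lemma cornerWarp_top (hH : 1 / 2 ≤ H) {x : ℝ} (hx : th ≤ x ∧ x ≤ W - th) :
    cornerWarp W H b₁ b₂ t₁ t₂ l₁ l₂ r₁ r₂ (x, H - th) =
      ((wall W t₁ t₂ (H - l₂) (H - r₂) x).1, H - (wall W t₁ t₂ (H - l₂) (H - r₂) x).2) := by
  simp only [cornerWarp, warp, bump, sub_sub_cancel, chat_th, chat_far hH, wall, chat_eq_hat hx.1,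
    chat_eq_hat (show th ≤ W - x by linarith [hx.2])]
  ext <;> simp <;> ring

lemma cornerWarp_left (hW : 1 / 2 ≤ W) {y : ℝ} (hy : th ≤ y ∧ y ≤ H - th) :
    cornerWarp W H b₁ b₂ t₁ t₂ l₁ l₂ r₁ r₂ (th, y) = (wall H l₁ l₂ b₁ t₁ y).swap := by
  simp only [cornerWarp, warp, bump, chat_th, chat_far hW, wall, chat_eq_hat hy.1,
    chat_eq_hat (show th ≤ H - y by linarith [hy.2])]
  ext <;> simp <;> ring

lemma cornerWarp_right (hW : 1 / 2 ≤ W) {y : ℝ} (hy : th ≤ y ∧ y ≤ H - th) :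
    cornerWarp W H b₁ b₂ t₁ t₂ l₁ l₂ r₁ r₂ (W - th, y) =
      (W - (wall H r₁ r₂ (W - b₂) (W - t₂) y).2, (wall H r₁ r₂ (W - b₂) (W - t₂) y).1) := by
  simp only [cornerWarp, warp, bump, sub_sub_cancel, chat_th, chat_far hW, wall, chat_eq_hat hy.1,
    chat_eq_hat (show th ≤ H - y by linarith [hy.2])]
  ext <;> simp <;> ring

end Warp

lemma length_le {n m c u e : ℕ} (h : n = m + 4 * u * (2 * c + 1) + 2 * e)
    (h' : m + 2 * e ≤ 4 * u + 7) : n + 1 ≤ (8 * c + 8) * (u + 1) := by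
  have e1 : 4 * u * (2 * c + 1) = 8 * (c * u) + 4 * u := by ring
  have e2 : (8 * c + 8) * (u + 1) = 8 * (c * u) + 8 * c + 8 * u + 8 := by ring
  omega

lemma count_le {b t l r p q : ℕ} (hb : b + 1 ≤ p) (ht : t + 1 ≤ p) (hl : l + 1 ≤ q)
    (hr : r + 1 ≤ q) : 4 * ((b + 1) * (r + 1)) + 4 + 2 * (b + 1) + 2 * (t + 1) + 2 * (l + 1) +
      2 * (r + 1) + 1 + 1 + 1 + 1 ≤ 20 * (p * q) := by
  have k5 := Nat.mul_le_mul hb hr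
  have k6 := Nat.le_mul_of_pos_right p (show 0 < q by omega)
  have k7 := Nat.le_mul_of_pos_left q (show 0 < p by omega)
  omega

set_option maxHeartbeats 1000000 in
/-- A marked rectangle with an even number of marks can be filled. -/
theorem fills_rectangle {W H : ℝ} {c c' : ℕ} {B R T L : List ℝ} (hW : 1 / 2 ≤ W) (hH : 1 / 2 ≤ H)
    (hWc : 1 / 8 ≤ W / ((2 * c + 1 : ℕ) + 1)) (hHc : 1 / 8 ≤ H / ((2 * c' + 1 : ℕ) + 1))
    (hWH : W / ((2 * c + 1 : ℕ) + 1) ≤ H / 4) (hHW : H / ((2 * c' + 1 : ℕ) + 1) ≤ W / 4)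
    (hB : Marked W (2 * c + 1) (7 * th) B) (hT : Marked W (2 * c + 1) 0 T)
    (hL : Marked H (2 * c' + 1) 0 L) (hR : Marked H (2 * c' + 1) (26 * th) R)
    (hev : Even (B.length + T.length + (L.length + R.length))) :
    Fills Good (20 * (((8 * c + 8) * (B.length + T.length)) *
      ((8 * c' + 8) * (L.length + R.length)))) (boundarySum W H B R T L) := by
  have hth : th = 1 / 10000 := rfl
  obtain ⟨b₁, b₂, mB, rfl, hb₁, hb₁', hb₂, hb₂', SB⟩ := exists_strip_of_marked hB (by omega) hWc
    (by rw [hth]; norm_num) (by rw [hth]; norm_num)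
  obtain ⟨t₁, t₂, mT, rfl, ht₁, ht₁', ht₂, ht₂', ST⟩ := exists_strip_of_marked hT (by omega) hWc
    le_rfl (by rw [hth]; norm_num)
  obtain ⟨l₁, l₂, mL, rfl, hl₁, hl₁', hl₂, hl₂', SL⟩ := exists_strip_of_marked hL (by omega) hHc
    le_rfl (by rw [hth]; norm_num)
  obtain ⟨r₁, r₂, mR, rfl, hr₁, hr₁', hr₂, hr₂', SR⟩ := exists_strip_of_marked hR (by omega) hHc
    (by rw [hth]; norm_num) (by rw [hth]; norm_num)
  clear hB hT hL hR
  rw [Nat.even_iff] at hev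
  simp only [List.length_append, List.length_cons, List.length_nil] at hev ⊢
  -- The total is even, so both pairs of opposite sides have the same parity defect.
  obtain ⟨δ, hδ, hδV, hδH⟩ : ∃ δ ≤ 1, (mB.length + mT.length + δ) % 2 = 0 ∧
      (mR.length + mL.length + δ) % 2 = 0 :=
    ⟨(mB.length + mT.length) % 2, by omega, by omega, by omega⟩
  obtain ⟨eB, eT, heV, heB, heT⟩ := exists_equalizer _ _ _ hδV
  obtain ⟨eR, eL, heH, heR, heL⟩ := exists_equalizer _ _ _ hδH
  -- Opposite sides must use the same `u`, since it determines the controlled indices.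
  obtain ⟨u, hu⟩ : ∃ u, u = mB.length + mT.length + 3 := ⟨_, rfl⟩
  obtain ⟨v, hv⟩ : ∃ v, v = mL.length + mR.length + 3 := ⟨_, rfl⟩
  obtain ⟨XB, lB, chB, ctB, sB⟩ := SB u eB (by omega) l₁ r₁ hl₁ hl₁' hr₁ hr₁'
  obtain ⟨XT, lT, chT, ctT, sT⟩ := ST u eT (by omega) (H - l₂) (H - r₂) (by linarith) (by linarith)
    (by linarith) (by linarith)
  obtain ⟨XL, lL, chL, ctL, sL⟩ := SL v eL (by omega) b₁ t₁ hb₁ hb₁' ht₁ ht₁'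
  obtain ⟨XR, lR, chR, ctR, sR⟩ := SR v eR (by omega) (W - b₂) (W - t₂) (by linarith) (by linarith)
    (by linarith) (by linarith)
  clear SB ST SL SR
  obtain ⟨wB, memB⟩ := wall_of_strip chB ctB
  obtain ⟨wT, memT⟩ := wall_of_strip chT ctT
  obtain ⟨wL, memL⟩ := wall_of_strip chL ctL
  obtain ⟨wR, memR⟩ := wall_of_strip chR ctR
  let φ := cornerWarp W H b₁ b₂ t₁ t₂ l₁ l₂ r₁ r₂
  have hφ : NearId φ := by
    apply warp_nearId <;> constructor <;> rw [abs_le] <;> constructor <;> dsimp only <;> linarith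
  have inner := Fills.map φ (fills_inner hφ.hasVertical hφ.hasHorizontal (W := W) (H := H)
    (fun q hq hG => by
      have : (fun i => φ (q i)) = q := funext fun i => warp_eq_self (hq i)
      rw [this]; exact hG) hW hH hWH hHW (by omega) (by omega) wB wT wL wR hδ
      (by rw [lB, lT]; omega) (by rw [lR, lL]; omega))
  have bottom := sB
  have top := (isReflection_up H).fills sT
  have left := isReflection_swap.fills sL
  have right := (isRotation_right W).fills sR
  have c00 := fills_box hb₁ hl₁
  have c10 := fills_box hb₂' hr₁
  have c01 := fills_box ht₁ hl₂'
  have c11 := fills_box ht₂' hr₂'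
  -- The inner grids, four strips and four corner boxes; the sum of their boundaries is verified
  -- below as an identity of paths.
  refine ((((((((inner.add bottom).add top).add left).add right).add c00).add c10).add c01).add
    c11).mono ?_ fun f hf => ?_
  · rw [show mB.length + (0 + 1) + 1 + (mT.length + (0 + 1) + 1) = u + 1 by omega,
      show mL.length + (0 + 1) + 1 + (mR.length + (0 + 1) + 1) = v + 1 by omega]
    exact count_le (length_le lB (by omega)) (length_le lT (by omega)) (length_le lL (by omega))
      (length_le lR (by omega))
  · have ends : ∀ (g : ℝ → ℝ × ℝ) (a b t : ℝ) (m : List ℝ),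
        pathSum f ((full t (a :: (m ++ [b]))).map g) = f (g 0) (g a) +
          pathSum f ((a :: (m ++ [b])).map g) + f (g b) (g t) := by
      intro g a b t m
      have := pathSum_append f ((0 :: a :: m).map g) [g t] (g b)
      simp only [full]
      simp at this ⊢
      linarith
    have wB := congrArg (pathSum f) (wall_path_eq hW memB id fun x hx =>
      cornerWarp_bottom (b₁ := b₁) (b₂ := b₂) (t₁ := t₁) (t₂ := t₂) (l₁ := l₁) (l₂ := l₂)
      (r₁ := r₁) (r₂ := r₂) hH hx)
    have wT := congrArg (pathSum f) (wall_path_eq hW memT (fun p => (p.1, H - p.2)) fun x hx =>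
      cornerWarp_top (b₁ := b₁) (b₂ := b₂) (t₁ := t₁) (t₂ := t₂) (l₁ := l₁) (l₂ := l₂)
      (r₁ := r₁) (r₂ := r₂) hH hx)
    have wL := congrArg (pathSum f) (wall_path_eq hH memL Prod.swap fun x hx =>
      cornerWarp_left (b₁ := b₁) (b₂ := b₂) (t₁ := t₁) (t₂ := t₂) (l₁ := l₁) (l₂ := l₂)
      (r₁ := r₁) (r₂ := r₂) hW hx)
    have wR := congrArg (pathSum f) (wall_path_eq hH memR (fun p => (W - p.2, p.1)) fun x hx =>
      cornerWarp_right (b₁ := b₁) (b₂ := b₂) (t₁ := t₁) (t₂ := t₂) (l₁ := l₁) (l₂ := l₂)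
      (r₁ := r₁) (r₂ := r₂) hW hx)
    simp only [boundarySum]
    rw [ends, ends, ends, ends]
    have c₁ : ∀ l : List (ℝ × ℝ), pathSum (fun x y => f (φ x) (φ y)) l = pathSum f (l.map φ) :=
      fun l => (pathSum_map f φ l).symm
    have c₂ : ∀ l : List (ℝ × ℝ), pathSum (fun x y => f (x.1, H - x.2) (y.1, H - y.2)) l =
      pathSum f (l.map fun p => (p.1, H - p.2)) := fun l => (pathSum_map f _ l).symm
    have c₃ : ∀ l : List (ℝ × ℝ), pathSum (fun x y => f x.swap y.swap) l = pathSum f (l.map Prod.swap) :=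
      fun l => (pathSum_map f _ l).symm
    have c₄ : ∀ l : List (ℝ × ℝ), pathSum (fun x y => f (W - x.2, x.1) (W - y.2, y.1)) l =
      pathSum f (l.map fun p => (W - p.2, p.1)) := fun l => (pathSum_map f _ l).symm
    rw [c₁, c₁, c₁, c₁, c₂, c₂, c₃, c₃, c₄, c₄]
    simp only [id, φ, List.map_cons, List.map_append, List.map_map, List.map_nil, Function.comp_def,
      Prod.swap_prod_mk, sub_zero, sub_sub_cancel] at wB wT wL wR ⊢
    clear inner bottom top left right c00 c10 c01 c11 c₁ c₂ c₃ c₄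
    have h₁ := hf (b₁, 0) (b₁, l₁)
    have h₂ := hf (b₁, l₁) (0, l₁)
    have h₃ := hf (0, 0) (0, l₁)
    have h₄ := hf (b₂, 0) (b₂, r₁)
    have h₅ := hf (b₂, r₁) (W, r₁)
    have h₆ := hf (0, l₂) (t₁, l₂)
    have h₇ := hf (t₁, l₂) (t₁, H)
    have h₈ := hf (t₁, H) (0, H)
    have h₉ := hf (0, l₂) (0, H)
    have h₁₀ := hf (t₂, r₂) (W, r₂)
    have h₁₁ := hf (t₂, H) (W, H)
    have h₁₂ := hf (t₂, r₂) (t₂, H)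
    have h₁₃ := hf (0, H) (t₁, H)
    clear hf ends
    linarith

/-! ### Chains of rectangles -/

/-- The special marks on a side, in order. -/
noncomputable def specials (W : ℝ) (r : ℕ) (s : ℝ) : List ℝ :=
  th :: ((List.range r).map (site W r s) ++ [site W r s (r - 1) + 3 * th, W - th])

lemma length_specials (W : ℝ) (r : ℕ) (s : ℝ) : (specials W r s).length = r + 3 := by
  simp [specials]

lemma marked_of_specials {W s : ℝ} {r : ℕ} {M : List ℝ}
    (hM : (0 :: (M ++ [W])).IsChain (· < ·)) (h : ∀ x ∈ specials W r s, x ∈ M) :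
    Marked W r s M :=
  ⟨hM, h _ (by simp [specials]), h _ (by simp [specials]),
    fun j hj => h _ (by
      simp only [specials, List.mem_cons, List.mem_append, List.mem_map, List.mem_range]
      exact Or.inr (Or.inl ⟨j, hj, rfl⟩)),
    h _ (by simp [specials])⟩

lemma site_last {W s : ℝ} {r : ℕ} (hr : 0 < r) :
    site W r s (r - 1) = s + W - W / (r + 1) := by
  have : ((r - 1 : ℕ) : ℝ) + 1 = r := by
    rw [Nat.cast_sub (by omega : 1 ≤ r)]; simp
  have hr1 : (0 : ℝ) < r + 1 := by positivity
  simp only [site, this]; field_simp; ring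

lemma specials_chain {W s : ℝ} {r : ℕ} (hr : 0 < r) (hW : 1 / 8 ≤ W / (r + 1)) (hs : 0 ≤ s)
    (hs' : s ≤ 30 * th) : (0 :: (specials W r s ++ [W])).IsChain (· < ·) := by
  have hth : th = 1 / 10000 := rfl
  have hlast := site_last (W := W) (s := s) hr
  have hmono : ∀ i j, i < j → site W r s i < site W r s j := by
    intro i j hij
    have : (i : ℝ) < j := by exact_mod_cast hij
    have h0 : 0 < W / (r + 1) := by linarith
    simp only [site]
    have := mul_lt_mul_of_pos_right this h0
    linarith
  have h1 : ((List.range r).map (site W r s)).Pairwise (· < ·) := by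
    rw [List.pairwise_map]
    exact List.pairwise_lt_range.imp fun h => hmono _ _ h
  have h2 : ∀ x ∈ (List.range r).map (site W r s), th < x ∧ x ≤ site W r s (r - 1) := by
    intro x hx
    obtain ⟨j, hj, rfl⟩ := List.mem_map.1 hx
    rw [List.mem_range] at hj
    constructor
    · have h0 : 0 ≤ (j : ℝ) * (W / (r + 1)) := by positivity
      simp only [site]; rw [hth]; linarith
    · rcases (show j ≤ r - 1 by omega).eq_or_lt with h | h
      · rw [h]
      · exact (hmono _ _ h).le
  rw [List.isChain_iff_pairwise]
  simp only [specials, List.cons_append, List.append_assoc, List.pairwise_cons,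
    List.pairwise_append, List.nil_append, List.mem_append, List.mem_cons, List.not_mem_nil,
    or_false]
  have k1 : site W r s (r - 1) + 3 * th < W - th := by rw [hlast]; linarith
  have k2 : th < site W r s (r - 1) := (h2 _ (List.mem_map.2 ⟨r - 1, by simp; omega, rfl⟩)).1
  have k0 := th_pos
  refine ⟨?_, ?_, h1, ⟨?_, ?_, ?_, List.Pairwise.nil⟩, ?_⟩
  · rintro x (rfl | hx | rfl | rfl | rfl)
    · exact k0
    · linarith [(h2 x hx).1]
    all_goals linarith
  · rintro x (hx | rfl | rfl | rfl)
    · exact (h2 x hx).1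
    all_goals linarith
  · rintro x (rfl | rfl) <;> linarith
  · rintro x rfl; linarith
  · rintro x ⟨⟩
  · rintro x hx y (rfl | rfl | rfl) <;> linarith [(h2 x hx).2]

lemma length_le_of_subset {M M' : List ℝ} (hM : M.IsChain (· < ·)) (h : ∀ x ∈ M, x ∈ M') :
    M.length ≤ M'.length := by
  have : M.Nodup := (List.isChain_iff_pairwise.1 hM).imp fun h => h.ne
  exact (this.subperm h).length_le

lemma isChain_inner {a b : ℝ} {M : List ℝ} (h : (a :: (M ++ [b])).IsChain (· < ·)) :
    M.IsChain (· < ·) := by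
  rw [List.isChain_iff_pairwise] at h ⊢
  exact h.sublist (by simp)

lemma Marked.le_length {W s : ℝ} {r : ℕ} {M : List ℝ} (h : Marked W r s M) (hr : 0 < r)
    (hW : 1 / 8 ≤ W / (r + 1)) (hs : 0 ≤ s) (hs' : s ≤ 30 * th) : r + 3 ≤ M.length := by
  rw [← length_specials W r s]
  refine length_le_of_subset (isChain_inner (specials_chain hr hW hs hs')) fun x hx => ?_
  simp only [specials, List.mem_cons, List.mem_append, List.mem_map, List.mem_range,
    List.not_mem_nil, or_false] at hx
  rcases hx with rfl | ⟨j, hj, rfl⟩ | rfl | rfl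
  exacts [h.first, h.sites j hj, h.double, h.last]

/-- The marks on the long side of a row of `k + 1` rectangles of width `w`. -/
structure Chained (k : ℕ) (w s : ℝ) (B : List ℝ) : Prop where
  chain : (0 :: (B ++ [(k + 1) * w])).IsChain (· < ·)
  special : ∀ i < k + 1, ∀ x ∈ specials w 3 s, x + i * w ∈ B
  joint : ∀ i < k, (i + 1) * w ∈ B

lemma Chained.marked {w s : ℝ} {B : List ℝ} (h : Chained 0 w s B) : Marked w 3 s B := by
  refine marked_of_specials (by simpa using h.chain) fun x hx => ?_
  simpa using h.special 0 (by omega) x hx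

/-- The row is cut at its first joint, and the remaining marks are translated back to the origin. -/
lemma Chained.split {k : ℕ} {w s : ℝ} {B : List ℝ} (hw : 1 / 2 ≤ w) (hs : 0 ≤ s)
    (hs' : s ≤ 30 * th) (h : Chained (k + 1) w s B) :
    ∃ B₀ B₁, B = B₀ ++ w :: B₁.map (· + w) ∧ Marked w 3 s B₀ ∧ Chained k w s B₁ := by
  have hsp := List.isChain_iff_pairwise.1
    (specials_chain (W := w) (r := 3) (by norm_num) (by norm_num; linarith) hs hs')
  rw [List.pairwise_cons, List.pairwise_append] at hsp
  have hsp0 : ∀ x ∈ specials w 3 s, 0 < x := fun x hx => hsp.1 x (by simp [hx])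
  have hspw : ∀ x ∈ specials w 3 s, x < w := fun x hx => hsp.2.2.2 x hx w (by simp)
  have hwB : w ∈ B := by simpa using h.joint 0 (by omega)
  obtain ⟨B₀, B₂, rfl⟩ := List.append_of_mem hwB
  have hch := h.chain
  rw [List.append_assoc, List.cons_append, ← List.cons_append, List.isChain_split] at hch
  obtain ⟨hc1, hc2⟩ := hch
  have p1 := List.isChain_iff_pairwise.1 hc1
  have p2 := List.isChain_iff_pairwise.1 hc2
  rw [List.cons_append, List.pairwise_cons, List.pairwise_append] at p1
  rw [List.pairwise_cons] at p2
  have q1 : ∀ x ∈ B₀, x < w := fun x hx => p1.2.2.2 x hx w (by simp)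
  have q2 : ∀ x ∈ B₂, w < x := fun x hx => p2.1 x (by simp [hx])
  have mem0 : ∀ x ∈ B₀ ++ w :: B₂, x < w → x ∈ B₀ := by
    intro x hx hxw
    simp only [List.mem_append, List.mem_cons] at hx
    rcases hx with hx | rfl | hx
    · exact hx
    · exact absurd hxw (lt_irrefl _)
    · exact absurd hxw (q2 x hx).not_gt
  have mem1 : ∀ x, x + w ∈ B₀ ++ w :: B₂ → 0 < x → x ∈ B₂.map (· - w) := by
    intro x hx hxw
    simp only [List.mem_append, List.mem_cons] at hx
    rcases hx with hx | hx | hx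
    · linarith [q1 _ hx]
    · linarith
    · exact List.mem_map.2 ⟨x + w, hx, by ring⟩
  refine ⟨B₀, B₂.map (· - w), by simp [Function.comp_def], ?_, ?_, ?_, ?_⟩
  · refine marked_of_specials hc1 fun x hx => mem0 _ ?_ (hspw x hx)
    simpa using h.special 0 (by omega) x hx
  · have : ((w :: (B₂ ++ [((k + 1 : ℕ) + 1) * w])).map (· - w)).IsChain (· < ·) := by
      rw [List.isChain_map]
      exact hc2.imp fun _ _ h => by linarith
    have e : (((k + 1 : ℕ) : ℝ) + 1) * w - w = (k + 1) * w := by push_cast; ring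
    rw [List.map_cons, List.map_append, List.map_singleton, sub_self, e] at this
    exact this
  · intro i hi x hx
    refine mem1 _ ?_ (by have := hsp0 x hx; positivity)
    have := h.special (i + 1) (by omega) x hx
    push_cast at this
    convert this using 1; ring
  · intro i hi
    refine mem1 _ ?_ (by positivity)
    have := h.joint (i + 1) (by omega)
    push_cast at this
    convert this using 1; ring

lemma Chained.le_length {k : ℕ} {w s : ℝ} {B : List ℝ} (hw : 1 / 2 ≤ w) (hs : 0 ≤ s)
    (hs' : s ≤ 30 * th) (h : Chained k w s B) : 7 * k + 6 ≤ B.length := by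
  induction k generalizing B with
  | zero => exact h.marked.le_length (by norm_num) (by norm_num; linarith) hs hs'
  | succ k ih =>
    obtain ⟨B₀, B₁, rfl, h0, h1⟩ := h.split hw hs hs'
    have := ih h1
    have := h0.le_length (by norm_num) (by norm_num; linarith) hs hs'
    simp; omega

/-- The marks on a joint of two rectangles, with prescribed parity. -/
lemma exists_joint (p : ℕ) : ∃ J : List ℝ, Marked 1 7 0 J ∧ Marked 1 7 (26 * th) J ∧
    J.length ≤ 21 ∧ (J.length + p) % 2 = 0 := by
  have hth : th = 1 / 10000 := rfl
  have c1 := specials_chain (W := 1) (r := 7) (s := 0) (by norm_num) (by norm_num) le_rfl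
    (by rw [hth]; norm_num)
  have c2 := specials_chain (W := 1) (r := 7) (s := 26 * th) (by norm_num) (by norm_num)
    (by rw [hth]; norm_num) (by rw [hth]; norm_num)
  have mem : ∀ {s : ℝ}, (0 :: (specials 1 7 s ++ [1])).IsChain (· < ·) →
      ∀ x ∈ specials 1 7 s, 0 < x ∧ x < 1 := by
    intro s hs x hx
    have := List.isChain_iff_pairwise.1 hs
    rw [List.pairwise_cons, List.pairwise_append] at this
    exact ⟨this.1 x (by simp [hx]), this.2.2.2 x hx 1 (by simp)⟩
  let F : Finset ℝ := (specials 1 7 0 ++ specials 1 7 (26 * th)).toFinset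
  have hF : F.card ≤ 20 := by
    refine (List.toFinset_card_le _).trans ?_
    simp [length_specials]
  have key : ∀ F' : Finset ℝ, F ⊆ F' → (∀ x ∈ F', 0 < x ∧ x < 1) →
      Marked 1 7 0 (F'.sort (· ≤ ·)) ∧ Marked 1 7 (26 * th) (F'.sort (· ≤ ·)) := by
    intro F' hF' h01
    have hc : (0 :: (F'.sort (· ≤ ·) ++ [(1 : ℝ)])).IsChain (· < ·) := by
      rw [List.isChain_iff_pairwise, List.pairwise_cons, List.pairwise_append]
      refine ⟨fun x hx => ?_, Finset.sortedLT_sort _ |>.pairwise, by simp, fun x hx y hy => ?_⟩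
      · simp only [List.mem_append, Finset.mem_sort, List.mem_singleton] at hx
        rcases hx with hx | rfl
        · exact (h01 x hx).1
        · norm_num
      · simp only [Finset.mem_sort, List.mem_singleton] at hx hy
        rw [hy]; exact (h01 x hx).2
    exact ⟨marked_of_specials hc fun x hx => by
        rw [Finset.mem_sort]; exact hF' (by simp [F, hx]),
      marked_of_specials hc fun x hx => by
        rw [Finset.mem_sort]; exact hF' (by simp [F, hx])⟩
  have hF01 : ∀ x ∈ F, 0 < x ∧ x < 1 := by
    intro x hx
    simp only [F, List.mem_toFinset, List.mem_append] at hx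
    exact hx.elim (mem c1 x) (mem c2 x)
  -- A wrong parity is repaired by one more mark at an arbitrary new place.
  by_cases hp : (F.card + p) % 2 = 0
  · obtain ⟨k1, k2⟩ := key F subset_rfl hF01
    exact ⟨_, k1, k2, by simp; omega, by simpa using hp⟩
  · obtain ⟨y, hy, hyF⟩ := (Set.Ioo_infinite (zero_lt_one' ℝ)).exists_notMem_finset F
    obtain ⟨k1, k2⟩ := key (insert y F) (Finset.subset_insert _ _) (by
      intro x hx
      rcases Finset.mem_insert.1 hx with rfl | hx
      · exact hy
      · exact hF01 x hx)
    refine ⟨_, k1, k2, ?_, ?_⟩ <;> rw [Finset.length_sort, Finset.card_insert_of_notMem hyF] <;>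
      omega

/-- The common side with the marks `J` is traversed twice, in opposite directions, and cancels. -/
lemma boundarySum_append {f : ℝ × ℝ → ℝ × ℝ → ℝ} (w W H : ℝ) (B₀ B₁ T₀ T₁ L J R : List ℝ) :
    boundarySum (w + W) H (B₀ ++ w :: B₁.map (· + w)) R (T₀ ++ w :: T₁.map (· + w)) L f =
      boundarySum w H B₀ J T₀ L f +
        boundarySum W H B₁ R T₁ J fun x y => f (x.1 + w, x.2) (y.1 + w, y.2) := by
  have e : ∀ (y : ℝ) (B₀ B₁ : List ℝ),
      pathSum f ((full (w + W) (B₀ ++ w :: B₁.map (· + w))).map fun x => (x, y)) =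
      pathSum f ((full w B₀).map fun x => (x, y)) +
        pathSum (fun x y => f (x.1 + w, x.2) (y.1 + w, y.2)) ((full W B₁).map fun x => (x, y)) := by
    intro y B₀ B₁
    rw [← pathSum_map f (fun x : ℝ × ℝ => (x.1 + w, x.2))]
    have := pathSum_append f ((0 :: B₀).map fun x => (x, y))
      ((B₁.map (· + w) ++ [w + W]).map fun x => (x, y)) (w, y)
    simp only [full]
    simp [Function.comp_def, add_comm] at this ⊢
    linarith
  have e' : ∀ (y : ℝ) (B : List ℝ),
      pathSum (fun x y => f (x.1 + w, x.2) (y.1 + w, y.2)) (B.map fun x => (y, x)) =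
        pathSum f (B.map fun x => (y + w, x)) := by
    intro y B
    rw [← pathSum_map f (fun x : ℝ × ℝ => (x.1 + w, x.2)), List.map_map]
    rfl
  simp only [boundarySum, e, e', zero_add]
  rw [add_comm W w]
  ring

lemma isRotation_shift (w : ℝ) : IsRotation fun p => (p.1 + w, p.2) := by
  intro a b c d
  simp only [det2, dot2, Prod.fst_sub, Prod.snd_sub]
  constructor <;> ring

/-- A row of rectangles with an even number of marks on its boundary can be filled. -/
theorem fills_chain {w : ℝ} (hw : 1 / 2 ≤ w) (hw' : w ≤ 1) {R : List ℝ}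
    (hR : Marked 1 7 (26 * th) R) (k : ℕ) : ∀ {B T L : List ℝ} {m n : ℕ},
    Chained k w (7 * th) B → Chained k w 0 T → Marked 1 7 0 L →
    Even (B.length + T.length + (L.length + R.length)) →
    B.length + T.length ≤ 14 * k + 12 + m → L.length ≤ 21 + n →
    Fills Good (10240 * ((n + R.length) * (m + 12) + 42 * (m + 12 * (k + 1))))
      (boundarySum ((k + 1) * w) 1 B R T L) := by
  have hth : th = 1 / 10000 := rfl
  -- For `1 / 2 ≤ w ≤ 1` and height `1`, three sites on the horizontal and seven on the vertical
  -- sides satisfy the conditions on the slopes; the factors `16` and `32` are `8 * c + 8` and `8 *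
  -- c' + 8`.
  have box : ∀ {B T L R : List ℝ}, Marked w 3 (7 * th) B → Marked w 3 0 T → Marked 1 7 0 L →
      Marked 1 7 (26 * th) R → Even (B.length + T.length + (L.length + R.length)) →
      Fills Good (20 * ((16 * (B.length + T.length)) * (32 * (L.length + R.length))))
        (boundarySum w 1 B R T L) := by
    intro B T L R hB hT hL hR hev
    exact fills_rectangle (c := 1) (c' := 3) hw (by norm_num) (by norm_num; linarith)
      (by norm_num) (by norm_num; linarith) (by norm_num; linarith) hB hT hL hR hev
  induction k with
  | zero =>
    intro B T L m n hB hT hL hev h1 h2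
    have := box hB.marked hT.marked hL hR hev
    simp only [Nat.cast_zero, zero_add, one_mul]
    refine this.mono ?_ fun f _ => rfl
    have := Nat.mul_le_mul (show B.length + T.length ≤ m + 12 by omega)
      (show L.length + R.length ≤ n + R.length + 21 by omega)
    nlinarith
  | succ k ih =>
    intro B T L m n hB hT hL hev h1 h2
    have t7 : 0 ≤ 7 * th := by rw [hth]; norm_num
    have t7' : 7 * th ≤ 30 * th := by rw [hth]; norm_num
    have t0' : 0 ≤ 30 * th := by rw [hth]; norm_num
    obtain ⟨B₀, B₁, rfl, hB₀, hB₁⟩ := hB.split hw t7 t7'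
    obtain ⟨T₀, T₁, rfl, hT₀, hT₁⟩ := hT.split hw le_rfl t0'
    -- The joint is a right side for the first box and a left side for the rest, so it carries the
    -- special marks of both. Its parity makes the first box even; since the whole row is even and
    -- `J` is counted twice, the rest is even too.
    obtain ⟨J, hJ, hJ', hJl, hJp⟩ := exists_joint (B₀.length + T₀.length + L.length)
    have l1 := hB₁.le_length hw t7 t7'
    have l2 := hT₁.le_length hw le_rfl t0'
    rw [Nat.even_iff] at hev
    simp only [List.length_append, List.length_cons, List.length_map] at hev h1
    have f1 := box hB₀ hT₀ hL hJ' (by rw [Nat.even_iff]; omega)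
    obtain ⟨m', hm'⟩ : ∃ m', B₁.length + T₁.length = 14 * k + 12 + m' :=
      ⟨B₁.length + T₁.length - (14 * k + 12), by omega⟩
    -- The left side of the rest is a joint with at most `21` marks: no excess `n` remains.
    have f2 := (isRotation_shift w).fills (ih (m := m') (n := 0) hB₁ hT₁ hJ
      (by rw [Nat.even_iff]; omega) hm'.le (by omega))
    refine (f1.add f2).mono ?_ fun f _ => ?_
    · have q1 : B₀.length + T₀.length + m' ≤ m + 12 := by omega
      have q2 : L.length + J.length ≤ n + 42 := by omega
      obtain ⟨b, hb⟩ : ∃ b, b = B₀.length + T₀.length := ⟨_, rfl⟩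
      rw [← hb] at q1 ⊢
      have q3 := Nat.mul_le_mul (le_refl b) q2
      have q4 : 12 ≤ b := by
        have := hB₀.le_length (by norm_num) (by norm_num; linarith) t7 t7'
        have := hT₀.le_length (by norm_num) (by norm_num; linarith) le_rfl t0'
        omega
      have q5 := Nat.mul_le_mul_right n (show b ≤ m + 12 by omega)
      have q6 := Nat.mul_le_mul_left R.length (show m' + 12 ≤ m + 12 by omega)
      rw [show 20 * (16 * b * (32 * (L.length + J.length))) = 10240 * (b * (L.length + J.length)) by
        ring, ← Nat.mul_add]
      refine Nat.mul_le_mul_left _ ?_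
      generalize R.length = r at *
      generalize b * (L.length + J.length) = z at *
      linarith
    · have e : (((k + 1 : ℕ) : ℝ) + 1) * w = w + (k + 1) * w := by push_cast; ring
      rw [e, boundarySum_append (J := J)]

/-! ### Added vertices in the frame of a rectangle -/

/-- The points of `S` at height `y`. -/
noncomputable def row (S : Finset (ℝ × ℝ)) (y : ℝ) : Finset ℝ :=
  (S.filter fun p => p.2 = y).image Prod.fst

/-- The points of `S` above `x`. -/
noncomputable def col (S : Finset (ℝ × ℝ)) (x : ℝ) : Finset ℝ :=
  (S.filter fun p => p.1 = x).image Prod.snd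

lemma mem_row {S : Finset (ℝ × ℝ)} {x y : ℝ} : x ∈ row S y ↔ (x, y) ∈ S := by
  simp [row]

lemma mem_col {S : Finset (ℝ × ℝ)} {x y : ℝ} : y ∈ col S x ↔ (x, y) ∈ S := by
  simp [col]

lemma card_row (S : Finset (ℝ × ℝ)) (y : ℝ) : (row S y).card = (S.filter fun p => p.2 = y).card := by
  refine Finset.card_image_of_injOn fun p hp q hq h => ?_
  simp only [Finset.coe_filter, Set.mem_ofPred_eq] at hp hq
  exact Prod.ext h (hp.2.trans hq.2.symm)

lemma card_col (S : Finset (ℝ × ℝ)) (x : ℝ) : (col S x).card = (S.filter fun p => p.1 = x).card := by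
  refine Finset.card_image_of_injOn fun p hp q hq h => ?_
  simp only [Finset.coe_filter, Set.mem_ofPred_eq] at hp hq
  exact Prod.ext (hp.2.trans hq.2.symm) h

/-- All points lie on the open sides of the rectangle. -/
def OnSides (W H : ℝ) (S : Finset (ℝ × ℝ)) : Prop :=
  ∀ p ∈ S, ((0 < p.1 ∧ p.1 < W) ∧ (p.2 = 0 ∨ p.2 = H)) ∨ ((0 < p.2 ∧ p.2 < H) ∧ (p.1 = 0 ∨ p.1 = W))

lemma OnSides.row_mem {W H : ℝ} {S : Finset (ℝ × ℝ)} (hS : OnSides W H S) {x y : ℝ}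
    (hy : y = 0 ∨ y = H) (hx : x ∈ row S y) : 0 < x ∧ x < W := by
  rcases hS _ (mem_row.1 hx) with h | h
  · exact h.1
  · rcases hy with rfl | rfl
    · exact absurd h.1.1 (lt_irrefl _)
    · exact absurd h.1.2 (lt_irrefl _)

lemma OnSides.col_mem {W H : ℝ} {S : Finset (ℝ × ℝ)} (hS : OnSides W H S) {x y : ℝ}
    (hx : x = 0 ∨ x = W) (hy : y ∈ col S x) : 0 < y ∧ y < H := by
  rcases hS _ (mem_col.1 hy) with h | h
  · rcases hx with rfl | rfl
    · exact absurd h.1.1 (lt_irrefl _)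
    · exact absurd h.1.2 (lt_irrefl _)
  · exact h.1

lemma card_row_add_card_row {H : ℝ} (hH : 0 < H) (S : Finset (ℝ × ℝ)) :
    (row S 0).card + (row S H).card = (S.filter fun p => p.2 = 0 ∨ p.2 = H).card := by
  rw [card_row, card_row, Finset.filter_or, Finset.card_union_of_disjoint]
  rw [Finset.disjoint_filter]
  rintro p - h1 h2
  linarith

lemma card_col_add_card_col {W : ℝ} (hW : 0 < W) (S : Finset (ℝ × ℝ)) :
    (col S 0).card + (col S W).card = (S.filter fun p => p.1 = 0 ∨ p.1 = W).card := by
  rw [card_col, card_col, Finset.filter_or, Finset.card_union_of_disjoint]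
  rw [Finset.disjoint_filter]
  rintro p - h1 h2
  linarith

lemma OnSides.card {W H : ℝ} (hW : 0 < W) (hH : 0 < H) {S : Finset (ℝ × ℝ)}
    (hS : OnSides W H S) : (row S 0).card + (row S H).card +
      ((col S 0).card + (col S W).card) = S.card := by
  rw [card_row_add_card_row hH, card_col_add_card_col hW,
    ← Finset.card_filter_add_card_filter_not (s := S) fun p => p.2 = 0 ∨ p.2 = H]
  congr 2
  refine Finset.filter_congr fun p hp => ?_
  constructor
  · intro h h'
    rcases hS p hp with ⟨h1, -⟩ | ⟨h1, -⟩
    · rcases h with h | h <;> linarith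
    · rcases h' with h' | h' <;> linarith
  · intro h
    exact (hS p hp).elim (fun h' => absurd h'.2 h) fun h' => h'.2

/-- The points on the boundary of a rectangle with given coordinates on the four sides. -/
noncomputable def sidePoints (W H : ℝ) (b d t l : Finset ℝ) : Finset (ℝ × ℝ) :=
  b.image (fun x => (x, 0)) ∪ d.image (fun y => (W, y)) ∪
    t.image (fun x => (x, H)) ∪ l.image fun y => (0, y)

lemma mem_sidePoints {W H : ℝ} {b d t l : Finset ℝ} {p : ℝ × ℝ} :
    p ∈ sidePoints W H b d t l ↔ ((p.1 ∈ b ∧ p.2 = 0) ∨ (p.1 ∈ t ∧ p.2 = H)) ∨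
      ((p.2 ∈ l ∧ p.1 = 0) ∨ (p.2 ∈ d ∧ p.1 = W)) := by
  obtain ⟨x, y⟩ := p
  simp only [sidePoints, Finset.mem_union, Finset.mem_image, Prod.mk.injEq]
  constructor
  · rintro (((⟨a, h, rfl, rfl⟩ | ⟨a, h, rfl, rfl⟩) | ⟨a, h, rfl, rfl⟩) | ⟨a, h, rfl, rfl⟩) <;>
      simp [h]
  · rintro ((⟨h, rfl⟩ | ⟨h, rfl⟩) | (⟨h, rfl⟩ | ⟨h, rfl⟩)) <;> simp [h]

lemma isChain_full_sort {W : ℝ} (hW : 0 < W) {F : Finset ℝ} (h : ∀ x ∈ F, 0 < x ∧ x < W) :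
    (full W (F.sort (· ≤ ·))).IsChain (· < ·) := by
  rw [full, List.isChain_iff_pairwise, List.pairwise_cons, List.pairwise_append]
  refine ⟨fun x hx => ?_, Finset.sortedLT_sort _ |>.pairwise, by simp, fun x hx y hy => ?_⟩
  · simp only [List.mem_append, Finset.mem_sort, List.mem_singleton] at hx
    rcases hx with hx | rfl
    · exact (h x hx).1
    · exact hW
  · simp only [Finset.mem_sort, List.mem_singleton] at hx hy
    rw [hy]; exact (h x hx).2

section sidePoints

variable {W H : ℝ} {b d t l : Finset ℝ}

lemma onSides_sidePoints (hb : ∀ x ∈ b, 0 < x ∧ x < W) (hd : ∀ x ∈ d, 0 < x ∧ x < H)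
    (ht : ∀ x ∈ t, 0 < x ∧ x < W) (hl : ∀ x ∈ l, 0 < x ∧ x < H) :
    OnSides W H (sidePoints W H b d t l) := by
  intro p hp
  rcases mem_sidePoints.1 hp with (⟨h, h'⟩ | ⟨h, h'⟩) | (⟨h, h'⟩ | ⟨h, h'⟩)
  · exact Or.inl ⟨hb _ h, Or.inl h'⟩
  · exact Or.inl ⟨ht _ h, Or.inr h'⟩
  · exact Or.inr ⟨hl _ h, Or.inl h'⟩
  · exact Or.inr ⟨hd _ h, Or.inr h'⟩

lemma row_zero_sidePoints (hd : ∀ x ∈ d, 0 < x ∧ x < H)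
    (hl : ∀ x ∈ l, 0 < x ∧ x < H) (hH : 0 < H) : row (sidePoints W H b d t l) 0 = b := by
  ext x
  rw [mem_row, mem_sidePoints]
  constructor
  · rintro ((⟨h, -⟩ | ⟨-, h⟩) | (⟨h, -⟩ | ⟨h, -⟩))
    · exact h
    · exact absurd h hH.ne
    · exact absurd (hl _ h).1 (lt_irrefl _)
    · exact absurd (hd _ h).1 (lt_irrefl _)
  · exact fun h => Or.inl (Or.inl ⟨h, rfl⟩)

lemma row_sidePoints (hd : ∀ x ∈ d, 0 < x ∧ x < H)
    (hl : ∀ x ∈ l, 0 < x ∧ x < H) (hH : 0 < H) : row (sidePoints W H b d t l) H = t := by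
  ext x
  rw [mem_row, mem_sidePoints]
  constructor
  · rintro ((⟨-, h⟩ | ⟨h, -⟩) | (⟨h, -⟩ | ⟨h, -⟩))
    · exact absurd h hH.ne'
    · exact h
    · exact absurd (hl _ h).2 (lt_irrefl _)
    · exact absurd (hd _ h).2 (lt_irrefl _)
  · exact fun h => Or.inl (Or.inr ⟨h, rfl⟩)

lemma col_zero_sidePoints (hb : ∀ x ∈ b, 0 < x ∧ x < W)
    (ht : ∀ x ∈ t, 0 < x ∧ x < W) (hW : 0 < W) : col (sidePoints W H b d t l) 0 = l := by
  ext x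
  rw [mem_col, mem_sidePoints]
  constructor
  · rintro ((⟨h, -⟩ | ⟨h, -⟩) | (⟨h, -⟩ | ⟨-, h⟩))
    · exact absurd (hb _ h).1 (lt_irrefl _)
    · exact absurd (ht _ h).1 (lt_irrefl _)
    · exact h
    · exact absurd h hW.ne
  · exact fun h => Or.inr (Or.inl ⟨h, rfl⟩)

lemma col_sidePoints (hb : ∀ x ∈ b, 0 < x ∧ x < W)
    (ht : ∀ x ∈ t, 0 < x ∧ x < W) (hW : 0 < W) : col (sidePoints W H b d t l) W = d := by
  ext x
  rw [mem_col, mem_sidePoints]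
  constructor
  · rintro ((⟨h, -⟩ | ⟨h, -⟩) | (⟨-, h⟩ | ⟨h, -⟩))
    · exact absurd (hb _ h).2 (lt_irrefl _)
    · exact absurd (ht _ h).2 (lt_irrefl _)
    · exact absurd h hW.ne'
    · exact h
  · exact fun h => Or.inr (Or.inr ⟨h, rfl⟩)

end sidePoints

/-! ### Passing from vertices in the plane to marks in the frame and back. -/

namespace Rectangle

variable (R : Rectangle) {W H : ℝ} (hW : 0 < W) (hH : 0 < H)

include hW hH

lemma frame_corners : R.frame W H (0, 0) = R.corner 0 ∧ R.frame W H (W, 0) = R.corner 1 ∧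
    R.frame W H (W, H) = R.corner 2 ∧ R.frame W H (0, H) = R.corner 3 := by
  simp [frame_apply, hW.ne', hH.ne', R.corner_two]

lemma range_corner :
    Set.range R.corner = R.frame W H '' {p | (p.1 = 0 ∨ p.1 = W) ∧ (p.2 = 0 ∨ p.2 = H)} := by
  obtain ⟨h0, h1, h2, h3⟩ := R.frame_corners hW hH
  ext x
  constructor
  · rintro ⟨i, rfl⟩
    fin_cases i
    · exact ⟨_, by simp, h0⟩
    · exact ⟨_, by simp, h1⟩
    · exact ⟨_, by simp, h2⟩
    · exact ⟨_, by simp, h3⟩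
  · rintro ⟨⟨x, y⟩, ⟨(h | h), (h' | h')⟩, rfl⟩ <;> dsimp only at h h' <;> rw [h, h']
    · exact ⟨0, h0.symm⟩
    · exact ⟨3, h3.symm⟩
    · exact ⟨1, h1.symm⟩
    · exact ⟨2, h2.symm⟩

lemma openEdges_eq : R.toPolygon.openEdges = R.frame W H ''
    {p | ((0 < p.1 ∧ p.1 < W) ∧ (p.2 = 0 ∨ p.2 = H)) ∨
      ((0 < p.2 ∧ p.2 < H) ∧ (p.1 = 0 ∨ p.1 = W))} := by
  have hv : R.toPolygon.vertices = Set.range R.corner := rfl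
  rw [SimplePolygon.openEdges, hv, R.carrier_eq hW hH, R.range_corner hW hH,
    ← Set.image_sdiff (R.frame_injective hW hH)]
  congr 1
  ext ⟨x, y⟩
  simp only [closedRect, openRect, Set.mem_sdiff, Set.mem_ofPred_eq]
  constructor
  · rintro ⟨⟨⟨h1, h2, h3, h4⟩, h5⟩, h6⟩
    rcases h1.eq_or_lt' with rfl | h1
    · refine Or.inr ⟨⟨h3.lt_of_ne' fun h => h6 (by simp [h]), h4.lt_of_ne fun h => h6 (by simp [h])⟩,
        by simp⟩
    rcases h2.eq_or_lt with rfl | h2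
    · refine Or.inr ⟨⟨h3.lt_of_ne' fun h => h6 (by simp [h]), h4.lt_of_ne fun h => h6 (by simp [h])⟩,
        by simp⟩
    refine Or.inl ⟨⟨h1, h2⟩, ?_⟩
    by_contra! h
    exact h5 ⟨h1, h2, h3.lt_of_ne' h.1, h4.lt_of_ne h.2⟩
  · rintro (⟨⟨h1, h2⟩, (rfl | rfl)⟩ | ⟨⟨h1, h2⟩, (rfl | rfl)⟩) <;>
      refine ⟨⟨⟨?_, ?_, ?_, ?_⟩, ?_⟩, ?_⟩ <;> first
        | linarith
        | (intro h; rcases h with ⟨h3 | h3, h4 | h4⟩ <;> linarith)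
        | (intro h; linarith [h.1, h.2.1, h.2.2.1, h.2.2.2])

lemma frame_mem_sides₁ {p : ℝ × ℝ} (h0 : 0 ≤ p.1) (h1 : p.1 ≤ W) (h : p.2 = 0 ∨ p.2 = H) :
    R.frame W H p ∈ R.sides₁ := by
  have e : ∀ y, p.2 = y → p ∈ segment ℝ ((0 : ℝ), y) (W, y) := by
    rintro y rfl
    refine ⟨1 - p.1 / W, p.1 / W, ?_, by positivity, by ring, ?_⟩
    · rw [sub_nonneg, div_le_one hW]; exact h1
    · ext
      · simp; field_simp
      · simp; ring
  obtain ⟨c0, c1, c2, c3⟩ := R.frame_corners hW hH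
  rcases h with h | h
  · left
    rw [← c0, ← c1, ← image_segment]
    exact ⟨p, e _ h, rfl⟩
  · right
    rw [← c2, ← c3, ← image_segment, segment_symm]
    exact ⟨p, e _ h, rfl⟩

lemma frame_mem_sides₂ {p : ℝ × ℝ} (h0 : 0 ≤ p.2) (h1 : p.2 ≤ H) (h : p.1 = 0 ∨ p.1 = W) :
    R.frame W H p ∈ R.sides₂ := by
  have e : ∀ x, p.1 = x → p ∈ segment ℝ (x, (0 : ℝ)) (x, H) := by
    rintro x rfl
    refine ⟨1 - p.2 / H, p.2 / H, ?_, by positivity, by ring, ?_⟩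
    · rw [sub_nonneg, div_le_one hH]; exact h1
    · ext
      · simp; ring
      · simp; field_simp
  obtain ⟨c0, c1, c2, c3⟩ := R.frame_corners hW hH
  rcases h with h | h
  · right
    rw [← c3, ← c0, ← image_segment, segment_symm]
    exact ⟨p, e _ h, rfl⟩
  · left
    rw [← c1, ← c2, ← image_segment]
    exact ⟨p, e _ h, rfl⟩

/-- The added vertices in the frame of the rectangle. -/
lemma exists_pullback {A : Finset Plane} (hA : (A : Set Plane) ⊆ R.toPolygon.openEdges) :
    ∃ A₀ : Finset (ℝ × ℝ), R.frame W H '' A₀ = A ∧ OnSides W H A₀ ∧ A₀.card = A.card ∧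
      (row A₀ 0).card + (row A₀ H).card ≤ ((A : Set Plane) ∩ R.sides₁).ncard ∧
      (col A₀ 0).card + (col A₀ W).card ≤ ((A : Set Plane) ∩ R.sides₂).ncard := by
  classical
  have inj := R.frame_injective hW hH
  have him : R.frame W H '' (A.preimage (R.frame W H) inj.injOn) = A := by
    rw [Finset.coe_preimage]
    exact Set.image_preimage_eq _ (R.frame_surjective hW hH)
  have hon : OnSides W H (A.preimage (R.frame W H) inj.injOn) := by
    intro p hp
    have h1 := hA (Finset.mem_coe.2 (Finset.mem_preimage.1 hp))
    rw [R.openEdges_eq hW hH] at h1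
    obtain ⟨q, hq, hqp⟩ := h1
    rw [← inj hqp]; exact hq
  have count : ∀ (Q : ℝ × ℝ → Prop) [DecidablePred Q] (U : Set Plane),
      (∀ p ∈ A.preimage (R.frame W H) inj.injOn, Q p → R.frame W H p ∈ U) →
      ((A.preimage (R.frame W H) inj.injOn).filter Q).card ≤ ((A : Set Plane) ∩ U).ncard := by
    intro Q _ U hQ
    rw [← Finset.card_image_of_injective _ inj, ← Set.ncard_coe_finset]
    refine Set.ncard_le_ncard ?_ (A.finite_toSet.inter_of_left _)
    intro x hx
    simp only [Finset.coe_image, Finset.coe_filter, Set.mem_image, Set.mem_ofPred_eq] at hx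
    obtain ⟨p, ⟨hp, hp'⟩, rfl⟩ := hx
    exact ⟨Finset.mem_preimage.1 hp, hQ p hp hp'⟩
  refine ⟨A.preimage (R.frame W H) inj.injOn, him, hon, ?_, ?_, ?_⟩
  · rw [← Set.ncard_coe_finset, ← Set.ncard_image_of_injective _ inj, him, Set.ncard_coe_finset]
  · rw [card_row_add_card_row hH]
    refine count _ _ fun p hp h => R.frame_mem_sides₁ hW hH ?_ ?_ h
    · rcases hon p hp with ⟨h', -⟩ | ⟨-, h' | h'⟩ <;> linarith
    · rcases hon p hp with ⟨h', -⟩ | ⟨-, h' | h'⟩ <;> linarith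
  · rw [card_col_add_card_col hW]
    refine count _ _ fun p hp h => R.frame_mem_sides₂ hW hH ?_ ?_ h
    · rcases hon p hp with ⟨-, h' | h'⟩ | ⟨h', -⟩ <;> linarith
    · rcases hon p hp with ⟨-, h' | h'⟩ | ⟨h', -⟩ <;> linarith

variable (hsim : inner ℝ (R.corner 1 - R.corner 0) (R.corner 1 - R.corner 0) * H ^ 2 =
  inner ℝ (R.corner 3 - R.corner 0) (R.corner 3 - R.corner 0) * W ^ 2)

include hsim

/-- Marks that make every even extension fillable give a sink. -/
theorem exists_addVertices_niceMesh {b d t l : Finset ℝ}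
    (hb : ∀ x ∈ b, 0 < x ∧ x < W) (hd : ∀ x ∈ d, 0 < x ∧ x < H)
    (ht : ∀ x ∈ t, 0 < x ∧ x < W) (hl : ∀ x ∈ l, 0 < x ∧ x < H)
    (hev : Even (b.card + t.card + (l.card + d.card))) {N : ℕ → ℕ → ℕ}
    (hfill : ∀ b' d' t' l' : Finset ℝ, b ⊆ b' → d ⊆ d' → t ⊆ t' → l ⊆ l' →
      (full W (b'.sort (· ≤ ·))).IsChain (· < ·) → (full H (d'.sort (· ≤ ·))).IsChain (· < ·) →
      (full W (t'.sort (· ≤ ·))).IsChain (· < ·) → (full H (l'.sort (· ≤ ·))).IsChain (· < ·) →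
      Even (b'.card + t'.card + (l'.card + d'.card)) → ∀ m n : ℕ,
      b'.card + t'.card ≤ b.card + t.card + m → l'.card + d'.card ≤ l.card + d.card + n →
      Fills Good (N m n) (boundarySum W H (b'.sort (· ≤ ·)) (d'.sort (· ≤ ·))
        (t'.sort (· ≤ ·)) (l'.sort (· ≤ ·)))) :
    ∃ (B : Finset Plane) (hB : (B : Set Plane) ⊆ R.toPolygon.openEdges),
      B.card = b.card + t.card + (l.card + d.card) ∧
      ∀ (A : Finset Plane) (hA : (A : Set Plane) ⊆ (R.toPolygon.addVertices B hB).openEdges)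
        (m n : ℕ), Even A.card → ((A : Set Plane) ∩ R.sides₁).ncard ≤ m →
        ((A : Set Plane) ∩ R.sides₂).ncard ≤ n →
        ∃ T, IsNiceMeshExtending T ((R.toPolygon.addVertices B hB).addVertices A hA) ∧
          T.card ≤ N m n := by
  classical
  have inj := R.frame_injective hW hH
  set B₀ := sidePoints W H b d t l with hB₀
  have hon := onSides_sidePoints hb hd ht hl
  have hcard := hon.card hW hH
  rw [row_zero_sidePoints hd hl hH, row_sidePoints hd hl hH,
    col_zero_sidePoints hb ht hW, col_sidePoints hb ht hW] at hcard
  have hB : ((B₀.image (R.frame W H) : Finset Plane) : Set Plane) ⊆ R.toPolygon.openEdges := by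
    rw [R.openEdges_eq hW hH, Finset.coe_image]
    exact Set.image_mono fun p hp => hon p hp
  refine ⟨B₀.image (R.frame W H), hB, ?_, ?_⟩
  · rw [Finset.card_image_of_injective _ inj, hcard]
  intro A hA m n hAev hm hn
  have hA' : (A : Set Plane) ⊆ R.toPolygon.openEdges := fun x hx =>
    ⟨(hA hx).1, fun h => (hA hx).2 (Or.inl h)⟩
  obtain ⟨A₀, him, hAon, hAcard, hA1, hA2⟩ := R.exists_pullback hW hH hA'
  -- New vertices lie on open edges of the extended polygon, so the numbers of marks add up and
  -- evenness is preserved.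
  have hdisj : Disjoint B₀ A₀ := by
    rw [Finset.disjoint_left]
    intro p hp hp'
    have h1 : R.frame W H p ∈ (A : Set Plane) := by rw [← him]; exact ⟨p, hp', rfl⟩
    exact (hA h1).2 (Or.inr (by rw [Finset.coe_image]; exact ⟨p, hp, rfl⟩))
  have hS : OnSides W H (B₀ ∪ A₀) := fun p hp =>
    (Finset.mem_union.1 hp).elim (hon p) (hAon p)
  have hSc := hS.card hW hH
  rw [Finset.card_union_of_disjoint hdisj, ← hcard, hAcard] at hSc
  have hrow : ∀ y, row (B₀ ∪ A₀) y = row B₀ y ∪ row A₀ y := by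
    intro y; ext x; simp [mem_row]
  have hcol : ∀ y, col (B₀ ∪ A₀) y = col B₀ y ∪ col A₀ y := by
    intro y; ext x; simp [mem_col]
  have r0 := hrow 0
  have rH := hrow H
  have c0 := hcol 0
  have cW := hcol W
  rw [hB₀, row_zero_sidePoints hd hl hH, ← hB₀] at r0
  rw [hB₀, row_sidePoints hd hl hH, ← hB₀] at rH
  rw [hB₀, col_zero_sidePoints hb ht hW, ← hB₀] at c0
  rw [hB₀, col_sidePoints hb ht hW, ← hB₀] at cW
  have r0' := Finset.card_union_le b (row A₀ 0)
  have rH' := Finset.card_union_le t (row A₀ H)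
  have c0' := Finset.card_union_le l (col A₀ 0)
  have cW' := Finset.card_union_le d (col A₀ W)
  rw [← r0] at r0'
  rw [← rH] at rH'
  rw [← c0] at c0'
  rw [← cW] at cW'
  have k1 := isChain_full_sort hW fun x hx => hS.row_mem (Or.inl rfl) hx
  have k2 := isChain_full_sort hH fun x hx => hS.col_mem (Or.inr rfl) hx
  have k3 := isChain_full_sort hW fun x hx => hS.row_mem (Or.inr rfl) hx
  have k4 := isChain_full_sort hH fun x hx => hS.col_mem (Or.inl rfl) hx
  refine R.exists_niceMesh_of_fills hW hH hsim
    (P := (R.toPolygon.addVertices (B₀.image (R.frame W H)) hB).addVertices A hA) rfl k1 k2 k3 k4 ?_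
    (hfill _ _ _ _ (r0 ▸ Finset.subset_union_left) (cW ▸ Finset.subset_union_left)
      (rH ▸ Finset.subset_union_left) (c0 ▸ Finset.subset_union_left) k1 k2 k3 k4
      (hSc ▸ hev.add hAev) m n (by omega) (by omega))
  have hv : ((R.toPolygon.addVertices (B₀.image (R.frame W H)) hB).addVertices A hA).vertices =
      (Set.range R.corner ∪ ((B₀.image (R.frame W H) : Finset Plane) : Set Plane)) ∪ A := rfl
  rw [hv, R.range_corner hW hH, Finset.coe_image, ← him, ← Set.image_union, ← Set.image_union]
  congr 1
  ext ⟨x, y⟩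
  rw [Set.mem_ofPred_eq, exists_boundaryEdge_iff k1 k2 k3 k4]
  simp only [full, List.mem_cons, List.mem_append, Finset.mem_sort, List.not_mem_nil, or_false,
    mem_row, mem_col, Set.mem_union, Set.mem_ofPred_eq, Finset.mem_coe]
  rw [or_assoc, ← Finset.mem_union]
  clear_value B₀
  generalize B₀ ∪ A₀ = S at hS ⊢
  clear * - hS
  constructor
  · rintro (⟨hx, hy⟩ | h)
    · rcases hy with rfl | rfl
      · exact Or.inl ⟨hx.imp_right Or.inr, rfl⟩
      · exact Or.inr (Or.inr (Or.inl ⟨hx.imp_right Or.inr, rfl⟩))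
    · rcases hS _ h with ⟨-, h' | h'⟩ | ⟨-, h' | h'⟩ <;> dsimp only at h' <;> subst h' <;> simp [h]
  · rintro (⟨hx, rfl⟩ | ⟨rfl, hx⟩ | ⟨hx, rfl⟩ | ⟨rfl, hx⟩) <;> rcases hx with rfl | hx | rfl <;>
      simp [*]

end Rectangle

/-! ### Square and rectangular sinks -/

lemma card_specials {W s : ℝ} {r : ℕ} (hr : 0 < r) (hW : 1 / 8 ≤ W / (r + 1)) (hs : 0 ≤ s)
    (hs' : s ≤ 30 * th) : (specials W r s).toFinset.card = r + 3 := by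
  rw [List.toFinset_card_of_nodup, length_specials]
  exact (List.isChain_iff_pairwise.1 (isChain_inner (specials_chain hr hW hs hs'))).imp
    fun h => h.ne

lemma specials_mem {W s : ℝ} {r : ℕ} (hr : 0 < r) (hW : 1 / 8 ≤ W / (r + 1)) (hs : 0 ≤ s)
    (hs' : s ≤ 30 * th) {x : ℝ} (hx : x ∈ specials W r s) : 0 < x ∧ x < W := by
  have := List.isChain_iff_pairwise.1 (specials_chain hr hW hs hs')
  rw [List.pairwise_cons, List.pairwise_append] at this
  exact ⟨this.1 x (by simp [hx]), this.2.2.2 x hx W (by simp)⟩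

lemma marked_sort {W s : ℝ} {r : ℕ} {F : Finset ℝ} (h : (specials W r s).toFinset ⊆ F)
    (hF : (full W (F.sort (· ≤ ·))).IsChain (· < ·)) : Marked W r s (F.sort (· ≤ ·)) :=
  marked_of_specials hF fun x hx => (Finset.mem_sort _).2 (h (by simpa using hx))

/-- The special marks on the long side of a row of `k + 1` rectangles of width `w`. -/
noncomputable def rowSpecials (k : ℕ) (w s : ℝ) : Finset ℝ :=
  ((Finset.range (k + 1)).biUnion fun i => (specials w 3 s).toFinset.image fun x => x + i * w) ∪
    (Finset.range k).image fun i : ℕ => ((i : ℝ) + 1) * w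

lemma rowSpecials_mem {k : ℕ} {w s : ℝ} (hw : 1 / 2 ≤ w) (hs : 0 ≤ s) (hs' : s ≤ 30 * th) {x : ℝ}
    (hx : x ∈ rowSpecials k w s) : 0 < x ∧ x < (k + 1) * w := by
  have hw0 : 0 < w := by linarith
  simp only [rowSpecials, Finset.mem_union, Finset.mem_biUnion, Finset.mem_image, Finset.mem_range,
    List.mem_toFinset] at hx
  rcases hx with ⟨i, hi, y, hy, rfl⟩ | ⟨i, hi, rfl⟩
  · obtain ⟨h1, h2⟩ := specials_mem (by norm_num) (by norm_num; linarith) hs hs' hy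
    have hi' : (i : ℝ) ≤ k := by exact_mod_cast Nat.lt_succ_iff.1 hi
    have := mul_le_mul_of_nonneg_right hi' hw0.le
    have h0 : 0 ≤ (i : ℝ) * w := by positivity
    exact ⟨by linarith, by linarith⟩
  · have hi' : (i : ℝ) < k := by exact_mod_cast hi
    exact ⟨by positivity, mul_lt_mul_of_pos_right (by linarith) hw0⟩

lemma chained_sort {k : ℕ} {w s : ℝ} {F : Finset ℝ} (h : rowSpecials k w s ⊆ F)
    (hF : (full ((k + 1) * w) (F.sort (· ≤ ·))).IsChain (· < ·)) :
    Chained k w s (F.sort (· ≤ ·)) := by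
  refine ⟨hF, fun i hi x hx => (Finset.mem_sort _).2 (h ?_),
    fun i hi => (Finset.mem_sort _).2 (h ?_)⟩
  · exact Finset.mem_union_left _ (Finset.mem_biUnion.2 ⟨i, Finset.mem_range.2 hi,
      Finset.mem_image.2 ⟨x, List.mem_toFinset.2 hx, rfl⟩⟩)
  · exact Finset.mem_union_right _ (Finset.mem_image.2 ⟨i, Finset.mem_range.2 hi, rfl⟩)

/-- The union bound gives one inequality; the other is `Chained.le_length`, applied to the sorted
marks themselves. -/
lemma card_rowSpecials {k : ℕ} {w s : ℝ} (hw : 1 / 2 ≤ w) (hs : 0 ≤ s) (hs' : s ≤ 30 * th) :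
    (rowSpecials k w s).card = 7 * k + 6 := by
  refine le_antisymm ?_ ?_
  · have h1 : ((Finset.range (k + 1)).biUnion fun i =>
        (specials w 3 s).toFinset.image fun x => x + i * w).card ≤ (Finset.range (k + 1)).card * 6 :=
      Finset.card_biUnion_le_card_mul _ _ _ fun i _ => Finset.card_image_le.trans
        (card_specials (by norm_num) (by norm_num; linarith) hs hs').le
    have h2 : ((Finset.range k).image fun i : ℕ => ((i : ℝ) + 1) * w).card ≤ (Finset.range k).card :=
      Finset.card_image_le
    rw [Finset.card_range] at h1 h2
    have := Finset.card_union_le ((Finset.range (k + 1)).biUnion fun i =>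
      (specials w 3 s).toFinset.image fun x => x + i * w)
      ((Finset.range k).image fun i : ℕ => ((i : ℝ) + 1) * w)
    rw [rowSpecials]
    omega
  · have hW : (0 : ℝ) < (k + 1) * w := by positivity
    simpa using (chained_sort subset_rfl
      (isChain_full_sort hW fun x hx => rowSpecials_mem hw hs hs' hx)).le_length hw hs hs'

/-! ### Numbers of marks and sizes of meshes for squares and rectangles. -/

namespace Rectangle

variable (R : Rectangle)

lemma dist_sides : dist (R.corner 1) (R.corner 2) = dist (R.corner 0) (R.corner 3) ∧
    dist (R.corner 2) (R.corner 3) = dist (R.corner 0) (R.corner 1) ∧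
    dist (R.corner 3) (R.corner 0) = dist (R.corner 0) (R.corner 3) := by
  refine ⟨?_, ?_, dist_comm _ _⟩
  · rw [dist_comm, dist_comm (R.corner 0), dist_eq_norm, dist_eq_norm, R.corner_two]
    congr 1; abel
  · rw [dist_comm (R.corner 0), dist_eq_norm, dist_eq_norm, R.parallelogram]

lemma dist_three_pos : 0 < dist (R.corner 0) (R.corner 3) := dist_pos.2 R.ne_three.symm

lemma eccentricity_eq (h : dist (R.corner 0) (R.corner 3) ≤ dist (R.corner 0) (R.corner 1)) :
    eccentricity R.corner = dist (R.corner 0) (R.corner 1) / dist (R.corner 0) (R.corner 3) := by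
  obtain ⟨h1, h2, h3⟩ := R.dist_sides
  have all : ∀ i, dist (R.corner i) (R.corner (i + 1)) = dist (R.corner 0) (R.corner 1) ∨
      dist (R.corner i) (R.corner (i + 1)) = dist (R.corner 0) (R.corner 3) := by
    intro i
    fin_cases i
    · exact Or.inl rfl
    · exact Or.inr h1
    · exact Or.inl h2
    · exact Or.inr h3
  rw [eccentricity]
  congr 1
  · refine le_antisymm (ciSup_le fun i => ?_) ?_
    · rcases all i with e | e <;> rw [e]
      exact h
    · exact le_ciSup (f := fun i => dist (R.corner i) (R.corner (i + 1)))
        (Set.finite_range _).bddAbove 0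
  · refine le_antisymm ?_ (le_ciInf fun i => ?_)
    · rw [← h1]
      exact ciInf_le (f := fun i => dist (R.corner i) (R.corner (i + 1)))
        (Set.finite_range _).bddBelow 1
    · rcases all i with e | e <;> rw [e]
      exact h

lemma inner_sides : inner ℝ (R.corner 1 - R.corner 0) (R.corner 1 - R.corner 0) =
      dist (R.corner 0) (R.corner 1) ^ 2 ∧
    inner ℝ (R.corner 3 - R.corner 0) (R.corner 3 - R.corner 0) =
      dist (R.corner 0) (R.corner 3) ^ 2 := by
  rw [real_inner_self_eq_norm_sq, real_inner_self_eq_norm_sq, dist_comm, dist_eq_norm,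
    dist_comm (R.corner 0), dist_eq_norm]
  exact ⟨rfl, rfl⟩

/-- Exactly 24 points on the sides of a square turn it into a sink. -/
theorem exists_square_sink (h : R.IsSquare) :
    ∃ (B : Finset Plane) (hB : (B : Set Plane) ⊆ R.toPolygon.openEdges), B.card = 24 ∧
      ∀ (A : Finset Plane) (hA : (A : Set Plane) ⊆ (R.toPolygon.addVertices B hB).openEdges)
        (m n : ℕ), 1 ≤ m → 1 ≤ n → Even A.card → ((A : Set Plane) ∩ R.sides₁).ncard ≤ m →
        ((A : Set Plane) ∩ R.sides₂).ncard ≤ n →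
        HasNiceMeshOfSize ((R.toPolygon.addVertices B hB).addVertices A hA)
          (865280 * ((m : ℝ) * n)) := by
  have hth : th = 1 / 10000 := rfl
  have hr : 0 < 3 := by norm_num
  have hW : (1 : ℝ) / 8 ≤ 1 / ((3 : ℕ) + 1) := by norm_num
  have t7 : 0 ≤ 7 * th := by rw [hth]; norm_num
  have t7' : 7 * th ≤ 30 * th := by rw [hth]; norm_num
  have t0 : 0 ≤ 30 * th := by rw [hth]; norm_num
  have t26 : 0 ≤ 26 * th := by rw [hth]; norm_num
  have t26' : 26 * th ≤ 30 * th := by rw [hth]; norm_num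
  have c7 := card_specials hr hW t7 t7'
  have c0 := card_specials hr hW le_rfl t0
  have c26 := card_specials hr hW t26 t26'
  obtain ⟨e1, e2⟩ := R.inner_sides
  obtain ⟨B, hB, hBc, hBA⟩ := R.exists_addVertices_niceMesh one_pos one_pos
    (by rw [e1, e2, show dist _ _ = dist _ _ from h])
    (fun x hx => specials_mem hr hW t7 t7' (List.mem_toFinset.1 hx))
    (fun x hx => specials_mem hr hW t26 t26' (List.mem_toFinset.1 hx))
    (fun x hx => specials_mem hr hW le_rfl t0 (List.mem_toFinset.1 hx))
    (fun x hx => specials_mem hr hW le_rfl t0 (List.mem_toFinset.1 hx))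
    (by rw [c7, c0, c26]; decide)
    (N := fun m n => 20 * ((16 * (12 + m)) * (16 * (12 + n))))
    (fun b d t l hb hd ht hl kb kd kt kl hev m n hm hn => by
      rw [c7, c0] at hm
      rw [c26, c0] at hn
      refine (fills_rectangle (c := 1) (c' := 1) (by norm_num) (by norm_num) (by norm_num)
        (by norm_num) (by norm_num) (by norm_num) (marked_sort hb kb) (marked_sort ht kt)
        (marked_sort hl kl) (marked_sort hd kd) (by simpa using hev)).mono ?_ fun f _ => rfl
      simp only [Finset.length_sort]
      gcongr)
  refine ⟨B, hB, by rw [hBc, c7, c0, c26], fun A hA m n hm hn hev h1 h2 => ?_⟩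
  obtain ⟨T, hT, hTc⟩ := hBA A hA m n hev h1 h2
  refine ⟨T, hT, ?_⟩
  -- `12 + m ≤ 13 * m` as `1 ≤ m`, and `865280 = 20 * 16 ^ 2 * 13 ^ 2`.
  have : 20 * ((16 * (12 + m)) * (16 * (12 + n))) ≤ 865280 * (m * n) := by
    calc 20 * ((16 * (12 + m)) * (16 * (12 + n)))
        ≤ 20 * ((16 * (13 * m)) * (16 * (13 * n))) := by gcongr <;> omega
      _ = 865280 * (m * n) := by ring
  exact_mod_cast hTc.trans this

/-- With the short side scaled to `1`, the rectangle is a row of `k + 1 = ⌈E⌉` boxes of width `w = E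
/ (k + 1)`, which is between `1 / 2` and `1`. The number of marks is `2 * (7 * k + 6) + 20`, at most
`28 * (k + 1)` because `E > 1` forces `1 ≤ k`. -/
lemma exists_sink_of_lt (h : dist (R.corner 0) (R.corner 3) < dist (R.corner 0) (R.corner 1)) :
    ∃ (B : Finset Plane) (hB : (B : Set Plane) ⊆ R.toPolygon.openEdges),
      (B.card : ℤ) ≤ 28 * ⌈eccentricity R.corner⌉ ∧
      ∀ (A : Finset Plane) (hA : (A : Set Plane) ⊆ (R.toPolygon.addVertices B hB).openEdges)
        (m n : ℕ), 1 ≤ m → 1 ≤ n → Even A.card → ((A : Set Plane) ∩ R.sides₁).ncard ≤ m →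
        ((A : Set Plane) ∩ R.sides₂).ncard ≤ n →
        HasNiceMeshOfSize ((R.toPolygon.addVertices B hB).addVertices A hA)
          (10321920 * (eccentricity R.corner + (m : ℝ) * n)) := by
  have hth : th = 1 / 10000 := rfl
  have hE := R.eccentricity_eq h.le
  obtain ⟨e1, e2⟩ := R.inner_sides
  have hsim : inner ℝ (R.corner 1 - R.corner 0) (R.corner 1 - R.corner 0) * (1 : ℝ) ^ 2 =
      inner ℝ (R.corner 3 - R.corner 0) (R.corner 3 - R.corner 0) *
        eccentricity R.corner ^ 2 := by
    have := R.dist_three_pos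
    rw [e1, e2, hE]; field_simp
  have hE1 : 1 < eccentricity R.corner := by rw [hE, one_lt_div R.dist_three_pos]; exact h
  generalize eccentricity R.corner = E at *
  obtain ⟨k, hk⟩ : ∃ k : ℕ, ⌈E⌉ = k + 1 := by
    have : 0 < ⌈E⌉ := Int.ceil_pos.2 (by linarith)
    exact ⟨(⌈E⌉ - 1).toNat, by omega⟩
  have hEk : E ≤ k + 1 := by
    have := Int.le_ceil E
    rw [hk] at this
    exact_mod_cast this
  have hkE : (k : ℝ) < E := by
    have := Int.ceil_lt_add_one E
    rw [hk] at this
    push_cast at this; linarith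
  have hk1 : 1 ≤ k := by
    have : (0 : ℝ) < k := by linarith
    exact_mod_cast this
  have hk1' : (1 : ℝ) ≤ k := by exact_mod_cast hk1
  have hk0 : (0 : ℝ) < k + 1 := by positivity
  obtain ⟨w, rfl⟩ : ∃ w, E = (k + 1) * w := ⟨E / (k + 1), by field_simp⟩
  have hw' : w ≤ 1 := by nlinarith
  have hw : 1 / 2 ≤ w := by nlinarith
  have hr : 0 < 7 := by norm_num
  have hW : (1 : ℝ) / 8 ≤ 1 / ((7 : ℕ) + 1) := by norm_num
  have t7 : 0 ≤ 7 * th := by rw [hth]; norm_num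
  have t7' : 7 * th ≤ 30 * th := by rw [hth]; norm_num
  have t0 : 0 ≤ 30 * th := by rw [hth]; norm_num
  have t26 : 0 ≤ 26 * th := by rw [hth]; norm_num
  have t26' : 26 * th ≤ 30 * th := by rw [hth]; norm_num
  have c0 := card_specials hr hW le_rfl t0
  have c26 := card_specials hr hW t26 t26'
  have r7 := card_rowSpecials (k := k) hw t7 t7'
  have r0 := card_rowSpecials (k := k) hw le_rfl t0
  obtain ⟨B, hB, hBc, hBA⟩ := R.exists_addVertices_niceMesh (by linarith) one_pos hsim
    (fun x hx => rowSpecials_mem hw t7 t7' hx)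
    (fun x hx => specials_mem hr hW t26 t26' (List.mem_toFinset.1 hx))
    (fun x hx => rowSpecials_mem hw le_rfl t0 hx)
    (fun x hx => specials_mem hr hW le_rfl t0 (List.mem_toFinset.1 hx))
    (by rw [r7, r0, c0, c26, Nat.even_iff]; omega)
    (N := fun m n => 10240 * ((n + (10 + n)) * (m + 12) + 42 * (m + 12 * (k + 1))))
    (fun b d t l hb hd ht hl kb kd kt kl hev m n hm hn => by
      rw [r7, r0] at hm
      rw [c26, c0] at hn
      have l1 := Finset.card_le_card hd
      have l2 := Finset.card_le_card hl
      rw [c26] at l1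
      rw [c0] at l2
      refine (fills_chain hw hw' (marked_sort hd kd) k (m := m) (n := n) (chained_sort hb kb)
        (chained_sort ht kt) (marked_sort hl kl) (by simpa using hev) ?_ ?_).mono ?_ fun f _ => rfl
      · simp only [Finset.length_sort]; omega
      · simp only [Finset.length_sort]; omega
      · simp only [Finset.length_sort]
        gcongr
        omega)
  refine ⟨B, hB, ?_, fun A hA m n hm hn hev h1 h2 => ?_⟩
  · rw [hBc, r7, r0, c0, c26, hk]
    push_cast; omega
  obtain ⟨T, hT, hTc⟩ := hBA A hA m n hev h1 h2
  refine ⟨T, hT, ?_⟩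
  have key : 10240 * ((n + (10 + n)) * (m + 12) + 42 * (m + 12 * (k + 1))) ≤
      10240 * (504 * (k + 1) + 198 * (m * n)) := by
    have q1 : (n + (10 + n)) * (m + 12) ≤ (12 * n) * (13 * m) := by gcongr <;> omega
    have q2 : m ≤ m * n := Nat.le_mul_of_pos_right m hn
    refine Nat.mul_le_mul_left _ ?_
    linarith
  have h3 : (T.card : ℝ) ≤ 10240 * (504 * (k + 1) + 198 * (m * n)) := by
    exact_mod_cast hTc.trans key
  have h4 : (0 : ℝ) ≤ m * n := by positivity
  -- `k + 1 < 2 * E`, and `10321920 = 2 * 10240 * 504`.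
  refine h3.trans ?_
  nlinarith

/-- The same rectangle with its corners listed in the other direction. -/
def swap : Rectangle where
  corner := ![R.corner 0, R.corner 3, R.corner 2, R.corner 1]
  ne_one := R.ne_three
  ne_three := R.ne_one
  parallelogram := by
    have := R.corner_two
    simp only [Matrix.cons_val]
    rw [this]; abel
  right_angle := by
    have := R.right_angle
    rw [real_inner_comm] at this
    exact this

lemma swap_sides₁ : R.swap.sides₁ = R.sides₂ := by
  simp only [sides₁, sides₂, swap, Matrix.cons_val]
  rw [Set.union_comm, segment_symm ℝ (R.corner 2), segment_symm ℝ (R.corner 0)]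

lemma swap_sides₂ : R.swap.sides₂ = R.sides₁ := by
  simp only [sides₁, sides₂, swap, Matrix.cons_val]
  rw [Set.union_comm, segment_symm ℝ (R.corner 1), segment_symm ℝ (R.corner 3)]

lemma polyCurve_corner : polyCurve (n := 1) R.corner = R.sides₁ ∪ R.sides₂ := by
  ext x
  simp only [polyCurve, Set.mem_iUnion, sides₁, sides₂, Set.mem_union]
  constructor
  · rintro ⟨i, hi⟩
    fin_cases i
    · exact Or.inl (Or.inl hi)
    · exact Or.inr (Or.inl hi)
    · exact Or.inl (Or.inr hi)
    · exact Or.inr (Or.inr hi)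
  · rintro ((h | h) | (h | h))
    exacts [⟨0, h⟩, ⟨2, h⟩, ⟨1, h⟩, ⟨3, h⟩]

lemma swap_toPolygon : R.swap.toPolygon = R.toPolygon := by
  have h1 : polyCurve (n := 1) R.swap.corner = polyCurve (n := 1) R.corner := by
    rw [polyCurve_corner, polyCurve_corner, swap_sides₁, swap_sides₂, Set.union_comm]
  have h2 : Set.range R.swap.corner = Set.range R.corner := by
    ext x
    constructor
    · rintro ⟨i, rfl⟩
      fin_cases i
      exacts [⟨0, rfl⟩, ⟨3, rfl⟩, ⟨2, rfl⟩, ⟨1, rfl⟩]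
    · rintro ⟨i, rfl⟩
      fin_cases i
      exacts [⟨0, rfl⟩, ⟨3, rfl⟩, ⟨2, rfl⟩, ⟨1, rfl⟩]
  simp only [toPolygon, h1, h2]

lemma swap_eccentricity : eccentricity R.swap.corner = eccentricity R.corner := by
  have h : ∀ i, dist (R.swap.corner i) (R.swap.corner (i + 1)) =
      dist (R.corner (Equiv.subLeft 3 i)) (R.corner (Equiv.subLeft 3 i + 1)) := by
    intro i
    fin_cases i <;> exact dist_comm _ _
  simp only [eccentricity, h]
  rw [(Equiv.subLeft (3 : Fin 4)).iSup_comp (g := fun i => dist (R.corner i) (R.corner (i + 1))),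
    (Equiv.subLeft (3 : Fin 4)).iInf_comp (g := fun i => dist (R.corner i) (R.corner (i + 1)))]

/-- Finitely many points on the sides of a rectangle turn it into a sink. -/
theorem exists_sink :
    ∃ (B : Finset Plane) (hB : (B : Set Plane) ⊆ R.toPolygon.openEdges),
      (B.card : ℤ) ≤ 28 * ⌈eccentricity R.corner⌉ ∧
      ∀ (A : Finset Plane) (hA : (A : Set Plane) ⊆ (R.toPolygon.addVertices B hB).openEdges)
        (m n : ℕ), 1 ≤ m → 1 ≤ n → Even A.card → ((A : Set Plane) ∩ R.sides₁).ncard ≤ m →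
        ((A : Set Plane) ∩ R.sides₂).ncard ≤ n →
        HasNiceMeshOfSize ((R.toPolygon.addVertices B hB).addVertices A hA)
          (10321920 * (eccentricity R.corner + (m : ℝ) * n)) := by
  rcases lt_trichotomy (dist (R.corner 0) (R.corner 3)) (dist (R.corner 0) (R.corner 1)) with
    h | h | h
  · exact R.exists_sink_of_lt h
  -- Squares are treated separately: a row of one box would need `32` marks, more than the `28`
  -- allowed.
  · have hE : eccentricity R.corner = 1 := by
      rw [R.eccentricity_eq h.le, ← h, div_self R.dist_three_pos.ne']
    obtain ⟨B, hB, hBc, hBA⟩ := R.exists_square_sink h.symm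
    refine ⟨B, hB, by rw [hBc, hE]; simp, fun A hA m n hm hn hev h1 h2 => ?_⟩
    obtain ⟨T, hT, hTc⟩ := hBA A hA m n hm hn hev h1 h2
    refine ⟨T, hT, hTc.trans ?_⟩
    have : (0 : ℝ) ≤ m * n := by positivity
    rw [hE]; linarith
  · have := R.swap.exists_sink_of_lt h
    rw [swap_toPolygon, swap_sides₁, swap_sides₂, swap_eccentricity] at this
    obtain ⟨B, hB, hBc, hBA⟩ := this
    refine ⟨B, hB, hBc, fun A hA m n hm hn hev h1 h2 => ?_⟩
    rw [mul_comm (m : ℝ)]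
    exact hBA A hA n m hn hm hev h2 h1

end Rectangle

end QuadMesh

theorem mainTheorem6 :
    -- square sinks
    (∃ C : ℝ, ∀ S : QuadMesh.Rectangle, S.IsSquare →
      ∃ (B : Finset QuadMesh.Plane) (hB : (B : Set QuadMesh.Plane) ⊆ S.toPolygon.openEdges),
        B.card = 24 ∧
        QuadMesh.IsSink (S.toPolygon.addVertices B hB) ∧
        (∀ (M : ℕ) (A : Finset QuadMesh.Plane)
          (hA : (A : Set QuadMesh.Plane) ⊆ (S.toPolygon.addVertices B hB).openEdges),
          0 < M → A.card = 2 * M →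
          QuadMesh.HasNiceMeshOfSize ((S.toPolygon.addVertices B hB).addVertices A hA)
            (C * (M : ℝ) ^ 2)) ∧
        (∀ (M₁ M₂ : ℕ) (A : Finset QuadMesh.Plane)
          (hA : (A : Set QuadMesh.Plane) ⊆ (S.toPolygon.addVertices B hB).openEdges),
          1 ≤ M₁ → 1 ≤ M₂ → Even A.card →
          ((A : Set QuadMesh.Plane) ∩ S.sides₁).ncard ≤ M₁ →
          ((A : Set QuadMesh.Plane) ∩ S.sides₂).ncard ≤ M₂ →
          QuadMesh.HasNiceMeshOfSize ((S.toPolygon.addVertices B hB).addVertices A hA)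
            (C * ((M₁ : ℝ) * M₂)))) ∧
    -- rectangular sinks
    (∃ C : ℝ, ∀ R : QuadMesh.Rectangle,
      ∃ (B : Finset QuadMesh.Plane) (hB : (B : Set QuadMesh.Plane) ⊆ R.toPolygon.openEdges),
        (B.card : ℤ) ≤ 28 * ⌈QuadMesh.eccentricity R.corner⌉ ∧
        QuadMesh.IsSink (R.toPolygon.addVertices B hB) ∧
        (∀ (M₁ M₂ : ℕ) (A : Finset QuadMesh.Plane)
          (hA : (A : Set QuadMesh.Plane) ⊆ (R.toPolygon.addVertices B hB).openEdges),
          1 ≤ M₁ → 1 ≤ M₂ → Even A.card →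
          ((A : Set QuadMesh.Plane) ∩ R.sides₁).ncard ≤ M₁ →
          ((A : Set QuadMesh.Plane) ∩ R.sides₂).ncard ≤ M₂ →
          QuadMesh.HasNiceMeshOfSize ((R.toPolygon.addVertices B hB).addVertices A hA)
            (C * (QuadMesh.eccentricity R.corner + (M₁ : ℝ) * M₂)))) := by
  refine ⟨⟨3461120, fun S hS => ?_⟩, ⟨10321920, fun R => ?_⟩⟩
  · obtain ⟨B, hB, hBc, hBA⟩ := S.exists_square_sink hS
    refine ⟨B, hB, hBc, fun A hA hev => ?_, fun M A hA hM hAc => ?_,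
      fun M₁ M₂ A hA hM₁ hM₂ hev h1 h2 => ?_⟩
    -- The bounds are the actual numbers of points plus one, since they must be positive.
    · obtain ⟨T, hT, -⟩ := hBA A hA _ _ (Nat.le_add_left 1 _) (Nat.le_add_left 1 _) hev
        (Nat.le_succ _) (Nat.le_succ _)
      exact ⟨T, hT⟩
    · have hle : ∀ U : Set QuadMesh.Plane, ((A : Set QuadMesh.Plane) ∩ U).ncard ≤ 2 * M := by
        intro U
        rw [← hAc, ← Set.ncard_coe_finset]
        exact Set.ncard_le_ncard Set.inter_subset_left A.finite_toSet
      -- Each pair of sides contains at most all `2 * M` new points, which gives the factor `4` in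
      -- the constant.
      obtain ⟨T, hT, hTc⟩ := hBA A hA (2 * M) (2 * M) (by omega) (by omega)
        (hAc ▸ even_two_mul M) (hle _) (hle _)
      refine ⟨T, hT, hTc.trans_eq ?_⟩
      push_cast; ring
    · obtain ⟨T, hT, hTc⟩ := hBA A hA M₁ M₂ hM₁ hM₂ hev h1 h2
      refine ⟨T, hT, hTc.trans ?_⟩
      gcongr
      norm_num
  · obtain ⟨B, hB, hBc, hBA⟩ := R.exists_sink
    refine ⟨B, hB, hBc, fun A hA hev => ?_, fun M₁ M₂ A hA hM₁ hM₂ hev h1 h2 =>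
      hBA A hA M₁ M₂ hM₁ hM₂ hev h1 h2⟩
    obtain ⟨T, hT, -⟩ := hBA A hA _ _ (Nat.le_add_left 1 _) (Nat.le_add_left 1 _) hev
      (Nat.le_succ _) (Nat.le_succ _)
    exact ⟨T, hT⟩
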